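/- Let $M$ be a smooth (Hausdorff, second countable) manifold of dimension $n$ without boundary, let $t_0\in\mathbb R$, and let $\mathcal V=M\times(t_0,\infty)$ carry the smooth Lorentzian metric $$ {}^{(n+1)}g=-N^2\,dt^2+g_{ij}\,(dx^i+\beta^i dt)(dx^j+\beta^j dt),$$ where the lapse $N$, the shift $\beta$ (a $t$-dependent vector field on $M$) and the $t$-dependent Riemannian metric $g_t=g_{ij}dx^idx^j$ on $M$ are smooth on $\mathcal V$; time-orient $\mathcal V$ by increasing $t$. Assume: (Bounded lapse) there are constants $N_m,N_M$ with $0<N_m\le N\le N_M$ on $\mathcal V$; (Slice completeness) for every $t>t_0$ the Riemannian metric $g_t$ on $M$ is complete, and there are a complete Riemannian metric $\gamma$ on $M$ and a number $A>0$ with $A\,\gamma_{ij}v^iv^j\le g_{ij}v^iv^j$ for all $t>t_0$ and all tangent vectors $v$ of $M$. Let $\nabla N$ be the gradient of $N$ along the slices $M\times\{t\}$, and let $K_{ij}=-N\Gamma^0_{ij}$ be the extrinsic curvature of the slices, $\Gamma$ being the connection coefficients of ${}^{(n+1)}g$; put $|\nabla N|_g=(g^{ij}\partial_iN\,\partial_jN)^{1/2}$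 and $|K|_g=(g^{ik}g^{jl}K_{ij}K_{kl})^{1/2}$. Suppose that for every $t_1\in(t_0,\infty)$ 1. $|\nabla N|_g$ is bounded on $M\times[t_1,\infty)$ by a function of $t$ alone that is integrable on $[t_1,\infty)$; 2. $|K|_g$ is bounded on $M\times[t_1,\infty)$ by a function of $t$ alone that is integrable on $[t_1,\infty)$. Then $(\mathcal V,{}^{(n+1)}g)$ is future timelike and null geodesically complete: every affinely parametrized future-directed timelike geodesic, and every affinely parametrized future-directed null geodesic, defined for $s\in[a,b)$, extends to such a geodesic defined for all $s\in[a,\infty)$. Moreover, along each future-directed timelike or null geodesic $s\in[a,\infty)\mapsto c(s)\in\mathcal V$ the function $dt/ds$ is bounded above. -/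

import Mathlib

open Set Filter Topology MeasureTheory
open scoped Manifold ContDiff Bundle ENNReal

noncomputable section

/-! ### Geodesics of a metric tensor on a manifold without boundary -/

section Geodesics

variable {E : Type*} [NormedAddCommGroup E] [NormedSpace ℝ E]
  {H : Type*} [TopologicalSpace H] (I : ModelWithCorners ℝ E H)
  {V : Type*} [TopologicalSpace V] [ChartedSpace H V]

/-- The metric tensor `G` written in the chart around `p₀`: the form
`(u, v) ↦ G(∂φ⁻¹ u, ∂φ⁻¹ v)` at the point with coordinates `y`. -/
def metricInChart (G : ∀ p : V, TangentSpace I p → TangentSpace I p → ℝ) (p₀ : V)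
    (y u v : E) : ℝ :=
  G ((extChartAt I p₀).symm y)
    (mfderivWithin 𝓘(ℝ, E) I (extChartAt I p₀).symm (range I) y u)
    (mfderivWithin 𝓘(ℝ, E) I (extChartAt I p₀).symm (range I) y v)

/-- The Christoffel symbols of the first kind of `G` in the chart around `p₀`, with constant
coefficient vector fields `u, v, w` in place of the coordinate fields:
`[u v, w] = ½ (∂ᵤ G(v, w) + ∂ᵥ G(u, w) - ∂_w G(u, v)) = G(∇ᵤ v, w)`. -/
def christoffelFirst (G : ∀ p : V, TangentSpace I p → TangentSpace I p → ℝ) (p₀ : V)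
    (y u v w : E) : ℝ :=
  (fderiv ℝ (fun z => metricInChart I G p₀ z v w) y u
    + fderiv ℝ (fun z => metricInChart I G p₀ z u w) y v
    - fderiv ℝ (fun z => metricInChart I G p₀ z u v) y w) / 2

/-- The velocity `c'(s)` of a curve defined on an interval `J`. -/
def curveVelocity (c : ℝ → V) (J : Set ℝ) (s : ℝ) : TangentSpace I (c s) :=
  mfderivWithin 𝓘(ℝ, ℝ) I c J s (1 : ℝ)

/-- `c : J → V` is an affinely parametrized geodesic of `G`: it is of class `C²` and, in every
chart, its coordinate expression `ξ` satisfies `ξ'' + Γ(ξ', ξ') = 0`, an equation which is written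
here with the index lowered by the metric, `G(ξ'', w) + [ξ' ξ', w] = 0` for all `w`. -/
def IsGeodesicOn (G : ∀ p : V, TangentSpace I p → TangentSpace I p → ℝ)
    (c : ℝ → V) (J : Set ℝ) : Prop :=
  ContMDiffOn 𝓘(ℝ, ℝ) I 2 c J ∧
  ∀ s ∈ J, ∀ p₀ : V, c s ∈ (extChartAt I p₀).source →
    let ξ : ℝ → E := fun r => extChartAt I p₀ (c r)
    ∀ w : E,
      metricInChart I G p₀ (ξ s) (derivWithin (derivWithin ξ J) J s) w
        + christoffelFirst I G p₀ (ξ s) (derivWithin ξ J s) (derivWithin ξ J s) w = 0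

end Geodesics

/-! ### Riemannian metrics on the slice manifold -/

section Slices

variable {n : ℕ} {M : Type*} [TopologicalSpace M]
  [ChartedSpace (EuclideanSpace ℝ (Fin n)) M]

/-- A Riemannian metric is complete if all Cauchy sequences for its Riemannian distance (the
infimum of the lengths of `C¹` paths) converge in the manifold. -/
def IsCompleteRiemannian
    (h : Bundle.RiemannianMetric (fun x : M => TangentSpace (𝓡 n) x)) : Prop :=
  letI : Bundle.RiemannianBundle (fun x : M => TangentSpace (𝓡 n) x) := ⟨h⟩
  ∀ a : ℕ → M,
    (∀ ε : ℝ≥0∞, 0 < ε →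
      ∃ k, ∀ i ≥ k, ∀ j ≥ k, Manifold.riemannianEDist (𝓡 n) (a i) (a j) < ε) →
    ∃ x, Tendsto a atTop (𝓝 x)

/-- A positive definite bilinear form on a finite dimensional space has bounded unit ball. -/
theorem isVonNBounded_of_posDef {F : Type*} [NormedAddCommGroup F] [NormedSpace ℝ F]
    [FiniteDimensional ℝ F] (b : F →L[ℝ] F →L[ℝ] ℝ) (hb : ∀ v, v ≠ 0 → 0 < b v v) :
    Bornology.IsVonNBounded ℝ {v : F | b v v < 1} := by
  rw [NormedSpace.isVonNBounded_iff]
  have hcont : Continuous (fun v : F => b v v) := by fun_prop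
  rcases (Metric.sphere (0 : F) 1).eq_empty_or_nonempty with he | hne
  · have hz : ∀ v : F, v = 0 := by
      intro v
      by_contra hv
      have : (‖v‖⁻¹ • v) ∈ Metric.sphere (0 : F) 1 := by
        simp [norm_smul, norm_ne_zero_iff.2 hv]
      rw [he] at this
      exact this
    exact (Bornology.isBounded_singleton (x := (0 : F))).subset fun v _ => hz v
  · obtain ⟨e, he, hmin⟩ :=
      (isCompact_sphere (0 : F) 1).exists_isMinOn hne hcont.continuousOn
    have he0 : e ≠ 0 := by
      rintro rfl
      simp at he
    have hc : 0 < b e e := hb e he0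
    rw [isBounded_iff_forall_norm_le]
    refine ⟨Real.sqrt (1 / b e e), fun v hv => Real.le_sqrt_of_sq_le ?_⟩
    rw [le_div_iff₀ hc]
    rcases eq_or_ne v 0 with rfl | hv0
    · simp
    have hn : ‖v‖ ≠ 0 := norm_ne_zero_iff.2 hv0
    have hmem : (‖v‖⁻¹ • v) ∈ Metric.sphere (0 : F) 1 := by
      simp [norm_smul, hn]
    have h1 : b e e ≤ b (‖v‖⁻¹ • v) (‖v‖⁻¹ • v) := hmin hmem
    have h2 : b (‖v‖⁻¹ • v) (‖v‖⁻¹ • v) = b v v / ‖v‖ ^ 2 := by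
      simp only [map_smul, smul_eq_mul, _root_.smul_apply]
      field_simp
    rw [h2, le_div_iff₀ (by positivity)] at h1
    have h3 : b v v < 1 := hv
    linarith

end Slices

/-! ### The spacetime -/

/-- The data of a smooth `n + 1` splitting on `M × (t₀, ∞)`: the lapse `N`, the shift `β` and the
time dependent Riemannian metric `g_t`, all smooth on `M × (t₀, ∞)`. The functions are defined for
all real `t`, but their values for `t ≤ t₀` are arbitrary and irrelevant. -/
structure SplitMetric (n : ℕ) (M : Type*) [TopologicalSpace M]
    [ChartedSpace (EuclideanSpace ℝ (Fin n)) M] [IsManifold (𝓡 n) ∞ M] (t₀ : ℝ) where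
  lapse : ℝ → M → ℝ
  shift : (t : ℝ) → (x : M) → TangentSpace (𝓡 n) x
  metric : (t : ℝ) → (x : M) → TangentSpace (𝓡 n) x →L[ℝ] TangentSpace (𝓡 n) x →L[ℝ] ℝ
  metric_symm : ∀ t, t₀ < t → ∀ x v w, metric t x v w = metric t x w v
  metric_pos : ∀ t, t₀ < t → ∀ x v, v ≠ 0 → 0 < metric t x v v
  lapse_smooth : ContMDiffOn ((𝓡 n).prod 𝓘(ℝ, ℝ)) 𝓘(ℝ, ℝ) ∞
    (fun p : M × ℝ => lapse p.2 p.1) {p | t₀ < p.2}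
  shift_smooth : ContMDiffOn ((𝓡 n).prod 𝓘(ℝ, ℝ))
    ((𝓡 n).prod 𝓘(ℝ, EuclideanSpace ℝ (Fin n))) ∞
    (fun p : M × ℝ => Bundle.TotalSpace.mk' (EuclideanSpace ℝ (Fin n))
      (E := fun x : M => TangentSpace (𝓡 n) x) p.1 (shift p.2 p.1)) {p | t₀ < p.2}
  metric_smooth : ContMDiffOn ((𝓡 n).prod 𝓘(ℝ, ℝ))
    ((𝓡 n).prod 𝓘(ℝ, EuclideanSpace ℝ (Fin n) →L[ℝ] EuclideanSpace ℝ (Fin n) →L[ℝ] ℝ)) ∞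
    (fun p : M × ℝ => Bundle.TotalSpace.mk'
      (EuclideanSpace ℝ (Fin n) →L[ℝ] EuclideanSpace ℝ (Fin n) →L[ℝ] ℝ)
      (E := fun x : M => TangentSpace (𝓡 n) x →L[ℝ] TangentSpace (𝓡 n) x →L[ℝ] ℝ)
      p.1 (metric p.2 p.1)) {p | t₀ < p.2}

namespace SplitMetric

variable {n : ℕ} {M : Type*} [TopologicalSpace M]
  [ChartedSpace (EuclideanSpace ℝ (Fin n)) M] [IsManifold (𝓡 n) ∞ M] {t₀ : ℝ}

/-- The Riemannian metric `g_t` of the slice `M × {t}`. -/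
def slice (S : SplitMetric n M t₀) (t : ℝ) (ht : t₀ < t) :
    Bundle.ContMDiffRiemannianMetric (𝓡 n) ∞ (EuclideanSpace ℝ (Fin n))
      (fun x : M => TangentSpace (𝓡 n) x) where
  inner := S.metric t
  symm := S.metric_symm t ht
  pos := S.metric_pos t ht
  isVonNBounded x := isVonNBounded_of_posDef (F := EuclideanSpace ℝ (Fin n)) (S.metric t x)
    (S.metric_pos t ht x)
  contMDiff := by
    have h : ContMDiff (𝓡 n) ((𝓡 n).prod 𝓘(ℝ, ℝ)) ∞ (fun x : M => (x, t)) :=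
      contMDiff_id.prodMk contMDiff_const
    exact S.metric_smooth.comp_contMDiff h fun _ => ht

/-- The spacetime metric `-N² dt² + g_ij (dxⁱ + βⁱ dt)(dxʲ + βʲ dt)`. A tangent vector of
`M × ℝ` is a pair: its component along `M` and its `dt` component. -/
def spacetimeMetric (S : SplitMetric n M t₀) (p : M × ℝ)
    (u v : TangentSpace ((𝓡 n).prod 𝓘(ℝ, ℝ)) p) : ℝ :=
  let u' : TangentSpace (𝓡 n) p.1 × ℝ := u;
  let v' : TangentSpace (𝓡 n) p.1 × ℝ := v;
  (-(S.lapse p.2 p.1) ^ 2) * u'.2 * v'.2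
    + S.metric p.2 p.1 (u'.1 + u'.2 • S.shift p.2 p.1) (v'.1 + v'.2 • S.shift p.2 p.1)

/-- The frame vector `e₀ = ∂_t - β`, orthogonal to the slices. -/
def frameZero (S : SplitMetric n M t₀) (t : ℝ) (x : M) :
    TangentSpace ((𝓡 n).prod 𝓘(ℝ, ℝ)) ((x, t) : M × ℝ) :=
  ((-S.shift t x, 1) : TangentSpace (𝓡 n) x × ℝ)

/-- `e₀ = -N² grad t`. -/
theorem spacetimeMetric_frameZero (S : SplitMetric n M t₀) (t : ℝ) (x : M)
    (v : TangentSpace (𝓡 n) x) (a : ℝ) :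
    S.spacetimeMetric (x, t) (S.frameZero t x) ((v, a) : TangentSpace (𝓡 n) x × ℝ)
      = -(S.lapse t x) ^ 2 * a := by
  simp [spacetimeMetric, frameZero]

/-- The extrinsic curvature `K_ij = -N Γ⁰_ij` of the slice `M × {t}` at `x`, where `Γ` are the
connection coefficients of the spacetime metric. Since `Γ⁰_ij = dt(∇_i ∂_j)` and
`dt = -N⁻² G(e₀, ·)`, it is `N⁻¹ [∂_i ∂_j, e₀]`, computed in the chart around `(x, t)`, in which
coordinate vectors and tangent vectors at `(x, t)` are identified. -/
def extrinsicCurvature (S : SplitMetric n M t₀) (t : ℝ) (x : M)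
    (v w : TangentSpace (𝓡 n) x) : ℝ :=
  (S.lapse t x)⁻¹ *
    christoffelFirst ((𝓡 n).prod 𝓘(ℝ, ℝ)) S.spacetimeMetric ((x, t) : M × ℝ)
      (extChartAt ((𝓡 n).prod 𝓘(ℝ, ℝ)) ((x, t) : M × ℝ) (x, t))
      ((v, 0) : EuclideanSpace ℝ (Fin n) × ℝ) ((w, 0) : EuclideanSpace ℝ (Fin n) × ℝ)
      (S.frameZero t x)

/-- The coordinate basis vectors `∂_i` of `T_x M`. -/
def coordVector (x : M) (i : Fin n) : TangentSpace (𝓡 n) x :=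
  (EuclideanSpace.single i (1 : ℝ) : EuclideanSpace ℝ (Fin n))

/-- The matrix `g_ij` of the metric of the slice at `x`. -/
def gram (S : SplitMetric n M t₀) (t : ℝ) (x : M) : Matrix (Fin n) (Fin n) ℝ :=
  fun i j => S.metric t x (coordVector x i) (coordVector x j)

/-- The derivative `∂_i N` of the lapse along the slice. -/
def lapseDeriv (S : SplitMetric n M t₀) (t : ℝ) (x : M) (i : Fin n) : ℝ :=
  mfderiv (𝓡 n) 𝓘(ℝ, ℝ) (S.lapse t) x (coordVector x i)

/-- `|∇N|_g = (g^{ij} ∂_i N ∂_j N)^{1/2}`. -/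
def normGradLapse (S : SplitMetric n M t₀) (t : ℝ) (x : M) : ℝ :=
  Real.sqrt (∑ i, ∑ j, (S.gram t x)⁻¹ i j * S.lapseDeriv t x i * S.lapseDeriv t x j)

/-- `|K|_g = (g^{ik} g^{jl} K_ij K_kl)^{1/2}`. -/
def normExtrinsicCurvature (S : SplitMetric n M t₀) (t : ℝ) (x : M) : ℝ :=
  Real.sqrt (∑ i, ∑ j, ∑ k, ∑ l, (S.gram t x)⁻¹ i k * (S.gram t x)⁻¹ j l
    * S.extrinsicCurvature t x (coordVector x i) (coordVector x j)
    * S.extrinsicCurvature t x (coordVector x k) (coordVector x l))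

/-- The lapse lies between two positive constants. -/
def BoundedLapse (S : SplitMetric n M t₀) : Prop :=
  ∃ Nm NM : ℝ, 0 < Nm ∧ ∀ t, t₀ < t → ∀ x, Nm ≤ S.lapse t x ∧ S.lapse t x ≤ NM

/-- Every slice is complete, and the slice metrics are uniformly bounded below by a fixed complete
Riemannian metric `γ` on `M`. -/
def SliceComplete (S : SplitMetric n M t₀) : Prop :=
  (∀ t (ht : t₀ < t), IsCompleteRiemannian (S.slice t ht).toRiemannianMetric) ∧
  ∃ γ : Bundle.ContMDiffRiemannianMetric (𝓡 n) ∞ (EuclideanSpace ℝ (Fin n))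
      (fun x : M => TangentSpace (𝓡 n) x),
    IsCompleteRiemannian γ.toRiemannianMetric ∧
    ∃ A : ℝ, 0 < A ∧ ∀ t, t₀ < t → ∀ (x : M) (v : TangentSpace (𝓡 n) x),
      A * γ.inner x v v ≤ S.metric t x v v

/-- The rate `dt/ds` along a curve defined on the interval `J`. -/
def timeRate (c : ℝ → M × ℝ) (J : Set ℝ) (s : ℝ) : ℝ :=
  derivWithin (fun r => (c r).2) J s

/-- `c` is a geodesic of the spacetime `M × (t₀, ∞)` defined on the interval `J`. -/
def IsSpacetimeGeodesicOn (S : SplitMetric n M t₀) (c : ℝ → M × ℝ) (J : Set ℝ) : Prop :=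
  (∀ s ∈ J, t₀ < (c s).2) ∧ IsGeodesicOn ((𝓡 n).prod 𝓘(ℝ, ℝ)) S.spacetimeMetric c J

/-- Future-directed timelike geodesics: the velocity is timelike and `t` increases. -/
def IsFutureTimelikeGeodesicOn (S : SplitMetric n M t₀) (c : ℝ → M × ℝ) (J : Set ℝ) : Prop :=
  S.IsSpacetimeGeodesicOn c J ∧ ∀ s ∈ J,
    S.spacetimeMetric (c s) (curveVelocity ((𝓡 n).prod 𝓘(ℝ, ℝ)) c J s)
      (curveVelocity ((𝓡 n).prod 𝓘(ℝ, ℝ)) c J s) < 0 ∧ 0 < timeRate c J s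

/-- Future-directed null geodesics: the velocity is null (and nonzero) and `t` increases. -/
def IsFutureNullGeodesicOn (S : SplitMetric n M t₀) (c : ℝ → M × ℝ) (J : Set ℝ) : Prop :=
  S.IsSpacetimeGeodesicOn c J ∧ ∀ s ∈ J,
    S.spacetimeMetric (c s) (curveVelocity ((𝓡 n).prod 𝓘(ℝ, ℝ)) c J s)
      (curveVelocity ((𝓡 n).prod 𝓘(ℝ, ℝ)) c J s) = 0 ∧ 0 < timeRate c J s

/-- Every future-directed timelike geodesic extends to arbitrarily large values of its affine
parameter. -/
def FutureTimelikeComplete (S : SplitMetric n M t₀) : Prop :=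
  ∀ (a b : ℝ) (c : ℝ → M × ℝ), a < b → S.IsFutureTimelikeGeodesicOn c (Ico a b) →
    ∃ c' : ℝ → M × ℝ, S.IsFutureTimelikeGeodesicOn c' (Ici a) ∧ EqOn c' c (Ico a b)

/-- Every future-directed null geodesic extends to arbitrarily large values of its affine
parameter. -/
def FutureNullComplete (S : SplitMetric n M t₀) : Prop :=
  ∀ (a b : ℝ) (c : ℝ → M × ℝ), a < b → S.IsFutureNullGeodesicOn c (Ico a b) →
    ∃ c' : ℝ → M × ℝ, S.IsFutureNullGeodesicOn c' (Ici a) ∧ EqOn c' c (Ico a b)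

end SplitMetric

end

/-!
# Completeness of causal geodesics under integrable bounds on the extrinsic curvature

Let `E = N dt/ds` be the energy of a future-directed causal geodesic with respect to the observers
normal to the slices. Contracting the geodesic equation with `e₀ = ∂_t - β` gives
`|dE/ds| ≤ E (dt/ds) (|∇N| + N |K|)` (`hasDerivWithinAt_energy`): the velocity is causal, so that
its part tangent to the slices has length at most `E`. As the bounds on `|∇N|` and `|K|` are
integrable in `t`, `log E` is bounded above and below (`abs_log_energy_le`), and with the bounds on
the lapse `dt/ds` lies between two positive constants (`exists_timeRate_bounds`). This is the last
claim of the theorem, and shows that `t` has a finite limit `T` at the end of a bounded interval.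

It remains to see that the projection to `M` of a causal geodesic on a bounded interval converges.
The shift is not assumed to be bounded, so the length of this projection is not controlled. The
geodesic is compared instead with the normal curves of the slices, the integral curves of `e₀`:
along the normal flow the slice metric changes by `-2 N K`, so that this flow stretches lengths by
at most `exp (∫ N |K| dt)`. Hence the transport of the geodesic along the normal flow to the slice
at time `T` is Lipschitz in the parameter (`sliceEDist_flow_le`), and it converges because this
slice is complete (`exists_tendsto_flow`). That the normal curves do not leave `M` before the time
`T` follows from the same estimate: the set of the points of a path from which the time `T` is
reached is open, and closed by completeness (`survives_of_forall_Ico`), and a vertical path starting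
near the slice at time `T` connects the situation to one where a flow box suffices
(`survives_of_lt`). Stretching is estimated by chords in charts instead of by the differential of
the flow: the squared chord `Q` of two nearby normal curves satisfies
`Q(T') ≤ Q(T) exp (2 ∫ N |K| + O(√Q(T)))` (`exists_chordSq_le`), and these estimates are multiplied
along a normal curve (`chordLE_flow_path`).

A geodesic with an end point in the spacetime, whose velocity is bounded in a chart by the bound on
its energy, solves a first order system of class `C¹` and stays in a compact set, and can be
continued (`exists_continuation`). Zorn's lemma yields a continuation to all larger parameters
(`exists_geodesicAt_Ici`).
-/

noncomputable section

set_option linter.unusedSectionVars false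

/-! ### The metric data in charts of the slice manifold -/

namespace SplitMetric

variable {n : ℕ} {M : Type*} [TopologicalSpace M]
  [ChartedSpace (EuclideanSpace ℝ (Fin n)) M] [IsManifold (𝓡 n) ∞ M] {t₀ : ℝ}

local notation "𝓔" => EuclideanSpace ℝ (Fin n)

/-- The range in `𝓔 × ℝ` of the product chart around `x₀`, the domain on which the coordinate
expressions of the lapse, the shift and the metric are smooth. The argument `S` is only used to
determine `t₀`. -/
def chartDom (_S : SplitMetric n M t₀) (x₀ : M) : Set (𝓔 × ℝ) :=
  (extChartAt (𝓡 n) x₀).target ×ˢ Ioi t₀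

theorem isOpen_chartDom (S : SplitMetric n M t₀) (x₀ : M) : IsOpen (S.chartDom x₀) :=
  (isOpen_extChartAt_target x₀).prod isOpen_Ioi

/-- The derivative of the inverse of the chart around `x₀`, with values in the model space. -/
def chartSymmD (x₀ : M) (y : 𝓔) : 𝓔 →L[ℝ] 𝓔 :=
  mfderivWithin 𝓘(ℝ, 𝓔) (𝓡 n) (extChartAt (𝓡 n) x₀).symm (range (𝓡 n)) y

/-- The derivative of the chart around `x₀`, with values in the model space. -/
def chartD (n : ℕ) {M : Type*} [TopologicalSpace M]
    [ChartedSpace (EuclideanSpace ℝ (Fin n)) M] (x₀ x : M) :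
    EuclideanSpace ℝ (Fin n) →L[ℝ] EuclideanSpace ℝ (Fin n) :=
  mfderiv (𝓡 n) (𝓡 n) (extChartAt (𝓡 n) x₀) x

/-- The lapse in the chart around `x₀`. -/
def lapseC (S : SplitMetric n M t₀) (x₀ : M) (z : 𝓔 × ℝ) : ℝ :=
  S.lapse z.2 ((extChartAt (𝓡 n) x₀).symm z.1)

/-- The slice metric at a point, as a form on the model space. -/
def metricE (S : SplitMetric n M t₀) (t : ℝ) (x : M) : 𝓔 →L[ℝ] 𝓔 →L[ℝ] ℝ := S.metric t x

/-- The shift at a point, as a vector of the model space. -/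
def shiftE (S : SplitMetric n M t₀) (t : ℝ) (x : M) : 𝓔 := S.shift t x

/-- The slice metric in the chart around `x₀`. -/
def metricC (S : SplitMetric n M t₀) (x₀ : M) (z : 𝓔 × ℝ) : 𝓔 →L[ℝ] 𝓔 →L[ℝ] ℝ :=
  (S.metricE z.2 ((extChartAt (𝓡 n) x₀).symm z.1)).bilinearComp
    (chartSymmD x₀ z.1) (chartSymmD x₀ z.1)

/-- The shift in the chart around `x₀`. -/
def shiftC (S : SplitMetric n M t₀) (x₀ : M) (z : 𝓔 × ℝ) : 𝓔 :=
  chartD n x₀ ((extChartAt (𝓡 n) x₀).symm z.1) (S.shiftE z.2 ((extChartAt (𝓡 n) x₀).symm z.1))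

theorem chartD_comp_chartSymmD {x₀ : M} {y : 𝓔} (hy : y ∈ (extChartAt (𝓡 n) x₀).target) (v : 𝓔) :
    chartD n x₀ ((extChartAt (𝓡 n) x₀).symm y) (chartSymmD x₀ y v) = v :=
  have : IsManifold (𝓡 n) 1 M := IsManifold.of_le (n := ∞) (by norm_cast)
  DFunLike.congr_fun (mfderiv_extChartAt_comp_mfderivWithin_extChartAt_symm (I := 𝓡 n) hy) v

theorem chartSymmD_comp_chartD {x₀ : M} {y : 𝓔} (hy : y ∈ (extChartAt (𝓡 n) x₀).target) (v : 𝓔) :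
    chartSymmD x₀ y (chartD n x₀ ((extChartAt (𝓡 n) x₀).symm y) v) = v :=
  have : IsManifold (𝓡 n) 1 M := IsManifold.of_le (n := ∞) (by norm_cast)
  DFunLike.congr_fun (mfderivWithin_extChartAt_symm_comp_mfderiv_extChartAt (I := 𝓡 n) hy) v

theorem chartSymmD_self (x : M) : chartSymmD x (extChartAt (𝓡 n) x x) = ContinuousLinearMap.id ℝ 𝓔 :=
  have : IsManifold (𝓡 n) 1 M := IsManifold.of_le (n := ∞) (by norm_cast)
  mfderivWithin_range_extChartAt_symm (I := 𝓡 n)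

theorem chartD_self (x : M) : chartD n x x = ContinuousLinearMap.id ℝ 𝓔 :=
  have : IsManifold (𝓡 n) 1 M := IsManifold.of_le (n := ∞) (by norm_cast)
  mfderiv_extChartAt_self (I := 𝓡 n)

theorem contMDiffAt_chartInverse {x₀ : M} {z : 𝓔 × ℝ} (hz : z.1 ∈ (extChartAt (𝓡 n) x₀).target) :
    ContMDiffAt 𝓘(ℝ, 𝓔 × ℝ) ((𝓡 n).prod 𝓘(ℝ, ℝ)) ∞
      (fun z : 𝓔 × ℝ => (((extChartAt (𝓡 n) x₀).symm z.1, z.2) : M × ℝ)) z := by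
  have h1 : ContMDiffAt 𝓘(ℝ, 𝓔) (𝓡 n) ∞ (extChartAt (𝓡 n) x₀).symm z.1 :=
    (contMDiffOn_extChartAt_symm x₀).contMDiffAt ((isOpen_extChartAt_target x₀).mem_nhds hz)
  have h2 : ContMDiffAt 𝓘(ℝ, 𝓔 × ℝ) 𝓘(ℝ, 𝓔) ∞ (fun z : 𝓔 × ℝ => z.1) z :=
    contDiff_fst.contMDiff.contMDiffAt
  have h3 : ContMDiffAt 𝓘(ℝ, 𝓔 × ℝ) 𝓘(ℝ, ℝ) ∞ (fun z : 𝓔 × ℝ => z.2) z :=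
    contDiff_snd.contMDiff.contMDiffAt
  exact (h1.comp z h2).prodMk h3

theorem isOpen_timeDom : IsOpen {p : M × ℝ | t₀ < p.2} := isOpen_lt continuous_const continuous_snd

theorem contDiffAt_lapseC (S : SplitMetric n M t₀) {x₀ : M} {z : 𝓔 × ℝ} (hz : z ∈ S.chartDom x₀) :
    ContDiffAt ℝ ∞ (S.lapseC x₀) z := by
  rw [← contMDiffAt_iff_contDiffAt]
  have h1 := S.lapse_smooth.contMDiffAt
    (x := ((extChartAt (𝓡 n) x₀).symm z.1, z.2)) (isOpen_timeDom.mem_nhds hz.2)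
  exact h1.comp z (contMDiffAt_chartInverse hz.1)

theorem chart_mem_baseSet {x₀ : M} {y : 𝓔} (hy : y ∈ (extChartAt (𝓡 n) x₀).target) :
    (extChartAt (𝓡 n) x₀).symm y ∈ (chartAt 𝓔 x₀).source := by
  rw [← extChartAt_source (𝓡 n)]; exact (extChartAt (𝓡 n) x₀).map_target hy

theorem contDiffAt_shiftC (S : SplitMetric n M t₀) {x₀ : M} {z : 𝓔 × ℝ} (hz : z ∈ S.chartDom x₀) :
    ContDiffAt ℝ ∞ (S.shiftC x₀) z := by
  have : IsManifold (𝓡 n) 1 M := IsManifold.of_le (n := ∞) (by norm_cast)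
  rw [← contMDiffAt_iff_contDiffAt]
  have h1 := S.shift_smooth.contMDiffAt
    (x := ((extChartAt (𝓡 n) x₀).symm z.1, z.2)) (isOpen_timeDom.mem_nhds hz.2)
  have h2 := h1.comp z (contMDiffAt_chartInverse hz.1)
  have hb := chart_mem_baseSet hz.1
  have h3 := ((trivializationAt 𝓔 (fun x : M => TangentSpace (𝓡 n) x) x₀).contMDiffAt_iff
    (IM := 𝓘(ℝ, 𝓔 × ℝ)) (IB := 𝓡 n) (n := ∞)
    (by
      rw [Bundle.Trivialization.mem_source]
      exact hb)).1 h2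
  refine h3.2.congr_of_eventuallyEq ?_
  filter_upwards [(S.isOpen_chartDom x₀).mem_nhds hz] with w hw
  have hb' := chart_mem_baseSet hw.1
  have h4 := TangentBundle.continuousLinearMapAt_trivializationAt (I := 𝓡 n) hb'
  have h5 : S.shiftC x₀ w = (trivializationAt 𝓔 (fun x : M => TangentSpace (𝓡 n) x)
      x₀).continuousLinearMapAt ℝ ((extChartAt (𝓡 n) x₀).symm w.1)
      (S.shift w.2 ((extChartAt (𝓡 n) x₀).symm w.1)) := by
    rw [h4]; rfl
  rw [h5]
  rw [Bundle.Trivialization.continuousLinearMapAt_apply,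
    Bundle.Trivialization.linearMapAt_apply, if_pos (by exact hb')]
  rfl

set_option synthInstance.maxHeartbeats 200000 in
theorem contDiffAt_metricC (S : SplitMetric n M t₀) {x₀ : M} {z : 𝓔 × ℝ}
    (hz : z ∈ S.chartDom x₀) : ContDiffAt ℝ ∞ (S.metricC x₀) z := by
  have : IsManifold (𝓡 n) 1 M := IsManifold.of_le (n := ∞) (by norm_cast)
  rw [← contMDiffAt_iff_contDiffAt]
  have h1 := S.metric_smooth.contMDiffAt
    (x := ((extChartAt (𝓡 n) x₀).symm z.1, z.2)) (isOpen_timeDom.mem_nhds hz.2)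
  have h2 := h1.comp z (contMDiffAt_chartInverse hz.1)
  have hb := chart_mem_baseSet hz.1
  have h3 := ((trivializationAt (𝓔 →L[ℝ] 𝓔 →L[ℝ] ℝ)
    (fun x : M => TangentSpace (𝓡 n) x →L[ℝ] TangentSpace (𝓡 n) x →L[ℝ] ℝ) x₀).contMDiffAt_iff
    (by
      rw [Bundle.Trivialization.mem_source]
      exact ⟨hb, hb, mem_univ _⟩)).1 h2
  refine h3.2.congr_of_eventuallyEq ?_
  filter_upwards [(S.isOpen_chartDom x₀).mem_nhds hz] with w hw
  have hb' := chart_mem_baseSet hw.1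
  have h4 := TangentBundle.symmL_trivializationAt (I := 𝓡 n) hb'
  rw [(extChartAt (𝓡 n) x₀).right_inv hw.1] at h4
  ext u v
  rw [hom_trivializationAt_apply]
  dsimp only [Function.comp_apply]
  erw [inCoordinates_apply_eq₂ hb' hb' (mem_univ _)]
  have h5 : ∀ u : 𝓔, chartSymmD x₀ w.1 u = (trivializationAt 𝓔 (fun x : M => TangentSpace (𝓡 n) x)
    x₀).symm ((extChartAt (𝓡 n) x₀).symm w.1) u := by
    intro u
    rw [← Bundle.Trivialization.symmL_apply (R := ℝ), h4]; rfl
    exact hb'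
  have h6 : S.metricC x₀ w u v = S.metricE w.2 ((extChartAt (𝓡 n) x₀).symm w.1)
      (chartSymmD x₀ w.1 u) (chartSymmD x₀ w.1 v) := rfl
  rw [h6, h5, h5]
  erw [Bundle.Trivialization.linearMapAt_apply]
  rw [if_pos (by exact mem_univ _)]
  rfl

/-- The transition map between the charts around `x₀` and `x₁`. -/
def transition (n : ℕ) {M : Type*} [TopologicalSpace M]
    [ChartedSpace (EuclideanSpace ℝ (Fin n)) M] (x₀ x₁ : M) (y : EuclideanSpace ℝ (Fin n)) :
    EuclideanSpace ℝ (Fin n) :=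
  extChartAt (𝓡 n) x₁ ((extChartAt (𝓡 n) x₀).symm y)

theorem contDiffAt_transition {x₀ x₁ : M} {y : 𝓔} (hy : y ∈ (extChartAt (𝓡 n) x₀).target)
    (hy' : (extChartAt (𝓡 n) x₀).symm y ∈ (extChartAt (𝓡 n) x₁).source) :
    ContDiffAt ℝ ∞ (transition n x₀ x₁) y := by
  rw [← contMDiffAt_iff_contDiffAt]
  have h1 : ContMDiffAt 𝓘(ℝ, 𝓔) (𝓡 n) ∞ (extChartAt (𝓡 n) x₀).symm y :=
    (contMDiffOn_extChartAt_symm x₀).contMDiffAt ((isOpen_extChartAt_target x₀).mem_nhds hy)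
  have h2 : ContMDiffAt (𝓡 n) 𝓘(ℝ, 𝓔) ∞ (extChartAt (𝓡 n) x₁) ((extChartAt (𝓡 n) x₀).symm y) :=
    contMDiffAt_extChartAt' (by rwa [← extChartAt_source (𝓡 n)])
  exact h2.comp y h1

theorem hasFDerivAt_transition {x₀ x₁ : M} {y : 𝓔} (hy : y ∈ (extChartAt (𝓡 n) x₀).target)
    (hy' : (extChartAt (𝓡 n) x₀).symm y ∈ (extChartAt (𝓡 n) x₁).source) :
    HasFDerivAt (transition n x₀ x₁)
      ((chartD n x₁ ((extChartAt (𝓡 n) x₀).symm y)).comp (chartSymmD x₀ y)) y := by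
  have : IsManifold (𝓡 n) 1 M := IsManifold.of_le (n := ∞) (by norm_cast)
  have h1 := (mdifferentiableWithinAt_extChartAt_symm (I := 𝓡 n) hy).hasMFDerivWithinAt
  have h2 := (mdifferentiableAt_extChartAt (I := 𝓡 n) (x := x₁)
    (by rwa [← extChartAt_source (𝓡 n)])).hasMFDerivAt
  have h3 := h2.comp_hasMFDerivWithinAt y h1
  rw [hasMFDerivWithinAt_iff_hasFDerivWithinAt] at h3
  have h4 := h3.hasFDerivAt (by simp)
  exact h4

theorem transition_mem {x₀ x₁ : M} {y : 𝓔}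
    (hy' : (extChartAt (𝓡 n) x₀).symm y ∈ (extChartAt (𝓡 n) x₁).source) :
    transition n x₀ x₁ y ∈ (extChartAt (𝓡 n) x₁).target :=
  (extChartAt (𝓡 n) x₁).map_source hy'

theorem symm_transition {x₀ x₁ : M} {y : 𝓔}
    (hy' : (extChartAt (𝓡 n) x₀).symm y ∈ (extChartAt (𝓡 n) x₁).source) :
    (extChartAt (𝓡 n) x₁).symm (transition n x₀ x₁ y) = (extChartAt (𝓡 n) x₀).symm y :=
  (extChartAt (𝓡 n) x₁).left_inv hy'

theorem chartSymmD_fderiv_transition {x₀ x₁ : M} {y : 𝓔}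
    (hy : y ∈ (extChartAt (𝓡 n) x₀).target)
    (hy' : (extChartAt (𝓡 n) x₀).symm y ∈ (extChartAt (𝓡 n) x₁).source) (v : 𝓔) :
    chartSymmD x₁ (transition n x₀ x₁ y) (fderiv ℝ (transition n x₀ x₁) y v)
      = chartSymmD x₀ y v := by
  rw [(hasFDerivAt_transition hy hy').fderiv]
  have h := chartSymmD_comp_chartD (transition_mem hy') (chartSymmD x₀ y v)
  rw [symm_transition hy'] at h
  exact h

theorem lapseC_transition (S : SplitMetric n M t₀) {x₀ x₁ : M} {y : 𝓔}
    (hy' : (extChartAt (𝓡 n) x₀).symm y ∈ (extChartAt (𝓡 n) x₁).source) (t : ℝ) :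
    S.lapseC x₁ (transition n x₀ x₁ y, t) = S.lapseC x₀ (y, t) := by
  simp only [lapseC, symm_transition hy']

theorem metricC_apply (S : SplitMetric n M t₀) (x₀ : M) (z : 𝓔 × ℝ) (u v : 𝓔) :
    S.metricC x₀ z u v = S.metricE z.2 ((extChartAt (𝓡 n) x₀).symm z.1)
      (chartSymmD x₀ z.1 u) (chartSymmD x₀ z.1 v) := rfl

theorem metricC_transition (S : SplitMetric n M t₀) {x₀ x₁ : M} {y : 𝓔}
    (hy : y ∈ (extChartAt (𝓡 n) x₀).target)
    (hy' : (extChartAt (𝓡 n) x₀).symm y ∈ (extChartAt (𝓡 n) x₁).source) (t : ℝ) (u v : 𝓔) :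
    S.metricC x₁ (transition n x₀ x₁ y, t) (fderiv ℝ (transition n x₀ x₁) y u)
      (fderiv ℝ (transition n x₀ x₁) y v) = S.metricC x₀ (y, t) u v := by
  rw [metricC_apply, metricC_apply]
  simp only [chartSymmD_fderiv_transition hy hy', symm_transition hy']

theorem shiftC_transition (S : SplitMetric n M t₀) {x₀ x₁ : M} {y : 𝓔}
    (hy : y ∈ (extChartAt (𝓡 n) x₀).target)
    (hy' : (extChartAt (𝓡 n) x₀).symm y ∈ (extChartAt (𝓡 n) x₁).source) (t : ℝ) :
    S.shiftC x₁ (transition n x₀ x₁ y, t)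
      = fderiv ℝ (transition n x₀ x₁) y (S.shiftC x₀ (y, t)) := by
  rw [(hasFDerivAt_transition hy hy').fderiv]
  simp only [shiftC, symm_transition hy', ContinuousLinearMap.comp_apply,
    chartSymmD_comp_chartD hy]

theorem metricC_symm (S : SplitMetric n M t₀) {x₀ : M} {z : 𝓔 × ℝ} (hz : t₀ < z.2) (u v : 𝓔) :
    S.metricC x₀ z u v = S.metricC x₀ z v u :=
  S.metric_symm z.2 hz _ _ _

theorem metricC_pos (S : SplitMetric n M t₀) {x₀ : M} {z : 𝓔 × ℝ} (hz : z ∈ S.chartDom x₀) {v : 𝓔}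
    (hv : v ≠ 0) : 0 < S.metricC x₀ z v v := by
  refine S.metric_pos z.2 hz.2 _ _ fun h => hv ?_
  have h' : chartSymmD x₀ z.1 v = 0 := h
  rw [← chartD_comp_chartSymmD hz.1 v, h', map_zero]

theorem metricC_nonneg (S : SplitMetric n M t₀) {x₀ : M} {z : 𝓔 × ℝ} (hz : z ∈ S.chartDom x₀)
    (v : 𝓔) : 0 ≤ S.metricC x₀ z v v := by
  rcases eq_or_ne v 0 with rfl | hv
  · simp
  · exact (S.metricC_pos hz hv).le

end SplitMetric

/-! ### Christoffel symbols of a field of bilinear forms on a normed space -/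

section Christoffel

variable {F : Type*} [NormedAddCommGroup F] [NormedSpace ℝ F]

/-- The Christoffel symbols of the first kind of a field `B` of bilinear forms. -/
def christoffelForm (B : F → F →L[ℝ] F →L[ℝ] ℝ) (z u v w : F) : ℝ :=
  (fderiv ℝ B z u v w + fderiv ℝ B z v u w - fderiv ℝ B z w u v) / 2

theorem hasFDerivAt_form_apply {B : F → F →L[ℝ] F →L[ℝ] ℝ} {z : F}
    (hB : DifferentiableAt ℝ B z) (v w : F) :
    HasFDerivAt (fun x => B x v w) (((fderiv ℝ B z).flip v).flip w) z := by
  have h := (hB.hasFDerivAt.clm_apply (hasFDerivAt_const v z)).clm_apply (hasFDerivAt_const w z)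
  convert! h using 1
  ext u
  simp

set_option synthInstance.maxHeartbeats 200000 in
/-- The transformation law of the Christoffel symbols under a change of coordinates `Ψ`: they are
tensorial up to the second derivative of `Ψ`. -/
theorem christoffelForm_pullback {B₀ B₁ : F → F →L[ℝ] F →L[ℝ] ℝ} {Ψ : F → F} {z : F}
    (hΨ : ContDiffAt ℝ 2 Ψ z) (h₁ : DifferentiableAt ℝ B₁ (Ψ z))
    (h₀ : DifferentiableAt ℝ B₀ z)
    (hsymm : ∀ v w, B₁ (Ψ z) v w = B₁ (Ψ z) w v)
    (hpull : ∀ᶠ x in 𝓝 z, ∀ v w, B₀ x v w = B₁ (Ψ x) (fderiv ℝ Ψ x v) (fderiv ℝ Ψ x w))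
    (u v w : F) :
    christoffelForm B₀ z u v w
      = christoffelForm B₁ (Ψ z) (fderiv ℝ Ψ z u) (fderiv ℝ Ψ z v) (fderiv ℝ Ψ z w)
        + B₁ (Ψ z) (fderiv ℝ (fderiv ℝ Ψ) z u v) (fderiv ℝ Ψ z w) := by
  have hd : DifferentiableAt ℝ (fderiv ℝ Ψ) z :=
    (hΨ.fderiv_right (m := 1) (by norm_num)).differentiableAt (by norm_num)
  have hΨd : DifferentiableAt ℝ Ψ z := hΨ.differentiableAt (by norm_num)
  have hsnd : ∀ a b, fderiv ℝ (fderiv ℝ Ψ) z a b = fderiv ℝ (fderiv ℝ Ψ) z b a := fun a b =>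
    (hΨ.isSymmSndFDerivAt (by simp)).eq a b
  have key : ∀ a b c, fderiv ℝ B₀ z a b c
      = fderiv ℝ B₁ (Ψ z) (fderiv ℝ Ψ z a) (fderiv ℝ Ψ z b) (fderiv ℝ Ψ z c)
        + B₁ (Ψ z) (fderiv ℝ (fderiv ℝ Ψ) z a b) (fderiv ℝ Ψ z c)
        + B₁ (Ψ z) (fderiv ℝ Ψ z b) (fderiv ℝ (fderiv ℝ Ψ) z a c) := by
    intro a b c
    have e1 := hasFDerivAt_form_apply h₀ b c
    have e2 : HasFDerivAt (fun x => B₁ (Ψ x) (fderiv ℝ Ψ x b) (fderiv ℝ Ψ x c)) _ z :=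
      ((h₁.hasFDerivAt.comp z hΨd.hasFDerivAt).clm_apply
        (hd.hasFDerivAt.clm_apply (hasFDerivAt_const b z))).clm_apply
        (hd.hasFDerivAt.clm_apply (hasFDerivAt_const c z))
    have e3 := e1.unique (e2.congr_of_eventuallyEq (hpull.mono fun x hx => hx b c))
    have e4 := DFunLike.congr_fun e3 a
    simp at e4
    rw [e4]
    ring
  simp only [christoffelForm, key]
  rw [hsnd v u, hsnd w u, hsnd w v, hsymm (fderiv ℝ Ψ z v), hsymm (fderiv ℝ Ψ z u)
    (fderiv ℝ (fderiv ℝ Ψ) z v w), hsymm (fderiv ℝ (fderiv ℝ Ψ) z u w)]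
  ring

/-- By this identity `B(ξ', ξ')` is constant along the solutions of `B(ξ'', ·) + [ξ' ξ', ·] = 0`. -/
theorem christoffelForm_self (B : F → F →L[ℝ] F →L[ℝ] ℝ) (z u : F) :
    christoffelForm B z u u u = fderiv ℝ B z u u u / 2 := by
  simp only [christoffelForm]; ring

end Christoffel

namespace SplitMetric

variable {n : ℕ} {M : Type*} [TopologicalSpace M]
  [ChartedSpace (EuclideanSpace ℝ (Fin n)) M] [IsManifold (𝓡 n) ∞ M] {t₀ : ℝ}

local notation "𝓔" => EuclideanSpace ℝ (Fin n)

/-! ### The spacetime metric in product charts -/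

/-- The map `(v, a) ↦ v + a β`, the projection onto the slices along their normals, at a point with
shift `β`. -/
def horizontal (b : 𝓔) : 𝓔 × ℝ →L[ℝ] 𝓔 :=
  ContinuousLinearMap.fst ℝ 𝓔 ℝ + (ContinuousLinearMap.snd ℝ 𝓔 ℝ).smulRight b

@[simp] theorem horizontal_apply (b : 𝓔) (u : 𝓔 × ℝ) : horizontal b u = u.1 + u.2 • b := rfl

/-- The spacetime metric in the chart around `x₀`, with the time `t` as the last coordinate. -/
def lorentzC (S : SplitMetric n M t₀) (x₀ : M) (z : 𝓔 × ℝ) :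
    𝓔 × ℝ →L[ℝ] 𝓔 × ℝ →L[ℝ] ℝ :=
  (-(S.lapseC x₀ z) ^ 2) • (ContinuousLinearMap.mul ℝ ℝ).bilinearComp
      (ContinuousLinearMap.snd ℝ 𝓔 ℝ) (ContinuousLinearMap.snd ℝ 𝓔 ℝ)
    + (S.metricC x₀ z).bilinearComp (horizontal (S.shiftC x₀ z)) (horizontal (S.shiftC x₀ z))

theorem lorentzC_apply (S : SplitMetric n M t₀) (x₀ : M) (z u v : 𝓔 × ℝ) :
    S.lorentzC x₀ z u v = -(S.lapseC x₀ z) ^ 2 * (u.2 * v.2)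
      + S.metricC x₀ z (u.1 + u.2 • S.shiftC x₀ z) (v.1 + v.2 • S.shiftC x₀ z) := by
  simp [lorentzC]

theorem lorentzC_symm (S : SplitMetric n M t₀) {x₀ : M} {z : 𝓔 × ℝ} (hz : t₀ < z.2)
    (u v : 𝓔 × ℝ) : S.lorentzC x₀ z u v = S.lorentzC x₀ z v u := by
  rw [lorentzC_apply, lorentzC_apply, S.metricC_symm hz]; ring

theorem contDiffAt_lorentzC (S : SplitMetric n M t₀) {x₀ : M} {z : 𝓔 × ℝ}
    (hz : z ∈ S.chartDom x₀) : ContDiffAt ℝ ∞ (S.lorentzC x₀) z := by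
  refine ContDiffOn.contDiffAt ?_ ((S.isOpen_chartDom x₀).mem_nhds hz)
  rw [contDiffOn_clm_apply]
  intro u
  rw [contDiffOn_clm_apply]
  intro v
  simp only [lorentzC_apply]
  intro w hw
  refine ContDiffAt.contDiffWithinAt ?_
  have h1 := S.contDiffAt_lapseC hw
  have h2 := S.contDiffAt_shiftC hw
  have h3 := S.contDiffAt_metricC hw
  have h4 : ∀ u : 𝓔 × ℝ, ContDiffAt ℝ ∞ (fun z => u.1 + u.2 • S.shiftC x₀ z) w := fun u =>
    contDiffAt_const.add (contDiffAt_const.fun_smul h2)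
  have h5 : ContDiffAt ℝ ∞ (fun z => S.metricC x₀ z (u.1 + u.2 • S.shiftC x₀ z)) w :=
    h3.clm_apply (h4 u)
  have h6 : ContDiffAt ℝ ∞ (fun z => S.metricC x₀ z (u.1 + u.2 • S.shiftC x₀ z)
      (v.1 + v.2 • S.shiftC x₀ z)) w := h5.clm_apply (h4 v)
  have h7 : ContDiffAt ℝ ∞ (fun z => -(S.lapseC x₀ z) ^ 2 * (u.2 * v.2)) w :=
    (h1.pow 2).neg.mul contDiffAt_const
  exact h7.add h6

theorem extChartAt_prod_apply (p₀ p : M × ℝ) :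
    extChartAt ((𝓡 n).prod 𝓘(ℝ, ℝ)) p₀ p = (extChartAt (𝓡 n) p₀.1 p.1, p.2) := by
  rw [extChartAt_prod]; rfl

theorem extChartAt_prod_symm_apply (p₀ : M × ℝ) (z : 𝓔 × ℝ) :
    (extChartAt ((𝓡 n).prod 𝓘(ℝ, ℝ)) p₀).symm z = ((extChartAt (𝓡 n) p₀.1).symm z.1, z.2) := by
  rw [extChartAt_prod]; rfl

theorem mem_extChartAt_prod_source {p₀ p : M × ℝ} :
    p ∈ (extChartAt ((𝓡 n).prod 𝓘(ℝ, ℝ)) p₀).source ↔ p.1 ∈ (extChartAt (𝓡 n) p₀.1).source := by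
  rw [extChartAt_prod]; simp [chartAt_self_eq]

theorem mfderivWithin_extChartAt_prod_symm (p₀ : M × ℝ) {z : 𝓔 × ℝ}
    (hz : z.1 ∈ (extChartAt (𝓡 n) p₀.1).target) (u : 𝓔 × ℝ) :
    mfderivWithin 𝓘(ℝ, 𝓔 × ℝ) ((𝓡 n).prod 𝓘(ℝ, ℝ)) (extChartAt ((𝓡 n).prod 𝓘(ℝ, ℝ)) p₀).symm
      (range ((𝓡 n).prod 𝓘(ℝ, ℝ))) z u = ((chartSymmD p₀.1 z.1 u.1, u.2) : 𝓔 × ℝ) := by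
  have : IsManifold (𝓡 n) 1 M := IsManifold.of_le (n := ∞) (by norm_cast)
  have h1 : HasMFDerivAt 𝓘(ℝ, 𝓔) (𝓡 n) (extChartAt (𝓡 n) p₀.1).symm z.1
      (chartSymmD p₀.1 z.1) := by
    have h := (mdifferentiableWithinAt_extChartAt_symm (I := 𝓡 n) hz).hasMFDerivWithinAt
    exact h.hasMFDerivAt (by simp)
  have h2 : HasMFDerivAt 𝓘(ℝ, ℝ) 𝓘(ℝ, ℝ) (id : ℝ → ℝ) z.2 (ContinuousLinearMap.id ℝ ℝ) :=
    hasMFDerivAt_id z.2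
  have h0 : HasMFDerivAt 𝓘(ℝ, 𝓔 × ℝ) 𝓘(ℝ, 𝓔) (Prod.fst : 𝓔 × ℝ → 𝓔) z
      (ContinuousLinearMap.fst ℝ 𝓔 ℝ) := hasFDerivAt_fst.hasMFDerivAt
  have h0' : HasMFDerivAt 𝓘(ℝ, 𝓔 × ℝ) 𝓘(ℝ, ℝ) (Prod.snd : 𝓔 × ℝ → ℝ) z
      (ContinuousLinearMap.snd ℝ 𝓔 ℝ) := hasFDerivAt_snd.hasMFDerivAt
  have h3 := HasMFDerivAt.prodMk (HasMFDerivAt.comp z h1 h0) h0'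
  have h4 : (extChartAt ((𝓡 n).prod 𝓘(ℝ, ℝ)) p₀).symm
      = fun z : 𝓔 × ℝ => ((extChartAt (𝓡 n) p₀.1).symm z.1, z.2) := by
    funext z; exact extChartAt_prod_symm_apply p₀ z
  have hr : range ((𝓡 n).prod 𝓘(ℝ, ℝ)) = univ := by simp
  rw [hr, mfderivWithin_univ, h4]
  have h5 := h3.mfderiv
  exact DFunLike.congr_fun h5 u

theorem metricInChart_eq (S : SplitMetric n M t₀) (p₀ : M × ℝ) {z : 𝓔 × ℝ}
    (hz : z.1 ∈ (extChartAt (𝓡 n) p₀.1).target) (u v : 𝓔 × ℝ) :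
    metricInChart ((𝓡 n).prod 𝓘(ℝ, ℝ)) S.spacetimeMetric p₀ z u v = S.lorentzC p₀.1 z u v := by
  rw [metricInChart]
  rw [mfderivWithin_extChartAt_prod_symm p₀ hz, mfderivWithin_extChartAt_prod_symm p₀ hz]
  rw [extChartAt_prod_symm_apply, lorentzC_apply, metricC_apply]
  have hb : chartSymmD p₀.1 z.1 (S.shiftC p₀.1 z)
      = S.shiftE z.2 ((extChartAt (𝓡 n) p₀.1).symm z.1) := chartSymmD_comp_chartD hz _
  have hA : ∀ u : 𝓔 × ℝ, chartSymmD p₀.1 z.1 (u.1 + u.2 • S.shiftC p₀.1 z)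
      = chartSymmD p₀.1 z.1 u.1 + u.2 • S.shiftE z.2 ((extChartAt (𝓡 n) p₀.1).symm z.1) := by
    intro u
    rw [map_add, map_smul, hb]
  rw [hA, hA, ← mul_assoc]
  rfl

theorem christoffelFirst_eq (S : SplitMetric n M t₀) (p₀ : M × ℝ) {z : 𝓔 × ℝ}
    (hz : z ∈ S.chartDom p₀.1) (u v w : 𝓔 × ℝ) :
    christoffelFirst ((𝓡 n).prod 𝓘(ℝ, ℝ)) S.spacetimeMetric p₀ z u v w
      = christoffelForm (S.lorentzC p₀.1) z u v w := by
  have hd : DifferentiableAt ℝ (S.lorentzC p₀.1) z :=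
    (S.contDiffAt_lorentzC hz).differentiableAt (by simp)
  have key : ∀ a b c : 𝓔 × ℝ, fderiv ℝ (fun x =>
      metricInChart ((𝓡 n).prod 𝓘(ℝ, ℝ)) S.spacetimeMetric p₀ x b c) z a
      = fderiv ℝ (S.lorentzC p₀.1) z a b c := by
    intro a b c
    have h1 : (fun x => metricInChart ((𝓡 n).prod 𝓘(ℝ, ℝ)) S.spacetimeMetric p₀ x b c)
        =ᶠ[𝓝 z] fun x => S.lorentzC p₀.1 x b c := by
      filter_upwards [(S.isOpen_chartDom p₀.1).mem_nhds hz] with x hx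
      exact S.metricInChart_eq p₀ hx.1 b c
    rw [h1.fderiv_eq, (hasFDerivAt_form_apply hd b c).fderiv]
    rfl
  simp only [christoffelFirst, christoffelForm, key]

end SplitMetric

/-! ### Cauchy-Schwarz inequalities for the norms of covectors and of bilinear forms -/

section GramMatrix

open Matrix

variable {ι : Type*} [Fintype ι] [DecidableEq ι]

theorem Matrix.PosSemidef.sq_dotProduct_mulVec_le {P : Matrix ι ι ℝ} (hP : P.PosSemidef)
    (x y : ι → ℝ) : (x ⬝ᵥ P *ᵥ y) ^ 2 ≤ (x ⬝ᵥ P *ᵥ x) * (y ⬝ᵥ P *ᵥ y) := by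
  have h := LinearMap.BilinForm.apply_sq_le_of_symm (Matrix.toBilin' P)
    (fun z => by
      rw [Matrix.toBilin'_apply']
      simpa using hP.dotProduct_mulVec_nonneg z)
    ⟨fun z w => by
      rw [Matrix.toBilin'_apply', Matrix.toBilin'_apply']
      have h1 : Pᵀ = P := by simpa [Matrix.IsHermitian, conjTranspose_eq_transpose_of_trivial] using hP.isHermitian
      rw [RingHom.id_apply, Matrix.dotProduct_mulVec, ← Matrix.mulVec_transpose, h1,
        dotProduct_comm]⟩ x y
  simpa only [Matrix.toBilin'_apply'] using h

theorem Matrix.PosDef.inv_mulVec_mulVec {A : Matrix ι ι ℝ} (hA : A.PosDef) (c : ι → ℝ) :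
    A⁻¹ *ᵥ (A *ᵥ c) = c := by
  rw [Matrix.mulVec_mulVec, Matrix.nonsing_inv_mul _ (Matrix.isUnit_iff_isUnit_det _ |>.1 hA.isUnit),
    Matrix.one_mulVec]

/-- A covector is bounded by its norm for the inverse of the Gram matrix. -/
theorem Matrix.PosDef.sq_dotProduct_le {A : Matrix ι ι ℝ} (hA : A.PosDef) (l c : ι → ℝ) :
    (l ⬝ᵥ c) ^ 2 ≤ (∑ i, ∑ j, A⁻¹ i j * l i * l j) * (c ⬝ᵥ A *ᵥ c) := by
  have h := hA.inv.posSemidef.sq_dotProduct_mulVec_le l (A *ᵥ c)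
  rw [hA.inv_mulVec_mulVec, dotProduct_comm (A *ᵥ c)] at h
  convert h using 2
  simp only [dotProduct, mulVec, Finset.mul_sum]
  exact Finset.sum_congr rfl fun i _ => Finset.sum_congr rfl fun j _ => by ring

/-- A bilinear form is bounded by its Hilbert-Schmidt norm. -/
theorem Matrix.PosDef.sq_bilin_le {A : Matrix ι ι ℝ} (hA : A.PosDef) (K : ι → ι → ℝ) (c : ι → ℝ) :
    (∑ i, ∑ j, K i j * (c i * c j)) ^ 2
      ≤ (∑ i, ∑ j, ∑ k, ∑ l, A⁻¹ i k * A⁻¹ j l * K i j * K k l) * (c ⬝ᵥ A *ᵥ c) ^ 2 := by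
  have hP := hA.inv.posSemidef.kronecker hA.inv.posSemidef
  have h := hP.sq_dotProduct_mulVec_le (fun p => K p.1 p.2)
    (fun p => (A *ᵥ c) p.1 * (A *ᵥ c) p.2)
  have hy : kroneckerMap (fun x y => x * y) A⁻¹ A⁻¹ *ᵥ (fun p => (A *ᵥ c) p.1 * (A *ᵥ c) p.2)
      = fun p : ι × ι => c p.1 * c p.2 := by
    funext p
    have h1 : ∀ i, ∑ j, A⁻¹ i j * (A *ᵥ c) j = c i := fun i => congrFun (hA.inv_mulVec_mulVec c) i
    simp only [mulVec, dotProduct, kroneckerMap_apply, Fintype.sum_prod_type]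
    have h2 := congrArg₂ (· * ·) (h1 p.1) (h1 p.2)
    simp only [Finset.sum_mul_sum, mulVec, dotProduct] at h2
    rw [← h2]
    exact Finset.sum_congr rfl fun i _ => Finset.sum_congr rfl fun j _ => by ring
  rw [hy] at h
  have e1 : (fun p : ι × ι => K p.1 p.2) ⬝ᵥ (fun p : ι × ι => c p.1 * c p.2)
      = ∑ i, ∑ j, K i j * (c i * c j) := by
    simp only [dotProduct, Fintype.sum_prod_type]
  have e2 : (fun p : ι × ι => (A *ᵥ c) p.1 * (A *ᵥ c) p.2) ⬝ᵥ (fun p : ι × ι => c p.1 * c p.2)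
      = (c ⬝ᵥ A *ᵥ c) ^ 2 := by
    rw [sq]
    simp only [dotProduct, Fintype.sum_prod_type]
    rw [Finset.sum_mul_sum]
    exact Finset.sum_congr rfl fun i _ => Finset.sum_congr rfl fun j _ => by ring
  have e3 : (fun p : ι × ι => K p.1 p.2) ⬝ᵥ
      kroneckerMap (fun x y => x * y) A⁻¹ A⁻¹ *ᵥ (fun p : ι × ι => K p.1 p.2)
      = ∑ i, ∑ j, ∑ k, ∑ l, A⁻¹ i k * A⁻¹ j l * K i j * K k l := by
    simp only [dotProduct, mulVec, kroneckerMap_apply, Fintype.sum_prod_type, Finset.mul_sum]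
    exact Finset.sum_congr rfl fun i _ => Finset.sum_congr rfl fun j _ =>
      Finset.sum_congr rfl fun k _ => Finset.sum_congr rfl fun l _ => by ring
  rw [e1, e2, e3] at h
  exact h

end GramMatrix

namespace SplitMetric

variable {n : ℕ} {M : Type*} [TopologicalSpace M]
  [ChartedSpace (EuclideanSpace ℝ (Fin n)) M] [IsManifold (𝓡 n) ∞ M] {t₀ : ℝ}

local notation "𝓔" => EuclideanSpace ℝ (Fin n)

/-! ### The second fundamental form of the slices in charts -/

/-- The vector `e₀ = ∂_t - β` in the chart around `x₀`. -/
def normalC (S : SplitMetric n M t₀) (x₀ : M) (z : 𝓔 × ℝ) : 𝓔 × ℝ := (-S.shiftC x₀ z, 1)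

/-- The form `N K = [· ·, e₀]` in the chart around `x₀`, where `K` is the extrinsic curvature of the
slices. -/
def secondForm (S : SplitMetric n M t₀) (x₀ : M) (z : 𝓔 × ℝ) (v w : 𝓔) : ℝ :=
  christoffelForm (S.lorentzC x₀) z (v, 0) (w, 0) (S.normalC x₀ z)

theorem lorentzC_normalC (S : SplitMetric n M t₀) (x₀ : M) (z u : 𝓔 × ℝ) :
    S.lorentzC x₀ z u (S.normalC x₀ z) = -(S.lapseC x₀ z) ^ 2 * u.2 := by
  simp [lorentzC_apply, normalC]

theorem differentiableAt_lorentzC (S : SplitMetric n M t₀) {x₀ : M} {z : 𝓔 × ℝ}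
    (hz : z ∈ S.chartDom x₀) : DifferentiableAt ℝ (S.lorentzC x₀) z :=
  (S.contDiffAt_lorentzC hz).differentiableAt (by simp)

set_option synthInstance.maxHeartbeats 200000 in
theorem fderiv_lorentzC (S : SplitMetric n M t₀) {x₀ : M} {z : 𝓔 × ℝ} (hz : z ∈ S.chartDom x₀)
    (a u v : 𝓔 × ℝ) : fderiv ℝ (S.lorentzC x₀) z a u v
      = -(2 * S.lapseC x₀ z * fderiv ℝ (S.lapseC x₀) z a) * (u.2 * v.2)
        + fderiv ℝ (S.metricC x₀) z a (u.1 + u.2 • S.shiftC x₀ z) (v.1 + v.2 • S.shiftC x₀ z)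
        + S.metricC x₀ z (u.2 • fderiv ℝ (S.shiftC x₀) z a) (v.1 + v.2 • S.shiftC x₀ z)
        + S.metricC x₀ z (u.1 + u.2 • S.shiftC x₀ z) (v.2 • fderiv ℝ (S.shiftC x₀) z a) := by
  have hN := ((S.contDiffAt_lapseC hz).differentiableAt (by simp)).hasFDerivAt
  have hb := ((S.contDiffAt_shiftC hz).differentiableAt (by simp)).hasFDerivAt
  have hg := ((S.contDiffAt_metricC hz).differentiableAt (by simp)).hasFDerivAt
  have e1 := hasFDerivAt_form_apply (S.differentiableAt_lorentzC hz) u v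
  simp only [lorentzC_apply] at e1
  have hu : ∀ u : 𝓔 × ℝ, HasFDerivAt (fun x => u.1 + u.2 • S.shiftC x₀ x)
      (u.2 • fderiv ℝ (S.shiftC x₀) z) z := fun u => (hb.const_smul u.2).const_add u.1
  have e2 : HasFDerivAt (fun x => -(S.lapseC x₀ x) ^ 2 * (u.2 * v.2)) _ z :=
    ((hN.pow 2).neg.mul_const (u.2 * v.2))
  have e3 : HasFDerivAt (fun x => S.metricC x₀ x (u.1 + u.2 • S.shiftC x₀ x)
      (v.1 + v.2 • S.shiftC x₀ x)) _ z := (hg.clm_apply (hu u)).clm_apply (hu v)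
  have e4 := DFunLike.congr_fun (e1.unique (e2.add e3)) a
  simp at e4
  rw [e4]
  simp
  ring

/-- The second fundamental form in terms of the shift and of the slice metric: `N K` is minus one
half of the Lie derivative of the slice metric along `e₀ = ∂_t - β`. -/
theorem secondForm_eq (S : SplitMetric n M t₀) {x₀ : M} {z : 𝓔 × ℝ} (hz : z ∈ S.chartDom x₀)
    (v : 𝓔) : S.secondForm x₀ z v v = S.metricC x₀ z v (fderiv ℝ (S.shiftC x₀) z (v, 0))
      - fderiv ℝ (S.metricC x₀) z (S.normalC x₀ z) v v / 2 := by
  simp only [secondForm, christoffelForm, S.fderiv_lorentzC hz]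
  simp [normalC]
  ring

theorem secondForm_polar (S : SplitMetric n M t₀) {x₀ : M} {z : 𝓔 × ℝ} (hz : z ∈ S.chartDom x₀)
    (v w : 𝓔) : S.secondForm x₀ z v w = (S.metricC x₀ z v (fderiv ℝ (S.shiftC x₀) z (w, 0))
      + S.metricC x₀ z w (fderiv ℝ (S.shiftC x₀) z (v, 0))
      - fderiv ℝ (S.metricC x₀) z (S.normalC x₀ z) v w) / 2 := by
  simp only [secondForm, christoffelForm, S.fderiv_lorentzC hz]
  simp [normalC]
  ring

/-- The second fundamental form as a bilinear map. -/
def secondFormₗ (S : SplitMetric n M t₀) {x₀ : M} {z : 𝓔 × ℝ} (hz : z ∈ S.chartDom x₀) :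
    𝓔 →ₗ[ℝ] 𝓔 →ₗ[ℝ] ℝ :=
  LinearMap.mk₂ ℝ (S.secondForm x₀ z)
    (fun u v w => by
      have h : ((u + v, 0) : 𝓔 × ℝ) = (u, 0) + (v, 0) := by simp
      simp only [S.secondForm_polar hz, h, map_add, add_apply]; ring)
    (fun c v w => by
      have h : ((c • v, 0) : 𝓔 × ℝ) = c • (v, 0) := by simp
      simp only [S.secondForm_polar hz, h, map_smul, smul_apply, smul_eq_mul]; ring)
    (fun u v w => by
      have h : ((v + w, 0) : 𝓔 × ℝ) = (v, 0) + (w, 0) := by simp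
      simp only [S.secondForm_polar hz, h, map_add, add_apply]; ring)
    (fun c v w => by
      have h : ((c • w, 0) : 𝓔 × ℝ) = c • (w, 0) := by simp
      simp only [S.secondForm_polar hz, h, map_smul, smul_apply, smul_eq_mul]; ring)

/-- The Christoffel term in the component along `e₀` of the geodesic equation: the derivatives of the
shift and of the slice metric only enter through the second fundamental form. -/
theorem christoffelForm_normalC (S : SplitMetric n M t₀) {x₀ : M} {z : 𝓔 × ℝ}
    (hz : z ∈ S.chartDom x₀) (u : 𝓔 × ℝ) :
    christoffelForm (S.lorentzC x₀) z u u (S.normalC x₀ z)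
      = -(S.lapseC x₀ z * u.2 * fderiv ℝ (S.lapseC x₀) z u)
        - S.lapseC x₀ z * u.2 * fderiv ℝ (S.lapseC x₀) z (u.1 + u.2 • S.shiftC x₀ z, 0)
        + S.secondForm x₀ z (u.1 + u.2 • S.shiftC x₀ z) (u.1 + u.2 • S.shiftC x₀ z) := by
  have hu : u = (u.1 + u.2 • S.shiftC x₀ z, 0) + u.2 • S.normalC x₀ z := by
    ext <;> simp [normalC]
  set v := u.1 + u.2 • S.shiftC x₀ z with hv
  have hDN : fderiv ℝ (S.lapseC x₀) z u = fderiv ℝ (S.lapseC x₀) z (v, 0)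
      + u.2 * fderiv ℝ (S.lapseC x₀) z (S.normalC x₀ z) := by
    conv_lhs => rw [hu]
    rw [map_add, map_smul, smul_eq_mul]
  have hDb : fderiv ℝ (S.shiftC x₀) z u = fderiv ℝ (S.shiftC x₀) z (v, 0)
      + u.2 • fderiv ℝ (S.shiftC x₀) z (S.normalC x₀ z) := by
    conv_lhs => rw [hu]
    rw [map_add, map_smul]
  rw [S.secondForm_eq hz]
  simp only [christoffelForm, S.fderiv_lorentzC hz, ← hv]
  simp only [normalC, one_smul, neg_add_cancel, map_zero, map_smul,
    smul_apply, smul_eq_mul] at *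
  rw [hDN, hDb]
  simp only [map_add, map_smul, smul_eq_mul]
  rw [S.metricC_symm hz.2 (fderiv ℝ (S.shiftC x₀) z (-S.shiftC x₀ z, 1)) v]
  ring

/-! ### The pointwise bounds on the second fundamental form and on the gradient of the lapse -/

theorem sum_smul_single (v : 𝓔) : ∑ i, v i • (EuclideanSpace.single i (1 : ℝ) : 𝓔) = v := by
  ext j
  simp [Pi.single_apply]

theorem metricE_apply (S : SplitMetric n M t₀) (t : ℝ) (x : M) (v : 𝓔) :
    v ⬝ᵥ (S.gram t x).mulVec v = S.metricE t x v v := by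
  conv_rhs => rw [← sum_smul_single v]
  simp only [map_sum, map_smul, _root_.sum_apply, smul_apply, smul_eq_mul,
    dotProduct, Matrix.mulVec, Finset.mul_sum]
  rw [Finset.sum_comm]
  refine Finset.sum_congr rfl fun i _ => Finset.sum_congr rfl fun j _ => ?_
  have h : S.gram t x j i = S.metricE t x (EuclideanSpace.single j 1) (EuclideanSpace.single i 1) :=
    rfl
  rw [h]; ring

theorem posDef_gram (S : SplitMetric n M t₀) {t : ℝ} (ht : t₀ < t) (x : M) :
    (S.gram t x).PosDef := by
  refine Matrix.PosDef.of_dotProduct_mulVec_pos ?_ ?_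
  · ext i j
    exact S.metric_symm t ht x _ _
  · intro c hc
    have h := S.metricE_apply t x (WithLp.toLp 2 c)
    have h2 : 0 < S.metricE t x (WithLp.toLp 2 c) (WithLp.toLp 2 c) := by
      refine S.metric_pos t ht x _ fun h => hc ?_
      have h' : (WithLp.toLp 2 c : 𝓔) = 0 := h
      funext i
      exact congrArg (fun v : 𝓔 => v i) h'
    rw [← h] at h2
    simpa using h2

/-- The differential of the lapse along a slice, as a form on the model space. -/
def lapseD (S : SplitMetric n M t₀) (t : ℝ) (x : M) : 𝓔 →L[ℝ] ℝ :=
  mfderiv (𝓡 n) 𝓘(ℝ, ℝ) (S.lapse t) x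

theorem abs_lapseD_le (S : SplitMetric n M t₀) {t : ℝ} (ht : t₀ < t) (x : M) (v : 𝓔) :
    |S.lapseD t x v| ≤ S.normGradLapse t x * Real.sqrt (S.metricE t x v v) := by
  have h := (S.posDef_gram ht x).sq_dotProduct_le (S.lapseDeriv t x) v
  rw [S.metricE_apply] at h
  have h1 : S.lapseDeriv t x ⬝ᵥ v = S.lapseD t x v := by
    conv_rhs => rw [← sum_smul_single v]
    simp only [map_sum, map_smul, smul_eq_mul, dotProduct]
    exact Finset.sum_congr rfl fun i _ => mul_comm _ _
  rw [h1] at h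
  have hg : 0 ≤ S.metricE t x v v := by
    rw [← S.metricE_apply]
    simpa using (S.posDef_gram ht x).posSemidef.dotProduct_mulVec_nonneg v
  rw [normGradLapse, ← Real.sqrt_mul' _ hg]
  exact Real.abs_le_sqrt h

theorem chartPoint_mem (S : SplitMetric n M t₀) {t : ℝ} (ht : t₀ < t) (x : M) :
    (extChartAt (𝓡 n) x x, t) ∈ S.chartDom x := ⟨mem_extChartAt_target x, ht⟩

theorem metricC_self (S : SplitMetric n M t₀) (t : ℝ) (x : M) :
    S.metricC x (extChartAt (𝓡 n) x x, t) = S.metricE t x := by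
  ext u v
  rw [metricC_apply]
  simp only [chartSymmD_self, extChartAt_to_inv, ContinuousLinearMap.id_apply]

theorem shiftC_self (S : SplitMetric n M t₀) (t : ℝ) (x : M) :
    S.shiftC x (extChartAt (𝓡 n) x x, t) = S.shiftE t x := by
  simp only [shiftC, chartD_self, extChartAt_to_inv, ContinuousLinearMap.id_apply]

theorem lapseC_self (S : SplitMetric n M t₀) (t : ℝ) (x : M) :
    S.lapseC x (extChartAt (𝓡 n) x x, t) = S.lapse t x := by
  simp only [lapseC, extChartAt_to_inv]

theorem extrinsicCurvature_eq (S : SplitMetric n M t₀) {t : ℝ} (ht : t₀ < t) (x : M) (v w : 𝓔) :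
    S.extrinsicCurvature t x v w
      = (S.lapse t x)⁻¹ * S.secondForm x (extChartAt (𝓡 n) x x, t) v w := by
  have h1 : S.extrinsicCurvature t x v w = (S.lapse t x)⁻¹ *
      christoffelFirst ((𝓡 n).prod 𝓘(ℝ, ℝ)) S.spacetimeMetric ((x, t) : M × ℝ)
        (extChartAt ((𝓡 n).prod 𝓘(ℝ, ℝ)) ((x, t) : M × ℝ) (x, t))
        ((v, 0) : 𝓔 × ℝ) ((w, 0) : 𝓔 × ℝ) ((-S.shiftE t x, 1) : 𝓔 × ℝ) := rfl
  rw [h1, extChartAt_prod_apply, S.christoffelFirst_eq (x, t) (S.chartPoint_mem ht x),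
    secondForm, normalC, S.shiftC_self]

theorem abs_secondForm_self_le (S : SplitMetric n M t₀) {t : ℝ} (ht : t₀ < t) (x : M)
    (hN : 0 < S.lapse t x) (v : 𝓔) :
    |S.secondForm x (extChartAt (𝓡 n) x x, t) v v|
      ≤ S.lapse t x * S.normExtrinsicCurvature t x * S.metricE t x v v := by
  have hz := S.chartPoint_mem ht x
  have h := (S.posDef_gram ht x).sq_bilin_le
    (fun i j => S.extrinsicCurvature t x (coordVector x i) (coordVector x j)) v
  rw [S.metricE_apply] at h
  have h1 : ∑ i, ∑ j, S.extrinsicCurvature t x (coordVector x i) (coordVector x j) * (v i * v j)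
      = (S.lapse t x)⁻¹ * S.secondForm x (extChartAt (𝓡 n) x x, t) v v := by
    have e1 : S.secondForm x (extChartAt (𝓡 n) x x, t) v v = S.secondFormₗ hz v v := rfl
    rw [e1]
    conv_rhs => rw [← sum_smul_single v]
    simp only [map_sum, map_smul, LinearMap.sum_apply, LinearMap.smul_apply, smul_eq_mul,
      Finset.mul_sum]
    rw [Finset.sum_comm]
    refine Finset.sum_congr rfl fun i _ => Finset.sum_congr rfl fun j _ => ?_
    have e2 := S.extrinsicCurvature_eq ht x (EuclideanSpace.single j 1) (EuclideanSpace.single i 1)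
    have e3 : S.extrinsicCurvature t x (coordVector x j) (coordVector x i)
      = S.extrinsicCurvature t x (EuclideanSpace.single j 1 : 𝓔) (EuclideanSpace.single i 1 : 𝓔) := rfl
    rw [e3, e2]
    simp only [secondFormₗ, LinearMap.mk₂_apply]
    ring
  rw [h1] at h
  have hg : 0 ≤ S.metricE t x v v := by
    rw [← S.metricE_apply]
    simpa using (S.posDef_gram ht x).posSemidef.dotProduct_mulVec_nonneg v
  have h2 := Real.abs_le_sqrt h
  rw [Real.sqrt_mul' _ (sq_nonneg _), Real.sqrt_sq hg, abs_mul, abs_inv, abs_of_pos hN,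
    inv_mul_le_iff₀ hN] at h2
  rw [mul_assoc]
  exact h2

/-! ### The same bounds in arbitrary charts -/

/-- The transition map between two product charts. -/
def transitionT (n : ℕ) {M : Type*} [TopologicalSpace M]
    [ChartedSpace (EuclideanSpace ℝ (Fin n)) M] (x₀ x₁ : M)
    (z : EuclideanSpace ℝ (Fin n) × ℝ) : EuclideanSpace ℝ (Fin n) × ℝ :=
  (transition n x₀ x₁ z.1, z.2)

/-- The set of coordinates in the chart around `x₀` of the points in the domain of the chart
around `x₁`. -/
def overlap (S : SplitMetric n M t₀) (x₀ x₁ : M) : Set (𝓔 × ℝ) :=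
  {z | z ∈ S.chartDom x₀ ∧ (extChartAt (𝓡 n) x₀).symm z.1 ∈ (extChartAt (𝓡 n) x₁).source}

theorem overlap_mem_nhds (S : SplitMetric n M t₀) {x₀ x₁ : M} {z : 𝓔 × ℝ}
    (hz : z ∈ S.overlap x₀ x₁) : S.overlap x₀ x₁ ∈ 𝓝 z := by
  have h1 : ContinuousAt (fun w : 𝓔 × ℝ => (extChartAt (𝓡 n) x₀).symm w.1) z :=
    ContinuousAt.comp (f := Prod.fst) (continuousAt_extChartAt_symm'' hz.1.1) continuousAt_fst
  filter_upwards [(S.isOpen_chartDom x₀).mem_nhds hz.1,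
    h1.preimage_mem_nhds ((isOpen_extChartAt_source x₁).mem_nhds hz.2)] with w h2 h3
  exact ⟨h2, h3⟩

theorem contDiffAt_transitionT (S : SplitMetric n M t₀) {x₀ x₁ : M} {z : 𝓔 × ℝ}
    (hz : z ∈ S.overlap x₀ x₁) : ContDiffAt ℝ ∞ (transitionT n x₀ x₁) z :=
  ((contDiffAt_transition hz.1.1 hz.2).comp z contDiffAt_fst).prodMk contDiffAt_snd

theorem fderiv_transitionT (S : SplitMetric n M t₀) {x₀ x₁ : M} {z : 𝓔 × ℝ}
    (hz : z ∈ S.overlap x₀ x₁) (u : 𝓔 × ℝ) :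
    fderiv ℝ (transitionT n x₀ x₁) z u = (fderiv ℝ (transition n x₀ x₁) z.1 u.1, u.2) := by
  have h1 : HasFDerivAt (transition n x₀ x₁) (fderiv ℝ (transition n x₀ x₁) z.1) z.1 :=
    ((contDiffAt_transition hz.1.1 hz.2).differentiableAt (by simp)).hasFDerivAt
  have h2 : HasFDerivAt (transitionT n x₀ x₁) _ z :=
    (HasFDerivAt.comp z h1 hasFDerivAt_fst).prodMk hasFDerivAt_snd
  rw [h2.fderiv]
  rfl

theorem transitionT_mem (S : SplitMetric n M t₀) {x₀ x₁ : M} {z : 𝓔 × ℝ}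
    (hz : z ∈ S.overlap x₀ x₁) : transitionT n x₀ x₁ z ∈ S.chartDom x₁ :=
  ⟨transition_mem hz.2, hz.1.2⟩

theorem lorentzC_transitionT (S : SplitMetric n M t₀) {x₀ x₁ : M} {z : 𝓔 × ℝ}
    (hz : z ∈ S.overlap x₀ x₁) (u v : 𝓔 × ℝ) :
    S.lorentzC x₀ z u v = S.lorentzC x₁ (transitionT n x₀ x₁ z)
      (fderiv ℝ (transitionT n x₀ x₁) z u) (fderiv ℝ (transitionT n x₀ x₁) z v) := by
  rw [lorentzC_apply, lorentzC_apply, S.fderiv_transitionT hz, S.fderiv_transitionT hz]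
  simp only [transitionT, S.lapseC_transition hz.2, S.shiftC_transition hz.1.1 hz.2, ← map_smul,
    ← map_add, S.metricC_transition hz.1.1 hz.2]

theorem christoffelForm_transitionT (S : SplitMetric n M t₀) {x₀ x₁ : M} {z : 𝓔 × ℝ}
    (hz : z ∈ S.overlap x₀ x₁) (u v w : 𝓔 × ℝ) :
    christoffelForm (S.lorentzC x₀) z u v w
      = christoffelForm (S.lorentzC x₁) (transitionT n x₀ x₁ z)
          (fderiv ℝ (transitionT n x₀ x₁) z u) (fderiv ℝ (transitionT n x₀ x₁) z v)
          (fderiv ℝ (transitionT n x₀ x₁) z w)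
        + S.lorentzC x₁ (transitionT n x₀ x₁ z)
            (fderiv ℝ (fderiv ℝ (transitionT n x₀ x₁)) z u v)
            (fderiv ℝ (transitionT n x₀ x₁) z w) := by
  have hΨ : ContDiffAt ℝ 2 (transitionT n x₀ x₁) z :=
    (S.contDiffAt_transitionT hz).of_le (by norm_cast)
  refine christoffelForm_pullback hΨ (S.differentiableAt_lorentzC (S.transitionT_mem hz))
    (S.differentiableAt_lorentzC hz.1) (S.lorentzC_symm (S.transitionT_mem hz).2) ?_ u v w
  filter_upwards [S.overlap_mem_nhds hz] with x hx
  exact S.lorentzC_transitionT hx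

theorem normalC_transitionT (S : SplitMetric n M t₀) {x₀ x₁ : M} {z : 𝓔 × ℝ}
    (hz : z ∈ S.overlap x₀ x₁) : fderiv ℝ (transitionT n x₀ x₁) z (S.normalC x₀ z)
      = S.normalC x₁ (transitionT n x₀ x₁ z) := by
  rw [S.fderiv_transitionT hz]
  simp only [normalC, transitionT, S.shiftC_transition hz.1.1 hz.2, map_neg]

/-- The second derivative of a transition map has no time component, so that the second fundamental
form is a tensor. -/
theorem secondForm_transition (S : SplitMetric n M t₀) {x₀ x₁ : M} {z : 𝓔 × ℝ}
    (hz : z ∈ S.overlap x₀ x₁) (v w : 𝓔) :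
    S.secondForm x₀ z v w = S.secondForm x₁ (transitionT n x₀ x₁ z)
      (fderiv ℝ (transition n x₀ x₁) z.1 v) (fderiv ℝ (transition n x₀ x₁) z.1 w) := by
  have hd : DifferentiableAt ℝ (fderiv ℝ (transitionT n x₀ x₁)) z :=
    ((S.contDiffAt_transitionT hz).fderiv_right (m := 1) (by norm_cast)).differentiableAt
      (by norm_num)
  have h2 : (fderiv ℝ (fderiv ℝ (transitionT n x₀ x₁)) z (v, 0) (w, 0)).2 = 0 := by
    have e1 : HasFDerivAt (fun x => (fderiv ℝ (transitionT n x₀ x₁) x (w, 0)).2) _ z :=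
      HasFDerivAt.snd (hd.hasFDerivAt.clm_apply (hasFDerivAt_const ((w, 0) : 𝓔 × ℝ) z))
    have e2 : (fun x => (fderiv ℝ (transitionT n x₀ x₁) x (w, 0)).2) =ᶠ[𝓝 z] fun _ => (0 : ℝ) := by
      filter_upwards [S.overlap_mem_nhds hz] with x hx
      rw [S.fderiv_transitionT hx]
    have e3 := e1.unique ((hasFDerivAt_const (0 : ℝ) z).congr_of_eventuallyEq e2)
    have e4 := DFunLike.congr_fun e3 (v, 0)
    simpa using e4
  rw [secondForm, S.christoffelForm_transitionT hz, S.normalC_transitionT hz, lorentzC_normalC, h2,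
    S.fderiv_transitionT hz, S.fderiv_transitionT hz, mul_zero, add_zero]
  rfl

theorem mem_overlap_self (S : SplitMetric n M t₀) {x₀ : M} {z : 𝓔 × ℝ} (hz : z ∈ S.chartDom x₀) :
    z ∈ S.overlap x₀ ((extChartAt (𝓡 n) x₀).symm z.1) :=
  ⟨hz, mem_extChartAt_source _⟩

theorem abs_secondForm_le (S : SplitMetric n M t₀) {x₀ : M} {z : 𝓔 × ℝ} (hz : z ∈ S.chartDom x₀)
    (hN : 0 < S.lapseC x₀ z) (v : 𝓔) :
    |S.secondForm x₀ z v v| ≤ S.lapseC x₀ z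
      * S.normExtrinsicCurvature z.2 ((extChartAt (𝓡 n) x₀).symm z.1) * S.metricC x₀ z v v := by
  have ho := S.mem_overlap_self hz
  rw [S.secondForm_transition ho]
  have h := S.abs_secondForm_self_le hz.2 ((extChartAt (𝓡 n) x₀).symm z.1) hN
    (fderiv ℝ (transition n x₀ ((extChartAt (𝓡 n) x₀).symm z.1)) z.1 v)
  have h3 := S.metricC_transition (t := z.2) hz.1 ho.2 v v
  have h4 : transition n x₀ ((extChartAt (𝓡 n) x₀).symm z.1) z.1
      = extChartAt (𝓡 n) ((extChartAt (𝓡 n) x₀).symm z.1) ((extChartAt (𝓡 n) x₀).symm z.1) := rfl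
  rw [← S.metricC_self, ← h4, h3] at h
  exact h

theorem fderiv_lapseC (S : SplitMetric n M t₀) {x₀ : M} {z : 𝓔 × ℝ} (hz : z ∈ S.chartDom x₀)
    (v : 𝓔) : fderiv ℝ (S.lapseC x₀) z (v, 0)
      = S.lapseD z.2 ((extChartAt (𝓡 n) x₀).symm z.1) (chartSymmD x₀ z.1 v) := by
  have : IsManifold (𝓡 n) 1 M := IsManifold.of_le (n := ∞) (by norm_cast)
  have h1 : HasFDerivAt (fun y : 𝓔 => S.lapseC x₀ (y, z.2)) _ z.1 :=
    HasFDerivAt.comp (g := S.lapseC x₀) z.1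
      ((S.contDiffAt_lapseC hz).differentiableAt (by simp)).hasFDerivAt
      ((hasFDerivAt_id z.1).prodMk (hasFDerivAt_const z.2 z.1))
  have h2 : HasMFDerivAt 𝓘(ℝ, 𝓔) (𝓡 n) (extChartAt (𝓡 n) x₀).symm z.1
      (chartSymmD x₀ z.1) := by
    have h := (mdifferentiableWithinAt_extChartAt_symm (I := 𝓡 n) hz.1).hasMFDerivWithinAt
    exact h.hasMFDerivAt (by simp)
  have h3 : MDifferentiableAt (𝓡 n) 𝓘(ℝ, ℝ) (S.lapse z.2) ((extChartAt (𝓡 n) x₀).symm z.1) := by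
    have h4 := S.lapse_smooth.contMDiffAt
      (x := ((extChartAt (𝓡 n) x₀).symm z.1, z.2)) (isOpen_timeDom.mem_nhds hz.2)
    have h5 : ContMDiffAt (𝓡 n) ((𝓡 n).prod 𝓘(ℝ, ℝ)) ∞ (fun x : M => (x, z.2))
      ((extChartAt (𝓡 n) x₀).symm z.1) := contMDiffAt_id.prodMk contMDiffAt_const
    exact (h4.comp ((extChartAt (𝓡 n) x₀).symm z.1) h5).mdifferentiableAt (by simp)
  have h6 := (h3.hasMFDerivAt.comp z.1 h2).hasFDerivAt
  have h7 := DFunLike.congr_fun (h1.unique h6) v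
  simpa using! h7

theorem abs_fderiv_lapseC_le (S : SplitMetric n M t₀) {x₀ : M} {z : 𝓔 × ℝ}
    (hz : z ∈ S.chartDom x₀) (v : 𝓔) :
    |fderiv ℝ (S.lapseC x₀) z (v, 0)| ≤ S.normGradLapse z.2 ((extChartAt (𝓡 n) x₀).symm z.1)
      * Real.sqrt (S.metricC x₀ z v v) := by
  rw [S.fderiv_lapseC hz, metricC_apply]
  exact S.abs_lapseD_le hz.2 _ _

end SplitMetric

/-! ### An integral inequality -/

/-- If `|(log e)'| ≤ F(t) t'` along an increasing function `t` of the parameter, then `log e` varies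
by at most the integral of `F`. -/
theorem abs_log_sub_log_le_integral {e e' t τ F : ℝ → ℝ} {a b : ℝ} (hab : a ≤ b)
    (he : ∀ r ∈ Icc a b, HasDerivWithinAt e (e' r) (Icc a b) r)
    (ht : ∀ r ∈ Icc a b, HasDerivWithinAt t (τ r) (Icc a b) r)
    (hpos : ∀ r ∈ Icc a b, 0 < e r) (hτ : ∀ r ∈ Icc a b, 0 < τ r)
    (hle : ∀ r ∈ Icc a b, |e' r| ≤ e r * (τ r * F (t r)))
    (hF : IntegrableOn F (Ici (t a))) (hF0 : ∀ r, t a ≤ r → 0 ≤ F r) :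
    |Real.log (e b) - Real.log (e a)| ≤ ∫ r in Ici (t a), F r := by
  have htc : ContinuousOn t (Icc a b) := fun r hr => (ht r hr).continuousWithinAt
  have hmono : StrictMonoOn t (Icc a b) := by
    refine strictMonoOn_of_deriv_pos (convex_Icc a b) htc fun r hr => ?_
    rw [interior_Icc] at hr
    rw [((ht r (Ioo_subset_Icc_self hr)).hasDerivAt (Icc_mem_nhds hr.1 hr.2)).deriv]
    exact hτ r (Ioo_subset_Icc_self hr)
  have himg : t '' Icc a b ⊆ Ici (t a) := by
    rintro _ ⟨r, hr, rfl⟩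
    exact hmono.monotoneOn (left_mem_Icc.2 hab) hr hr.1
  have hint : IntegrableOn (fun r => |τ r| • F (t r)) (Icc a b) :=
    (integrableOn_image_iff_integrableOn_abs_deriv_smul measurableSet_Icc ht hmono.injOn F).1
      (hF.mono_set himg)
  have hint' : IntegrableOn (fun r => τ r * F (t r)) (Icc a b) :=
    hint.congr_fun (fun r hr => by simp [abs_of_pos (hτ r hr)]) measurableSet_Icc
  have hI : ∫ r in a..b, τ r * F (t r) ≤ ∫ r in Ici (t a), F r := by
    rw [intervalIntegral.integral_of_le hab, ← integral_Icc_eq_integral_Ioc]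
    calc ∫ r in Icc a b, τ r * F (t r) = ∫ r in Icc a b, |τ r| • F (t r) :=
          setIntegral_congr_fun measurableSet_Icc fun r hr => by simp [abs_of_pos (hτ r hr)]
      _ = ∫ r in t '' Icc a b, F r :=
          (integral_image_eq_integral_abs_deriv_smul measurableSet_Icc ht hmono.injOn F).symm
      _ ≤ ∫ r in Ici (t a), F r :=
          setIntegral_mono_set hF ((ae_restrict_iff' measurableSet_Ici).2
            (Eventually.of_forall fun r hr => hF0 r hr)) himg.eventuallyLE
  have hlog : ∀ r ∈ Icc a b, HasDerivWithinAt (fun r => Real.log (e r)) (e' r / e r) (Icc a b) r :=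
    fun r hr => (he r hr).log (hpos r hr).ne'
  have hcont : ContinuousOn (fun r => Real.log (e r)) (Icc a b) := fun r hr =>
    (hlog r hr).continuousWithinAt
  have hbd : ∀ r ∈ Icc a b, |e' r / e r| ≤ τ r * F (t r) := fun r hr => by
    rw [abs_div, abs_of_pos (hpos r hr), div_le_iff₀ (hpos r hr), mul_comm]
    exact hle r hr
  have hright : ∀ r ∈ Ioo a b, HasDerivWithinAt (fun r => Real.log (e r)) (e' r / e r) (Ioi r) r :=
    fun r hr => ((hlog r (Ioo_subset_Icc_self hr)).hasDerivAt
      (Icc_mem_nhds hr.1 hr.2)).hasDerivWithinAt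
  have h1 := intervalIntegral.sub_le_integral_of_hasDeriv_right_of_le hab hcont hright hint'
    fun r hr => (le_abs_self _).trans (hbd r (Ioo_subset_Icc_self hr))
  have h2 := intervalIntegral.sub_le_integral_of_hasDeriv_right_of_le hab hcont.neg
    (fun r hr => (hright r hr).neg) hint'
    fun r hr => (neg_le_abs _).trans (hbd r (Ioo_subset_Icc_self hr))
  rw [abs_le]
  simp only [Pi.neg_apply] at h2
  constructor <;> linarith

namespace SplitMetric

variable {n : ℕ} {M : Type*} [TopologicalSpace M]
  [ChartedSpace (EuclideanSpace ℝ (Fin n)) M] [IsManifold (𝓡 n) ∞ M] {t₀ : ℝ}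

local notation "𝓔" => EuclideanSpace ℝ (Fin n)

/-! ### Geodesics in product charts -/

/-- A curve of the spacetime in the chart around `x₀`. -/
def curveC (n : ℕ) {M : Type*} [TopologicalSpace M]
    [ChartedSpace (EuclideanSpace ℝ (Fin n)) M] (x₀ : M) (c : ℝ → M × ℝ) (r : ℝ) :
    EuclideanSpace ℝ (Fin n) × ℝ :=
  (extChartAt (𝓡 n) x₀ (c r).1, (c r).2)

theorem curveC_mem (S : SplitMetric n M t₀) {x₀ : M} {c : ℝ → M × ℝ} {s : ℝ} (ht : t₀ < (c s).2)
    (hs : (c s).1 ∈ (extChartAt (𝓡 n) x₀).source) : curveC n x₀ c s ∈ S.chartDom x₀ :=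
  ⟨(extChartAt (𝓡 n) x₀).map_source hs, ht⟩

theorem symm_curveC {x₀ : M} {c : ℝ → M × ℝ} {s : ℝ}
    (hs : (c s).1 ∈ (extChartAt (𝓡 n) x₀).source) :
    (extChartAt (𝓡 n) x₀).symm (curveC n x₀ c s).1 = (c s).1 :=
  (extChartAt (𝓡 n) x₀).left_inv hs

theorem contDiffWithinAt_curveC {x₀ : M} {c : ℝ → M × ℝ} {J : Set ℝ} {s : ℝ}
    (hc : ContMDiffWithinAt 𝓘(ℝ, ℝ) ((𝓡 n).prod 𝓘(ℝ, ℝ)) 2 c J s)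
    (hs : (c s).1 ∈ (extChartAt (𝓡 n) x₀).source) :
    ContDiffWithinAt ℝ 2 (curveC n x₀ c) J s := by
  have : IsManifold (𝓡 n) 2 M := IsManifold.of_le (n := ∞) (by norm_cast)
  rw [← contMDiffWithinAt_iff_contDiffWithinAt]
  have h1 : ContMDiffAt (𝓡 n) 𝓘(ℝ, 𝓔) 2 (extChartAt (𝓡 n) x₀) (c s).1 :=
    contMDiffAt_extChartAt' (by rwa [← extChartAt_source (𝓡 n)])
  have h2 : ContMDiffWithinAt 𝓘(ℝ, ℝ) (𝓡 n) 2 (fun r => (c r).1) J s :=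
    contMDiffAt_fst.comp_contMDiffWithinAt s hc
  have h3 : ContMDiffWithinAt 𝓘(ℝ, ℝ) 𝓘(ℝ, ℝ) 2 (fun r => (c r).2) J s :=
    contMDiffAt_snd.comp_contMDiffWithinAt s hc
  have h4 := (h1.comp_contMDiffWithinAt s h2).prodMk_space h3
  exact h4

theorem hasDerivWithinAt_curveC {x₀ : M} {c : ℝ → M × ℝ} {J : Set ℝ} {s : ℝ}
    (hc : ContMDiffWithinAt 𝓘(ℝ, ℝ) ((𝓡 n).prod 𝓘(ℝ, ℝ)) 2 c J s)
    (hs : (c s).1 ∈ (extChartAt (𝓡 n) x₀).source) :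
    HasDerivWithinAt (curveC n x₀ c) (derivWithin (curveC n x₀ c) J s) J s :=
  ((contDiffWithinAt_curveC hc hs).differentiableWithinAt (by norm_num)).hasDerivWithinAt

theorem hasDerivWithinAt_derivWithin_curveC {x₀ : M} {c : ℝ → M × ℝ} {J : Set ℝ} {s : ℝ}
    (hJ : UniqueDiffOn ℝ J) (hsJ : s ∈ J)
    (hc : ContMDiffWithinAt 𝓘(ℝ, ℝ) ((𝓡 n).prod 𝓘(ℝ, ℝ)) 2 c J s)
    (hs : (c s).1 ∈ (extChartAt (𝓡 n) x₀).source) :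
    HasDerivWithinAt (derivWithin (curveC n x₀ c) J)
      (derivWithin (derivWithin (curveC n x₀ c) J) J s) J s :=
  (((contDiffWithinAt_curveC hc hs).derivWithin (m := 1) hJ (by norm_num)
    hsJ).differentiableWithinAt (by norm_num)).hasDerivWithinAt

theorem extChartAt_prod_curve (p₀ : M × ℝ) (c : ℝ → M × ℝ) :
    (fun r => extChartAt ((𝓡 n).prod 𝓘(ℝ, ℝ)) p₀ (c r)) = curveC n p₀.1 c := by
  funext r; exact extChartAt_prod_apply p₀ (c r)

/-- The geodesic equation in the chart around `x₀`. -/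
theorem geodesic_equation (S : SplitMetric n M t₀) {x₀ : M} {c : ℝ → M × ℝ} {J : Set ℝ} {s : ℝ}
    (hc : S.IsSpacetimeGeodesicOn c J) (hsJ : s ∈ J)
    (hs : (c s).1 ∈ (extChartAt (𝓡 n) x₀).source) (w : 𝓔 × ℝ) :
    S.lorentzC x₀ (curveC n x₀ c s) (derivWithin (derivWithin (curveC n x₀ c) J) J s) w
      + christoffelForm (S.lorentzC x₀) (curveC n x₀ c s) (derivWithin (curveC n x₀ c) J s)
        (derivWithin (curveC n x₀ c) J s) w = 0 := by
  have h : ∀ ξ : ℝ → 𝓔 × ℝ,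
      (fun r => extChartAt ((𝓡 n).prod 𝓘(ℝ, ℝ)) ((x₀, 0) : M × ℝ) (c r)) = ξ →
      metricInChart ((𝓡 n).prod 𝓘(ℝ, ℝ)) S.spacetimeMetric ((x₀, 0) : M × ℝ) (ξ s)
          (derivWithin (derivWithin ξ J) J s) w
        + christoffelFirst ((𝓡 n).prod 𝓘(ℝ, ℝ)) S.spacetimeMetric ((x₀, 0) : M × ℝ) (ξ s)
          (derivWithin ξ J s) (derivWithin ξ J s) w = 0 := by
    rintro _ rfl
    exact hc.2.2 s hsJ (x₀, 0) (mem_extChartAt_prod_source.2 hs) w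
  have hm := S.curveC_mem (hc.1 s hsJ) hs
  have h' := h _ (extChartAt_prod_curve _ c)
  exact (congrArg₂ (· + ·) (S.metricInChart_eq (x₀, 0) hm.1 _ _)
    (S.christoffelFirst_eq (x₀, 0) hm _ _ _)).symm.trans h'

/-- The square of the velocity, in the chart around `x₀`. -/
theorem spacetimeMetric_curveVelocity (S : SplitMetric n M t₀) {x₀ : M} {c : ℝ → M × ℝ}
    {J : Set ℝ} {s : ℝ} (hJ : UniqueDiffWithinAt ℝ J s) (ht : t₀ < (c s).2)
    (hc : ContMDiffWithinAt 𝓘(ℝ, ℝ) ((𝓡 n).prod 𝓘(ℝ, ℝ)) 2 c J s)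
    (hs : (c s).1 ∈ (extChartAt (𝓡 n) x₀).source) :
    S.spacetimeMetric (c s) (curveVelocity ((𝓡 n).prod 𝓘(ℝ, ℝ)) c J s)
        (curveVelocity ((𝓡 n).prod 𝓘(ℝ, ℝ)) c J s)
      = S.lorentzC x₀ (curveC n x₀ c s) (derivWithin (curveC n x₀ c) J s)
          (derivWithin (curveC n x₀ c) J s) := by
  have hself : (c s).1 ∈ (extChartAt (𝓡 n) (c s).1).source := mem_extChartAt_source _
  set u := derivWithin (curveC n (c s).1 c) J s with hu
  have hv : curveVelocity ((𝓡 n).prod 𝓘(ℝ, ℝ)) c J s = u := by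
    have h1 : MDifferentiableWithinAt 𝓘(ℝ, ℝ) ((𝓡 n).prod 𝓘(ℝ, ℝ)) c J s :=
      hc.mdifferentiableWithinAt (by norm_num)
    have h2 : writtenInExtChartAt 𝓘(ℝ, ℝ) ((𝓡 n).prod 𝓘(ℝ, ℝ)) s c = curveC n (c s).1 c := by
      funext r
      exact extChartAt_prod_apply (c s) (c r)
    have h3 : mfderivWithin 𝓘(ℝ, ℝ) ((𝓡 n).prod 𝓘(ℝ, ℝ)) c J s
        = fderivWithin ℝ (curveC n (c s).1 c) J s := by
      rw [← h2]
      refine (h1.mfderivWithin).trans ?_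
      simp only [mfld_simps, inter_univ]
      rfl
    rw [curveVelocity, h3]
    rfl
  have h3 : S.spacetimeMetric (c s) (curveVelocity ((𝓡 n).prod 𝓘(ℝ, ℝ)) c J s)
        (curveVelocity ((𝓡 n).prod 𝓘(ℝ, ℝ)) c J s)
      = S.lorentzC (c s).1 (curveC n (c s).1 c s) u u := by
    rw [hv, lorentzC_apply]
    have e1 : curveC n (c s).1 c s = (extChartAt (𝓡 n) (c s).1 (c s).1, (c s).2) := rfl
    rw [e1, S.metricC_self, S.shiftC_self, S.lapseC_self, ← mul_assoc]
    rfl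
  have hz : curveC n x₀ c s ∈ S.overlap x₀ (c s).1 := by
    refine ⟨S.curveC_mem ht hs, ?_⟩
    rw [symm_curveC hs]; exact hself
  have h4 : transitionT n x₀ (c s).1 (curveC n x₀ c s) = curveC n (c s).1 c s := by
    simp only [transitionT, transition, symm_curveC hs]; rfl
  have h5 : u = fderiv ℝ (transitionT n x₀ (c s).1) (curveC n x₀ c s)
      (derivWithin (curveC n x₀ c) J s) := by
    have e1 : HasFDerivAt (transitionT n x₀ (c s).1)
        (fderiv ℝ (transitionT n x₀ (c s).1) (curveC n x₀ c s)) (curveC n x₀ c s) :=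
      ((S.contDiffAt_transitionT hz).differentiableAt (by simp)).hasFDerivAt
    have e2 := e1.comp_hasDerivWithinAt s (hasDerivWithinAt_curveC hc hs)
    have e3 : HasDerivWithinAt (curveC n (c s).1 c) _ J s := e2.congr_of_eventuallyEq (by
      have e4 : ∀ᶠ r in 𝓝[J] s, (c r).1 ∈ (extChartAt (𝓡 n) x₀).source :=
        (continuous_fst.continuousAt.comp_continuousWithinAt
          hc.continuousWithinAt).preimage_mem_nhdsWithin
          ((isOpen_extChartAt_source x₀).mem_nhds hs)
      filter_upwards [e4] with r hr
      simp only [Function.comp_apply, transitionT, transition, symm_curveC hr]; rfl) h4.symm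
    exact e3.derivWithin hJ
  rw [h3, S.lorentzC_transitionT hz, h4, h5]

theorem hasDerivWithinAt_time {c : ℝ → M × ℝ} {J : Set ℝ} {s : ℝ}
    (hc : ContMDiffWithinAt 𝓘(ℝ, ℝ) ((𝓡 n).prod 𝓘(ℝ, ℝ)) 2 c J s) :
    HasDerivWithinAt (fun r => (c r).2) (derivWithin (curveC n (c s).1 c) J s).2 J s :=
  (hasDerivWithinAt_curveC hc (mem_extChartAt_source _)).snd

theorem timeRate_eq {x₀ : M} {c : ℝ → M × ℝ} {J : Set ℝ} {s : ℝ} (hJ : UniqueDiffWithinAt ℝ J s)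
    (hc : ContMDiffWithinAt 𝓘(ℝ, ℝ) ((𝓡 n).prod 𝓘(ℝ, ℝ)) 2 c J s)
    (hs : (c s).1 ∈ (extChartAt (𝓡 n) x₀).source) :
    timeRate c J s = (derivWithin (curveC n x₀ c) J s).2 :=
  HasDerivWithinAt.derivWithin ((hasDerivWithinAt_curveC hc hs).snd) hJ

/-! ### The energy estimate -/

/-- A future-directed causal geodesic: the common case of timelike and null geodesics. -/
def IsFutureCausalGeodesicOn (S : SplitMetric n M t₀) (c : ℝ → M × ℝ) (J : Set ℝ) : Prop :=
  S.IsSpacetimeGeodesicOn c J ∧ ∀ s ∈ J,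
    S.spacetimeMetric (c s) (curveVelocity ((𝓡 n).prod 𝓘(ℝ, ℝ)) c J s)
      (curveVelocity ((𝓡 n).prod 𝓘(ℝ, ℝ)) c J s) ≤ 0 ∧ 0 < timeRate c J s

/-- The energy `N dt/ds` of a curve, measured by the observers normal to the slices. -/
def energy (S : SplitMetric n M t₀) (c : ℝ → M × ℝ) (J : Set ℝ) (s : ℝ) : ℝ :=
  S.lapse (c s).2 (c s).1 * timeRate c J s

/-- The horizontal part of the velocity of a causal curve is bounded by its energy. -/
theorem metricC_horizontal_le (S : SplitMetric n M t₀) {x₀ : M} {c : ℝ → M × ℝ} {J : Set ℝ}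
    {s : ℝ} (hJ : UniqueDiffOn ℝ J) (hc : S.IsFutureCausalGeodesicOn c J) (hsJ : s ∈ J)
    (hs : (c s).1 ∈ (extChartAt (𝓡 n) x₀).source) :
    S.metricC x₀ (curveC n x₀ c s) (horizontal (S.shiftC x₀ (curveC n x₀ c s))
        (derivWithin (curveC n x₀ c) J s)) (horizontal (S.shiftC x₀ (curveC n x₀ c s))
        (derivWithin (curveC n x₀ c) J s)) ≤ S.energy c J s ^ 2 := by
  have h := (hc.2 s hsJ).1
  have hl : S.lapseC x₀ (curveC n x₀ c s) = S.lapse (c s).2 (c s).1 := by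
    rw [lapseC, symm_curveC hs]; rfl
  rw [S.spacetimeMetric_curveVelocity (hJ s hsJ) (hc.1.1 s hsJ) (hc.1.2.1 s hsJ) hs,
    lorentzC_apply, hl, ← timeRate_eq (hJ s hsJ) (hc.1.2.1 s hsJ) hs] at h
  simp only [horizontal_apply, energy]
  rw [← timeRate_eq (hJ s hsJ) (hc.1.2.1 s hsJ) hs]
  nlinarith

/-- The derivative of the energy along a causal geodesic only involves the derivative of the lapse
along the slices and the extrinsic curvature. -/
theorem hasDerivWithinAt_energy (S : SplitMetric n M t₀) {c : ℝ → M × ℝ} {J : Set ℝ}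
    {s NM : ℝ} (hN : ∀ t, t₀ < t → ∀ x, 0 < S.lapse t x ∧ S.lapse t x ≤ NM)
    (hJ : UniqueDiffOn ℝ J) (hc : S.IsFutureCausalGeodesicOn c J) (hsJ : s ∈ J) :
    ∃ e', HasDerivWithinAt (S.energy c J) e' J s ∧
      |e'| ≤ S.energy c J s * (timeRate c J s * (S.normGradLapse (c s).2 (c s).1
        + NM * S.normExtrinsicCurvature (c s).2 (c s).1)) := by
  set x₀ := (c s).1 with hx₀
  have hs : (c s).1 ∈ (extChartAt (𝓡 n) x₀).source := mem_extChartAt_source _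
  have hcm := hc.1.2.1 s hsJ
  set z := curveC n x₀ c s with hz
  set u := derivWithin (curveC n x₀ c) J s with hu
  have hzm : z ∈ S.chartDom x₀ := S.curveC_mem (hc.1.1 s hsJ) hs
  have hl : S.lapseC x₀ z = S.lapse (c s).2 x₀ := by
    rw [lapseC, symm_curveC hs]; rfl
  have hev : ∀ᶠ r in 𝓝[J] s, (c r).1 ∈ (extChartAt (𝓡 n) x₀).source :=
    (continuous_fst.continuousAt.comp_continuousWithinAt
      hcm.continuousWithinAt).preimage_mem_nhdsWithin ((isOpen_extChartAt_source x₀).mem_nhds hs)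
  have h1 : HasDerivWithinAt (fun r => S.lapseC x₀ (curveC n x₀ c r))
      (fderiv ℝ (S.lapseC x₀) z u) J s :=
    HasFDerivAt.comp_hasDerivWithinAt (l := S.lapseC x₀) (f := curveC n x₀ c) s
      (((S.contDiffAt_lapseC hzm).differentiableAt (by simp)).hasFDerivAt)
      (hasDerivWithinAt_curveC hcm hs)
  have h2 : HasDerivWithinAt (fun r => (derivWithin (curveC n x₀ c) J r).2)
      (derivWithin (derivWithin (curveC n x₀ c) J) J s).2 J s :=
    (hasDerivWithinAt_derivWithin_curveC hJ hsJ hcm hs).snd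
  have hτ := timeRate_eq (hJ s hsJ) hcm hs
  rw [← hu] at hτ
  have hEeq : ∀ r ∈ J, (c r).1 ∈ (extChartAt (𝓡 n) x₀).source →
      S.energy c J r = S.lapseC x₀ (curveC n x₀ c r) * (derivWithin (curveC n x₀ c) J r).2 := by
    intro r hr hr'
    rw [energy, timeRate_eq (hJ r hr) (hc.1.2.1 r hr) hr', lapseC, symm_curveC hr']; rfl
  have h3 : HasDerivWithinAt (S.energy c J) _ J s := (h1.mul h2).congr_of_eventuallyEq
    (by
      filter_upwards [hev, self_mem_nhdsWithin] with r hr hrJ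
      exact hEeq r hrJ hr) (hEeq s hsJ hs)
  refine ⟨_, h3, ?_⟩
  -- the component of the geodesic equation along `e₀`, which contains the second derivative of `t`
  have hgeo := S.geodesic_equation hc.1 hsJ hs (S.normalC x₀ z)
  rw [lorentzC_normalC, S.christoffelForm_normalC hzm] at hgeo
  have hvle := S.metricC_horizontal_le hJ hc hsJ hs
  rw [horizontal_apply] at hvle
  rw [← hz, ← hu] at hgeo hvle
  set v := u.1 + u.2 • S.shiftC x₀ z with hv
  have hNp : 0 < S.lapseC x₀ z := hl ▸ (hN _ (hc.1.1 s hsJ) _).1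
  have hNM : S.lapseC x₀ z ≤ NM := hl ▸ (hN _ (hc.1.1 s hsJ) _).2
  have hK := S.abs_secondForm_le hzm hNp v
  have hG := S.abs_fderiv_lapseC_le hzm v
  rw [symm_curveC hs] at hK hG
  have hz2 : z.2 = (c s).2 := rfl
  rw [hz2, ← hx₀] at hK hG
  have hτpos : 0 < u.2 := hτ ▸ (hc.2 s hsJ).2
  have hen : S.energy c J s = S.lapseC x₀ z * u.2 := hEeq s hsJ hs
  have hkn : 0 ≤ S.normExtrinsicCurvature (c s).2 x₀ := Real.sqrt_nonneg _
  have hgn : 0 ≤ S.normGradLapse (c s).2 x₀ := Real.sqrt_nonneg _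
  have hsq : Real.sqrt (S.metricC x₀ z v v) ≤ S.lapseC x₀ z * u.2 := by
    rw [← hen]
    exact Real.sqrt_le_left (by rw [hen]; positivity) |>.2 hvle
  rw [hen] at hvle ⊢
  rw [hτ]
  generalize S.lapseC x₀ z = N at *
  generalize (derivWithin (derivWithin (curveC n x₀ c) J) J s).2 = b at *
  generalize fderiv ℝ (S.lapseC x₀) z u = d at *
  generalize fderiv ℝ (S.lapseC x₀) z (v, 0) = g at *
  generalize S.secondForm x₀ z v v = k at *
  generalize S.normExtrinsicCurvature (c s).2 x₀ = kn at *
  generalize S.normGradLapse (c s).2 x₀ = gn at *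
  generalize S.metricC x₀ z v v = m at *
  generalize u.2 = τ at *
  have e1 : N * (d * τ + N * b) = k - N * τ * g := by linarith
  have e2 : |k| ≤ N * kn * (N * τ) ^ 2 := hK.trans (by gcongr)
  have e3 : |g| ≤ gn * (N * τ) := hG.trans (by gcongr)
  have e4 : N * |d * τ + N * b| ≤ N * (N * τ * (τ * (gn + NM * kn))) := by
    calc N * |d * τ + N * b| = |k - N * τ * g| := by
          rw [← abs_of_pos hNp, ← abs_mul, abs_of_pos hNp, e1]
      _ ≤ |k| + |N * τ * g| := abs_sub _ _
      _ = |k| + N * τ * |g| := by rw [abs_mul, abs_of_pos (mul_pos hNp hτpos)]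
      _ ≤ N * kn * (N * τ) ^ 2 + N * τ * (gn * (N * τ)) := by gcongr
      _ = N * (N * τ * (τ * (gn + N * kn))) := by ring
      _ ≤ N * (N * τ * (τ * (gn + NM * kn))) := by gcongr
  exact le_of_mul_le_mul_left e4 hNp

/-- Along a future-directed causal geodesic the logarithm of the energy is bounded on both sides. -/
theorem abs_log_energy_le (S : SplitMetric n M t₀) {c : ℝ → M × ℝ} {J : Set ℝ}
    {a b NM : ℝ} {f₁ f₂ : ℝ → ℝ}
    (hN : ∀ t, t₀ < t → ∀ x, 0 < S.lapse t x ∧ S.lapse t x ≤ NM)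
    (hJ : UniqueDiffOn ℝ J) (hc : S.IsFutureCausalGeodesicOn c J) (hab : a ≤ b)
    (hIJ : Icc a b ⊆ J)
    (hf₁ : IntegrableOn f₁ (Ici (c a).2)) (hf₂ : IntegrableOn f₂ (Ici (c a).2))
    (h₁ : ∀ t, (c a).2 ≤ t → ∀ x : M, S.normGradLapse t x ≤ f₁ t)
    (h₂ : ∀ t, (c a).2 ≤ t → ∀ x : M, S.normExtrinsicCurvature t x ≤ f₂ t) :
    |Real.log (S.energy c J b) - Real.log (S.energy c J a)|
      ≤ ∫ t in Ici (c a).2, (f₁ t + NM * f₂ t) := by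
  have hNM : 0 ≤ NM := by
    have h := hN _ (hc.1.1 a (hIJ (left_mem_Icc.2 hab))) (c a).1
    linarith [h.1, h.2]
  have hF0 : ∀ t, (c a).2 ≤ t → 0 ≤ f₁ t + NM * f₂ t := fun t ht =>
    add_nonneg ((Real.sqrt_nonneg _).trans (h₁ t ht (c a).1))
      (mul_nonneg hNM ((Real.sqrt_nonneg _).trans (h₂ t ht (c a).1)))
  choose! e' he' hle using fun r (hr : r ∈ J) => S.hasDerivWithinAt_energy hN hJ hc hr
  have ht : ∀ r ∈ J, HasDerivWithinAt (fun r => (c r).2) (timeRate c J r) J r := fun r hr =>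
    (hasDerivWithinAt_time (hc.1.2.1 r hr)).differentiableWithinAt.hasDerivWithinAt
  have htm : MonotoneOn (fun r => (c r).2) (Icc a b) := by
    refine monotoneOn_of_deriv_nonneg (convex_Icc a b)
      (fun r hr => (ht r (hIJ hr)).continuousWithinAt.mono hIJ) (fun r hr => ?_) (fun r hr => ?_)
    all_goals
      rw [interior_Icc] at hr
      have h := ((ht r (hIJ (Ioo_subset_Icc_self hr))).mono hIJ).hasDerivAt
        (Icc_mem_nhds hr.1 hr.2)
    · exact h.differentiableAt.differentiableWithinAt
    · rw [h.deriv]; exact (hc.2 r (hIJ (Ioo_subset_Icc_self hr))).2.le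
  refine abs_log_sub_log_le_integral (t := fun r => (c r).2) (τ := timeRate c J)
    (F := fun t => f₁ t + NM * f₂ t) hab
    (fun r hr => (he' r (hIJ hr)).mono hIJ) (fun r hr => (ht r (hIJ hr)).mono hIJ)
    (fun r hr => mul_pos (hN _ (hc.1.1 r (hIJ hr)) _).1 (hc.2 r (hIJ hr)).2)
    (fun r hr => (hc.2 r (hIJ hr)).2) (fun r hr => ?_) (hf₁.add (hf₂.const_mul NM)) hF0
  refine (hle r (hIJ hr)).trans ?_
  have hta : (c a).2 ≤ (c r).2 := htm (left_mem_Icc.2 hab) hr hr.1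
  have p1 := (hN _ (hc.1.1 r (hIJ hr)) (c r).1).1
  have p2 := (hc.2 r (hIJ hr)).2
  have p3 : 0 < S.energy c J r := mul_pos p1 p2
  have := h₁ _ hta (c r).1
  have := h₂ _ hta (c r).1
  gcongr

/-! ### Normal curves of the slices -/

/-- A curve `x` in `M`, parametrized by `t ∈ J`, is a normal curve if `t ↦ (x t, t)` is an integral
curve of `e₀ = ∂_t - β`, that is if `x' = -β` in every chart. -/
def IsNormalOn (S : SplitMetric n M t₀) (x : ℝ → M) (J : Set ℝ) : Prop :=
  ∀ r ∈ J, t₀ < r ∧ ContinuousAt x r ∧ ∀ x₀ : M, x r ∈ (extChartAt (𝓡 n) x₀).source →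
    HasDerivAt (fun s => extChartAt (𝓡 n) x₀ (x s))
      (-S.shiftC x₀ (extChartAt (𝓡 n) x₀ (x r), r)) r

theorem IsNormalOn.mono {S : SplitMetric n M t₀} {x : ℝ → M} {J J' : Set ℝ}
    (h : S.IsNormalOn x J) (hJ : J' ⊆ J) : S.IsNormalOn x J' := fun r hr => h r (hJ hr)

theorem IsNormalOn.congr_eventually {S : SplitMetric n M t₀} {x x' : ℝ → M} {J : Set ℝ} {r : ℝ}
    (h : S.IsNormalOn x J) (hr : r ∈ J) (he : x' =ᶠ[𝓝 r] x) :
    S.IsNormalOn x' {r} := by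
  rintro _ rfl
  obtain ⟨h1, h2, h3⟩ := h _ hr
  have h0 := he.eq_of_nhds
  refine ⟨h1, h2.congr he.symm, fun x₀ hx₀ => ?_⟩
  rw [h0] at hx₀ ⊢
  exact (h3 x₀ hx₀).congr_of_eventuallyEq (he.fun_comp _)

theorem isNormalOn_of_forall {S : SplitMetric n M t₀} {x : ℝ → M} {J : Set ℝ}
    (h : ∀ r ∈ J, S.IsNormalOn x {r}) : S.IsNormalOn x J := fun r hr => h r hr r rfl

/-- The equation of a normal curve has to be checked in one chart only. -/
theorem isNormalOn_singleton_of_hasDerivAt (S : SplitMetric n M t₀) {x : ℝ → M} {r : ℝ} {x₀ : M}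
    (hr : t₀ < r) (hx : ContinuousAt x r) (hx₀ : x r ∈ (extChartAt (𝓡 n) x₀).source)
    (h : HasDerivAt (fun s => extChartAt (𝓡 n) x₀ (x s))
      (-S.shiftC x₀ (extChartAt (𝓡 n) x₀ (x r), r)) r) : S.IsNormalOn x {r} := by
  intro r' hr'
  obtain rfl : r' = r := hr'
  refine ⟨hr, hx, fun x₁ hx₁ => ?_⟩
  set y := extChartAt (𝓡 n) x₀ (x r') with hy
  have hyt : y ∈ (extChartAt (𝓡 n) x₀).target := (extChartAt (𝓡 n) x₀).map_source hx₀
  have hys : (extChartAt (𝓡 n) x₀).symm y = x r' := (extChartAt (𝓡 n) x₀).left_inv hx₀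
  have hy' : (extChartAt (𝓡 n) x₀).symm y ∈ (extChartAt (𝓡 n) x₁).source := by rwa [hys]
  have h1 : HasFDerivAt (transition n x₀ x₁) (fderiv ℝ (transition n x₀ x₁) y) y :=
    ((contDiffAt_transition hyt hy').differentiableAt (by simp)).hasFDerivAt
  have h2 := h1.comp_hasDerivAt r' h
  rw [map_neg, ← S.shiftC_transition hyt hy' r'] at h2
  have h3 : transition n x₀ x₁ y = extChartAt (𝓡 n) x₁ (x r') := by rw [transition, hys]
  rw [h3] at h2
  refine h2.congr_of_eventuallyEq ?_
  filter_upwards [hx.preimage_mem_nhds ((isOpen_extChartAt_source x₀).mem_nhds hx₀)] with s hs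
  simp only [Function.comp_apply, transition, (extChartAt (𝓡 n) x₀).left_inv hs]

/-- Local uniqueness of normal curves. -/
theorem IsNormalOn.eventuallyEq {S : SplitMetric n M t₀} {x y : ℝ → M} {J : Set ℝ} {r : ℝ}
    (hx : S.IsNormalOn x J) (hy : S.IsNormalOn y J) (hr : J ∈ 𝓝 r) (h : x r = y r) :
    x =ᶠ[𝓝 r] y := by
  have hrJ := mem_of_mem_nhds hr
  obtain ⟨h0, hxc, hxd⟩ := hx r hrJ
  have hyc := (hy r hrJ).2.1
  set q := x r with hq
  have hqs : q ∈ (extChartAt (𝓡 n) q).source := mem_extChartAt_source q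
  have hz : (extChartAt (𝓡 n) q q, r) ∈ S.chartDom q := ⟨(extChartAt (𝓡 n) q).map_source hqs, h0⟩
  obtain ⟨K, s, hs, hl⟩ :=
    ((S.contDiffAt_shiftC hz).of_le (m := 1) (by norm_cast)).exists_lipschitzOnWith
  obtain ⟨s₁, hs₁, s₂, hs₂, hss⟩ := mem_nhds_prod_iff.1 hs
  have hsrc := (isOpen_extChartAt_source (I := 𝓡 n) q).mem_nhds hqs
  have hcont : ∀ w : ℝ → M, ContinuousAt w r → w r = q →
      ∀ᶠ s in 𝓝 r, w s ∈ (extChartAt (𝓡 n) q).source ∧ extChartAt (𝓡 n) q (w s) ∈ s₁ := by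
    intro w hw hwq
    have h1 : ContinuousAt (fun s => extChartAt (𝓡 n) q (w s)) r :=
      ContinuousAt.comp (by rw [hwq]; exact continuousAt_extChartAt q) hw
    exact (hw.eventually_mem (by rwa [hwq])).and (h1.eventually_mem (by simpa only [hwq]))
  have hev : ∀ w : ℝ → M, S.IsNormalOn w J → ContinuousAt w r → w r = q → ∀ᶠ s in 𝓝 r,
      HasDerivAt (fun s => extChartAt (𝓡 n) q (w s))
        ((fun t y => -S.shiftC q (y, t)) s (extChartAt (𝓡 n) q (w s))) s ∧
        extChartAt (𝓡 n) q (w s) ∈ (fun _ : ℝ => s₁) s := by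
    intro w hw hwc hwq
    filter_upwards [hr, hcont w hwc hwq] with s hsJ hs'
    exact ⟨(hw s hsJ).2.2 q hs'.1, hs'.2⟩
  have huniq := ODE_solution_unique_of_eventually (v := fun t y => -S.shiftC q (y, t))
    (s := fun _ => s₁) (K := K) (t₀ := r) (by
      filter_upwards [hs₂] with t ht
      rw [lipschitzOnWith_iff_dist_le_mul]
      intro a ha b hb
      have h1 := (lipschitzOnWith_iff_dist_le_mul.1 hl) (a, t) (hss ⟨ha, ht⟩) (b, t) (hss ⟨hb, ht⟩)
      rw [dist_neg_neg]
      refine h1.trans (le_of_eq ?_)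
      rw [Prod.dist_eq, dist_self, max_eq_left dist_nonneg])
    (hev x hx hxc rfl) (hev y hy hyc h.symm) (by simp only [← h, hq])
  filter_upwards [huniq, hcont x hxc rfl, hcont y hyc h.symm] with s h1 h2 h3
  rw [← (extChartAt (𝓡 n) q).left_inv h2.1, ← (extChartAt (𝓡 n) q).left_inv h3.1]
  exact congrArg _ h1

/-- Uniqueness of normal curves. -/
theorem IsNormalOn.eqOn [T2Space M] {S : SplitMetric n M t₀} {x y : ℝ → M} {a b r : ℝ}
    (hx : S.IsNormalOn x (Ioo a b)) (hy : S.IsNormalOn y (Ioo a b)) (hr : r ∈ Ioo a b)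
    (h : x r = y r) : EqOn x y (Ioo a b) := by
  set s : Set ℝ := {t | x t = y t} ∩ Ioo a b with hs
  have hsub : Ioo a b ⊆ s := by
    refine isPreconnected_Ioo.subset_of_closure_inter_subset ?_ ⟨r, hr, h, hr⟩ ?_
    · rw [isOpen_iff_mem_nhds]
      rintro t ⟨ht, htI⟩
      have h1 := hx.eventuallyEq hy (isOpen_Ioo.mem_nhds htI) ht
      filter_upwards [h1, isOpen_Ioo.mem_nhds htI] with u hu hu' using ⟨hu, hu'⟩
    · rintro t ⟨htc, htI⟩
      refine ⟨?_, htI⟩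
      have h1 : ∃ᶠ u in 𝓝 t, x u = y u := mem_closure_iff_frequently.1 htc |>.mono fun u hu => hu.1
      by_contra hne
      have h2 : ∀ᶠ u in 𝓝 t, x u ≠ y u :=
        by
        obtain ⟨u, v, hu, hv, h3⟩ := t2_separation_nhds hne
        filter_upwards [(hx t htI).2.1.eventually_mem hu, (hy t htI).2.1.eventually_mem hv]
          with s h4 h5 using h3.ne_of_mem h4 h5
      exact (h1.and_eventually h2).exists.elim fun u hu => hu.2 hu.1
  exact fun t ht => (hsub ht).1

/-- Two normal curves which agree at one point can be glued. -/
theorem IsNormalOn.glue [T2Space M] {S : SplitMetric n M t₀} {x y : ℝ → M} {a b c d r : ℝ}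
    (hx : S.IsNormalOn x (Ioo a b)) (hy : S.IsNormalOn y (Ioo c d)) (hr : r ∈ Ioo a b)
    (hr' : r ∈ Ioo c d) (h : x r = y r) :
    ∃ w, S.IsNormalOn w (Ioo (min a c) (max b d)) ∧ EqOn w x (Ioo a b) ∧ EqOn w y (Ioo c d) := by
  classical
  have heq : EqOn x y (Ioo (max a c) (min b d)) :=
    (hx.mono (Ioo_subset_Ioo (le_max_left _ _) (min_le_left _ _))).eqOn
      (hy.mono (Ioo_subset_Ioo (le_max_right _ _) (min_le_right _ _)))
      ⟨max_lt hr.1 hr'.1, lt_min hr.2 hr'.2⟩ h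
  set w : ℝ → M := fun s => if s ∈ Ioo a b then x s else y s with hw
  have hwx : EqOn w x (Ioo a b) := fun s hs => if_pos hs
  have hwy : EqOn w y (Ioo c d) := by
    intro s hs
    by_cases hs' : s ∈ Ioo a b
    · rw [hwx hs']
      exact heq ⟨max_lt hs'.1 hs.1, lt_min hs'.2 hs.2⟩
    · exact if_neg hs'
  refine ⟨w, isNormalOn_of_forall fun s hs => ?_, hwx, hwy⟩
  have hcov : s ∈ Ioo a b ∨ s ∈ Ioo c d := by
    rcases hs with ⟨h1, h2⟩
    rcases min_lt_iff.1 h1 with h1 | h1 <;> rcases lt_max_iff.1 h2 with h2 | h2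
    · exact Or.inl ⟨h1, h2⟩
    · rcases lt_or_ge s b with h3 | h3
      · exact Or.inl ⟨h1, h3⟩
      · exact Or.inr ⟨hr'.1.trans (hr.2.trans_le h3), h2⟩
    · rcases lt_or_ge s d with h3 | h3
      · exact Or.inr ⟨h1, h3⟩
      · exact Or.inl ⟨hr.1.trans (hr'.2.trans_le h3), h2⟩
    · exact Or.inr ⟨h1, h2⟩
  rcases hcov with h1 | h1
  · exact hx.congr_eventually h1 (hwx.eventuallyEq_of_mem (isOpen_Ioo.mem_nhds h1))
  · exact hy.congr_eventually h1 (hwy.eventuallyEq_of_mem (isOpen_Ioo.mem_nhds h1))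

/-! ### The normal flow -/

/-- The normal curve through `z` at time `t` is defined up to time `T`, which may be smaller
than `t`. -/
def Survives (S : SplitMetric n M t₀) (t T : ℝ) (z : M) : Prop :=
  ∃ a b, t ∈ Ioo a b ∧ T ∈ Ioo a b ∧ ∃ y, S.IsNormalOn y (Ioo a b) ∧ y t = z

open Classical in
/-- The position at time `T` of the normal curve through `z` at time `t`; the junk value `z` if this
curve is not defined up to time `T`. -/
def flow (S : SplitMetric n M t₀) (t T : ℝ) (z : M) : M :=
  if h : S.Survives t T z then h.choose_spec.choose_spec.2.2.choose T else z

theorem IsNormalOn.survives {S : SplitMetric n M t₀} {y : ℝ → M} {a b t T : ℝ}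
    (hy : S.IsNormalOn y (Ioo a b)) (ht : t ∈ Ioo a b) (hT : T ∈ Ioo a b) :
    S.Survives t T (y t) := ⟨a, b, ht, hT, y, hy, rfl⟩

theorem IsNormalOn.flow_eq [T2Space M] {S : SplitMetric n M t₀} {y : ℝ → M} {a b t T : ℝ}
    (hy : S.IsNormalOn y (Ioo a b)) (ht : t ∈ Ioo a b) (hT : T ∈ Ioo a b) :
    S.flow t T (y t) = y T := by
  have h := hy.survives ht hT
  rw [flow, dif_pos h]
  have ht' := h.choose_spec.choose_spec.1
  have hT' := h.choose_spec.choose_spec.2.1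
  obtain ⟨hn, he⟩ := h.choose_spec.choose_spec.2.2.choose_spec
  generalize h.choose_spec.choose_spec.2.2.choose = w at *
  generalize h.choose_spec.choose = d at *
  generalize h.choose = c at *
  obtain ⟨v, -, h1, h2⟩ := hn.glue hy ht' ht he
  rw [← h1 hT', h2 hT]

theorem Survives.trans [T2Space M] {S : SplitMetric n M t₀} {t T T' : ℝ} {z : M}
    (h : S.Survives t T z) (h' : S.Survives T T' (S.flow t T z)) :
    S.Survives t T' z ∧ S.flow t T' z = S.flow T T' (S.flow t T z) := by
  obtain ⟨a, b, ht, hT, y, hy, rfl⟩ := h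
  rw [hy.flow_eq ht hT] at h' ⊢
  obtain ⟨c, d, hT1, hT', w, hw, he⟩ := h'
  obtain ⟨v, hv, h1, h2⟩ := hy.glue hw hT hT1 he.symm
  have i1 : Ioo a b ⊆ Ioo (min a c) (max b d) := Ioo_subset_Ioo (min_le_left _ _) (le_max_left _ _)
  have i2 : Ioo c d ⊆ Ioo (min a c) (max b d) :=
    Ioo_subset_Ioo (min_le_right _ _) (le_max_right _ _)
  rw [← h1 ht, ← h1 hT, hv.flow_eq (i1 ht) (i2 hT'), hv.flow_eq (i1 hT) (i2 hT')]
  exact ⟨hv.survives (i1 ht) (i2 hT'), rfl⟩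

theorem Survives.symm [T2Space M] {S : SplitMetric n M t₀} {t T : ℝ} {z : M}
    (h : S.Survives t T z) :
    S.Survives T t (S.flow t T z) ∧ S.flow T t (S.flow t T z) = z := by
  obtain ⟨a, b, ht, hT, y, hy, rfl⟩ := h
  rw [hy.flow_eq ht hT]
  exact ⟨hy.survives hT ht, hy.flow_eq hT ht⟩

/-- Flow boxes: near `(q, T₁)` the normal flow exists for a uniform time and stays in a given
neighbourhood of `q`. -/
theorem exists_flow_box (S : SplitMetric n M t₀) {q : M} {T₁ : ℝ} (hT₁ : t₀ < T₁) {W' : Set M}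
    (hW' : W' ∈ 𝓝 q) : ∃ W ∈ 𝓝 q, ∃ ε > 0, ∀ z ∈ W, ∀ t ∈ Ioo (T₁ - ε) (T₁ + ε), ∃ y : ℝ → M,
      S.IsNormalOn y (Ioo (T₁ - ε) (T₁ + ε)) ∧ y t = z ∧
      ∀ r ∈ Ioo (T₁ - ε) (T₁ + ε), y r ∈ W' := by
  set φ := extChartAt (𝓡 n) q with hφ
  have hqs : q ∈ φ.source := mem_extChartAt_source q
  set z₀ : 𝓔 × ℝ := (φ q, T₁) with hz₀
  have hz : z₀ ∈ S.chartDom q := ⟨φ.map_source hqs, hT₁⟩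
  set F : 𝓔 × ℝ → 𝓔 × ℝ := fun z => (-S.shiftC q z, 1) with hF
  have hFc : ContDiffAt ℝ 1 F z₀ :=
    (((S.contDiffAt_shiftC hz).of_le (by norm_cast)).neg).prodMk contDiffAt_const
  obtain ⟨ε₀, hε₀, a, ρ, L, K, hρ, hPL⟩ := IsPicardLindelof.of_contDiffAt_one hFc
  obtain ⟨α, hα, hαc⟩ :=
    (hPL 0).exists_forall_mem_closedBall_eq_hasDerivWithinAt_continuousOn
  -- the flow stays in the part of the chart which lies over `W'`
  have hgood : {z : 𝓔 × ℝ | z ∈ S.chartDom q ∧ φ.symm z.1 ∈ W'} ∈ 𝓝 z₀ := by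
    refine inter_mem ((S.isOpen_chartDom q).mem_nhds hz) ?_
    have h1 : ContinuousAt (fun z : 𝓔 × ℝ => φ.symm z.1) z₀ :=
      ContinuousAt.comp (f := Prod.fst) (g := φ.symm)
        (continuousAt_extChartAt_symm q) continuousAt_fst
    refine h1.preimage_mem_nhds ?_
    simpa only [hz₀, φ.left_inv hqs]
  have hα0 : α (z₀, 0) = z₀ := (hα z₀ (Metric.mem_closedBall_self ρ.2)).1
  have hdom : Metric.closedBall z₀ (ρ : ℝ) ×ˢ Icc (0 - ε₀) (0 + ε₀) ∈ 𝓝 ((z₀, 0) : (𝓔 × ℝ) × ℝ) :=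
    prod_mem_nhds (Metric.closedBall_mem_nhds _ hρ) (Icc_mem_nhds (by linarith) (by linarith))
  have hαca : ContinuousAt α (z₀, 0) := hαc.continuousAt hdom
  have hgood' := hαca.preimage_mem_nhds (by rwa [hα0])
  obtain ⟨U, hU, R, hR, hUR⟩ := mem_nhds_prod_iff.1 (inter_mem hdom hgood')
  obtain ⟨U₁, hU₁, U₂, hU₂, hUU⟩ := mem_nhds_prod_iff.1 hU
  obtain ⟨ε₁, hε₁, hR₁⟩ := Metric.mem_nhds_iff.1 hR
  obtain ⟨ε₂, hε₂, hR₂⟩ := Metric.mem_nhds_iff.1 hU₂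
  set ε := min (ε₁ / 2) ε₂ with hε
  have hεp : 0 < ε := lt_min (half_pos hε₁) hε₂
  refine ⟨φ.source ∩ φ ⁻¹' U₁, inter_mem ((isOpen_extChartAt_source q).mem_nhds hqs)
    ((continuousAt_extChartAt q).preimage_mem_nhds hU₁), ε, hεp, ?_⟩
  rintro z ⟨hzs, hzU⟩ t ht
  have htU : t ∈ U₂ := hR₂ (by
    rw [Real.ball_eq_Ioo]
    exact ⟨by linarith [ht.1, min_le_right (ε₁ / 2) ε₂], by linarith [ht.2, min_le_right (ε₁ / 2) ε₂]⟩)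
  have hrR : ∀ r ∈ Ioo (T₁ - ε) (T₁ + ε), r - t ∈ R := by
    intro r hr
    refine hR₁ ?_
    rw [Real.ball_eq_Ioo]
    have := min_le_left (ε₁ / 2) ε₂
    exact ⟨by linarith [ht.2, hr.1], by linarith [ht.1, hr.2]⟩
  set p : 𝓔 × ℝ := (φ z, t) with hp
  have hpU : p ∈ U := hUU ⟨hzU, htU⟩
  have hRI : ∀ s ∈ R, p ∈ Metric.closedBall z₀ (ρ : ℝ) ∧ s ∈ Icc (0 - ε₀) (0 + ε₀) ∧
      α (p, s) ∈ S.chartDom q ∧ φ.symm (α (p, s)).1 ∈ W' := fun s hs => by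
    have h := hUR (mk_mem_prod hpU hs)
    exact ⟨h.1.1, h.1.2, h.2⟩
  have htI : t ∈ Ioo (T₁ - ε) (T₁ + ε) := ht
  have h00 := hRI _ (hrR t ht)
  set ξ : ℝ → 𝓔 × ℝ := fun r => α (p, r - t) with hξ
  have hξd : ∀ r ∈ Ioo (T₁ - ε) (T₁ + ε), HasDerivAt ξ (F (ξ r)) r := by
    intro r hr
    have hnhd : Icc (0 - ε₀) (0 + ε₀) ∈ 𝓝 (r - t) := by
      have hopen : (fun s => s - t) '' Ioo (T₁ - ε) (T₁ + ε) ∈ 𝓝 (r - t) := by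
        rw [image_sub_const_Ioo]
        exact Ioo_mem_nhds (by linarith [hr.1]) (by linarith [hr.2])
      refine mem_of_superset hopen ?_
      rintro _ ⟨s, hs, rfl⟩
      exact (hRI _ (hrR s hs)).2.1
    have h1 := ((hα p h00.1).2 (r - t) (hRI _ (hrR r hr)).2.1).hasDerivAt hnhd
    exact h1.comp_sub_const r t
  have hξt : ξ t = p := by
    simp only [hξ, sub_self]
    exact (hα p h00.1).1
  have hξ2 : ∀ r ∈ Ioo (T₁ - ε) (T₁ + ε), (ξ r).2 = r := by
    intro r hr
    have hd : ∀ s ∈ Ioo (T₁ - ε) (T₁ + ε), HasDerivAt (fun s => (ξ s).2 - s) 0 s := by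
      intro s hs
      have h1 : HasDerivAt (fun s => (ξ s).2) 1 s := (hξd s hs).snd
      simpa using! h1.fun_sub (hasDerivAt_id s)
    have hc := isOpen_Ioo.is_const_of_deriv_eq_zero isPreconnected_Ioo
      (fun s hs => (hd s hs).differentiableAt.differentiableWithinAt)
      (fun s hs => (hd s hs).deriv) hr ht
    have : (ξ t).2 = t := by rw [hξt]
    simp only [this] at hc
    linarith
  refine ⟨fun r => φ.symm (ξ r).1, isNormalOn_of_forall fun r hr => ?_, ?_, fun r hr =>
    (hRI _ (hrR r hr)).2.2.2⟩
  · have hm := (hRI _ (hrR r hr)).2.2.1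
    have hinv : φ (φ.symm (ξ r).1) = (ξ r).1 := φ.right_inv hm.1
    have hd1 : HasDerivAt (fun s => (ξ s).1) (-S.shiftC q (ξ r)) r := (hξd r hr).fst
    refine S.isNormalOn_singleton_of_hasDerivAt (x₀ := q) ?_ ?_ (φ.map_target hm.1) ?_
    · have h := hm.2
      have h2 := hξ2 r hr
      simp only [hξ] at h2
      rw [h2] at h
      exact h
    · exact ContinuousAt.comp (g := φ.symm) (continuousAt_extChartAt_symm'' hm.1) hd1.continuousAt
    · rw [← hφ, hinv]
      have h2 : ((ξ r).1, r) = ξ r := Prod.ext rfl (hξ2 r hr).symm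
      rw [h2]
      refine hd1.congr_of_eventuallyEq ?_
      filter_upwards [isOpen_Ioo.mem_nhds hr] with s hs
      exact φ.right_inv (hRI _ (hrR s hs)).2.2.1.1
  · simp only [hξt]
    exact φ.left_inv hzs

theorem exists_flow_box' [T2Space M] (S : SplitMetric n M t₀) {q : M} {T₁ : ℝ} (hT₁ : t₀ < T₁)
    {W' : Set M} (hW' : W' ∈ 𝓝 q) : ∃ W ∈ 𝓝 q, ∃ ε > 0, ∀ z ∈ W, ∀ t ∈ Ioo (T₁ - ε) (T₁ + ε),
      ∀ T ∈ Ioo (T₁ - ε) (T₁ + ε), S.Survives t T z ∧ S.flow t T z ∈ W' := by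
  obtain ⟨W, hW, ε, hε, h⟩ := S.exists_flow_box hT₁ hW'
  refine ⟨W, hW, ε, hε, fun z hz t ht T hT => ?_⟩
  obtain ⟨y, hy, rfl, hyW⟩ := h z hz t ht
  exact ⟨hy.survives ht hT, hy.flow_eq ht hT ▸ hyW T hT⟩

end SplitMetric

/-! ### Auxiliary estimates -/

/-- A differential inequality `Q' ≤ k Q` for a nonnegative function, which may vanish. -/
theorem le_mul_exp_integral {Q Q' k : ℝ → ℝ} {a b : ℝ} (hab : a ≤ b)
    (hc : ContinuousOn Q (Icc a b)) (hd : ∀ r ∈ Ioo a b, HasDerivAt Q (Q' r) r)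
    (h0 : ∀ r ∈ Icc a b, 0 ≤ Q r) (hk : ∀ r ∈ Ioo a b, 0 ≤ k r)
    (hle : ∀ r ∈ Ioo a b, Q' r ≤ k r * Q r) (hki : IntegrableOn k (Icc a b)) :
    Q b ≤ Q a * Real.exp (∫ r in a..b, k r) := by
  -- the logarithm of `Q + σ` is estimated first
  have key : ∀ σ > 0, Q b + σ ≤ (Q a + σ) * Real.exp (∫ r in a..b, k r) := by
    intro σ hσ
    have hpos : ∀ r ∈ Icc a b, 0 < Q r + σ := fun r hr => add_pos_of_nonneg_of_pos (h0 r hr) hσ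
    have h1 : Real.log (Q b + σ) - Real.log (Q a + σ) ≤ ∫ r in a..b, k r := by
      refine intervalIntegral.sub_le_integral_of_hasDeriv_right_of_le
        (g := fun r => Real.log (Q r + σ)) (g' := fun r => Q' r / (Q r + σ)) hab
        ((hc.add continuousOn_const).log fun r hr => (hpos r hr).ne') (fun r hr => ?_) hki
        fun r hr => ?_
      · exact (((hd r hr).add_const σ).log
          (hpos r (Ioo_subset_Icc_self hr)).ne').hasDerivWithinAt
      · rw [div_le_iff₀ (hpos r (Ioo_subset_Icc_self hr))]
        nlinarith [hle r hr, mul_nonneg (hk r hr) hσ.le]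
    have hb := hpos b (right_mem_Icc.2 hab)
    have ha := hpos a (left_mem_Icc.2 hab)
    calc Q b + σ = Real.exp (Real.log (Q b + σ)) := (Real.exp_log hb).symm
      _ ≤ Real.exp (Real.log (Q a + σ) + ∫ r in a..b, k r) := Real.exp_le_exp.2 (by linarith)
      _ = (Q a + σ) * Real.exp (∫ r in a..b, k r) := by rw [Real.exp_add, Real.exp_log ha]
  have t1 : Tendsto (fun σ : ℝ => Q b + σ) (𝓝[>] 0) (𝓝 (Q b + 0)) :=
    (tendsto_const_nhds.add tendsto_id).mono_left nhdsWithin_le_nhds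
  have t2 : Tendsto (fun σ : ℝ => (Q a + σ) * Real.exp (∫ r in a..b, k r)) (𝓝[>] 0)
      (𝓝 ((Q a + 0) * Real.exp (∫ r in a..b, k r))) :=
    ((tendsto_const_nhds.add tendsto_id).mul_const _).mono_left nhdsWithin_le_nhds
  have := le_of_tendsto_of_tendsto t1 t2 (eventually_mem_nhdsWithin.mono key)
  simpa using this

/-- A quadratic Taylor estimate, uniform near a point. -/
theorem ContDiffAt.exists_norm_sub_sub_le {F G : Type*} [NormedAddCommGroup F] [NormedSpace ℝ F]
    [NormedAddCommGroup G] [NormedSpace ℝ G] {f : F → G} {z₀ : F} (hf : ContDiffAt ℝ 2 f z₀) :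
    ∃ K, 0 ≤ K ∧ ∃ ρ > 0, ∀ z ∈ Metric.ball z₀ ρ, ∀ w ∈ Metric.ball z₀ ρ,
      ‖f w - f z - fderiv ℝ f z (w - z)‖ ≤ K * ‖w - z‖ ^ 2 := by
  obtain ⟨K, s, hs, hl⟩ :=
    (hf.fderiv_right (m := 1) (by norm_num)).exists_lipschitzOnWith
  have hd : ∀ᶠ z in 𝓝 z₀, DifferentiableAt ℝ f z :=
    (hf.eventually (by simp)).mono fun z hz => hz.differentiableAt (by norm_num)
  obtain ⟨ρ, hρ, hb⟩ := Metric.mem_nhds_iff.1 (inter_mem hs hd)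
  refine ⟨K, K.2, ρ, hρ, fun z hz w hw => ?_⟩
  have hsub : segment ℝ z w ⊆ Metric.ball z₀ ρ := (convex_ball z₀ ρ).segment_subset hz hw
  have h := (convex_segment z w).norm_image_sub_le_of_norm_hasFDerivWithin_le'
    (f := f) (f' := fderiv ℝ f) (φ := fderiv ℝ f z) (C := K * ‖w - z‖)
    (fun x hx => (hb (hsub hx)).2.hasFDerivAt.hasFDerivWithinAt) (fun x hx => ?_)
    (left_mem_segment ℝ z w) (right_mem_segment ℝ z w)
  · rwa [pow_two, ← mul_assoc]
  · refine (hl.norm_sub_le (hb (hsub hx)).1 (hb hz).1).trans ?_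
    gcongr
    exact norm_sub_le_of_mem_segment hx

set_option synthInstance.maxHeartbeats 200000 in
/-- A continuous family of bilinear forms which is positive definite at a point is bounded below
near that point. -/
theorem exists_eventually_le_bilin {X F : Type*} [TopologicalSpace X] [NormedAddCommGroup F]
    [NormedSpace ℝ F] [FiniteDimensional ℝ F] {B : X → F →L[ℝ] F →L[ℝ] ℝ} {x₀ : X}
    (hB : ContinuousAt B x₀) (hpos : ∀ v, v ≠ 0 → 0 < B x₀ v v) :
    ∃ m > 0, ∀ᶠ x in 𝓝 x₀, ∀ v, m * ‖v‖ ^ 2 ≤ B x v v := by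
  obtain ⟨R, hR⟩ := isBounded_iff_forall_norm_le.1
    (NormedSpace.isVonNBounded_iff ℝ |>.1 (isVonNBounded_of_posDef (B x₀) hpos))
  set R' := max R 1 with hR'
  have hR'p : 0 < R' := lt_max_of_lt_right one_pos
  have h0 : ∀ v, 1 / (2 * R' ^ 2) * ‖v‖ ^ 2 ≤ B x₀ v v := by
    intro v
    rcases eq_or_ne v 0 with rfl | hv
    · simp
    set b := B x₀ v v with hb
    have hbp : 0 < b := hpos v hv
    set c := Real.sqrt (2 * b) with hc
    have hcp : 0 < c := Real.sqrt_pos.2 (by positivity)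
    have hc2 : c ^ 2 = 2 * b := Real.sq_sqrt (by positivity)
    have h1 : c⁻¹ • v ∈ {v : F | B x₀ v v < 1} := by
      have : B x₀ (c⁻¹ • v) (c⁻¹ • v) = 1 / 2 := by
        simp only [map_smul, _root_.smul_apply, smul_eq_mul, ← hb]
        field_simp
        linarith
      rw [mem_ofPred_eq, this]
      norm_num
    have h2 := (hR _ h1).trans (le_max_left R 1)
    rw [norm_smul, norm_inv, Real.norm_of_nonneg hcp.le, inv_mul_le_iff₀ hcp] at h2
    have h3 : ‖v‖ ^ 2 ≤ (c * R') ^ 2 := by gcongr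
    rw [mul_pow, hc2] at h3
    rw [one_div, inv_mul_le_iff₀ (by positivity)]
    linarith
  set m := 1 / (4 * R' ^ 2) with hm
  have hmp : 0 < m := by positivity
  refine ⟨m, hmp, ?_⟩
  have hbm : Metric.ball (B x₀) m ∈ 𝓝 (B x₀) := Metric.ball_mem_nhds (B x₀) hmp
  filter_upwards [hB.eventually_mem hbm] with x hx v
  have hx' : ‖B x - B x₀‖ < m := lt_of_eq_of_lt (dist_eq_norm (B x) (B x₀)).symm hx
  have h1 : |(B x - B x₀) v v| ≤ m * ‖v‖ ^ 2 := by
    rw [← Real.norm_eq_abs]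
    refine ((B x - B x₀).le_opNorm₂ v v).trans ?_
    rw [mul_assoc, ← pow_two]
    gcongr
  have h2 : (B x - B x₀) v v = B x v v - B x₀ v v := by simp
  rw [h2] at h1
  have h3 := h0 v
  have h4 : 1 / (2 * R' ^ 2) = m + m := by rw [hm]; field_simp; norm_num
  rw [h4] at h3
  linarith [(abs_le.1 h1).1]

namespace SplitMetric

variable {n : ℕ} {M : Type*} [TopologicalSpace M]
  [ChartedSpace (EuclideanSpace ℝ (Fin n)) M] [IsManifold (𝓡 n) ∞ M] {t₀ : ℝ}

local notation "𝓔" => EuclideanSpace ℝ (Fin n)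

/-! ### The separation of normal curves -/

/-- The square of the length of the chord from `x` to `y` in the chart around `x₀`, measured by the
slice metric at `x`. -/
def chordSq (S : SplitMetric n M t₀) (x₀ : M) (T : ℝ) (x y : M) : ℝ :=
  S.metricC x₀ (extChartAt (𝓡 n) x₀ x, T) (extChartAt (𝓡 n) x₀ y - extChartAt (𝓡 n) x₀ x)
    (extChartAt (𝓡 n) x₀ y - extChartAt (𝓡 n) x₀ x)

/-- The derivative of the square of the chord between two normal curves: to leading order it is
`-2 N K` applied to the chord. -/
theorem hasDerivAt_chordSq (S : SplitMetric n M t₀) {q : M} {x y : ℝ → M} {r : ℝ}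
    (hx : S.IsNormalOn x {r}) (hy : S.IsNormalOn y {r}) (hxq : x r ∈ (extChartAt (𝓡 n) q).source)
    (hyq : y r ∈ (extChartAt (𝓡 n) q).source) :
    HasDerivAt (fun s => S.chordSq q s (x s) (y s))
      (-2 * S.secondForm q (extChartAt (𝓡 n) q (x r), r)
          (extChartAt (𝓡 n) q (y r) - extChartAt (𝓡 n) q (x r))
          (extChartAt (𝓡 n) q (y r) - extChartAt (𝓡 n) q (x r))
        - 2 * S.metricC q (extChartAt (𝓡 n) q (x r), r)
          (extChartAt (𝓡 n) q (y r) - extChartAt (𝓡 n) q (x r))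
          (S.shiftC q (extChartAt (𝓡 n) q (y r), r) - S.shiftC q (extChartAt (𝓡 n) q (x r), r)
            - fderiv ℝ (S.shiftC q) (extChartAt (𝓡 n) q (x r), r)
              (extChartAt (𝓡 n) q (y r) - extChartAt (𝓡 n) q (x r), 0))) r := by
  obtain ⟨hr, -, hx'⟩ := hx r rfl
  obtain ⟨-, -, hy'⟩ := hy r rfl
  have hxd := hx' q hxq
  have hyd := hy' q hyq
  set ξ : ℝ → 𝓔 := fun s => extChartAt (𝓡 n) q (x s) with hξ
  set η : ℝ → 𝓔 := fun s => extChartAt (𝓡 n) q (y s) with hη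
  set ζ : ℝ → 𝓔 × ℝ := fun s => (ξ s, s) with hζ
  have hz : ζ r ∈ S.chartDom q := ⟨(extChartAt (𝓡 n) q).map_source hxq, hr⟩
  have h1 : HasDerivAt ζ (S.normalC q (ζ r)) r := hxd.prodMk (hasDerivAt_id r)
  have h2 : HasDerivAt (fun s => S.metricC q (ζ s))
      (fderiv ℝ (S.metricC q) (ζ r) (S.normalC q (ζ r))) r :=
    HasFDerivAt.comp_hasDerivAt (l := S.metricC q) (f := ζ) r
      (((S.contDiffAt_metricC hz).differentiableAt (by simp)).hasFDerivAt) h1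
  have h3 : HasDerivAt (fun s => η s - ξ s)
      (-S.shiftC q (η r, r) - -S.shiftC q (ξ r, r)) r := hyd.fun_sub hxd
  have h4 := (h2.clm_apply h3).clm_apply h3
  refine h4.congr_deriv ?_
  rw [S.secondForm_eq hz]
  have hs := S.metricC_symm (x₀ := q) (z := ζ r) hz.2
  simp only [add_apply]
  change fderiv ℝ (S.metricC q) (ζ r) (S.normalC q (ζ r)) (η r - ξ r) (η r - ξ r)
      + S.metricC q (ζ r) (-S.shiftC q (η r, r) - -S.shiftC q (ζ r)) (η r - ξ r)
      + S.metricC q (ζ r) (η r - ξ r) (-S.shiftC q (η r, r) - -S.shiftC q (ζ r))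
    = -2 * (S.metricC q (ζ r) (η r - ξ r) (fderiv ℝ (S.shiftC q) (ζ r) (η r - ξ r, 0))
        - fderiv ℝ (S.metricC q) (ζ r) (S.normalC q (ζ r)) (η r - ξ r) (η r - ξ r) / 2)
      - 2 * S.metricC q (ζ r) (η r - ξ r) (S.shiftC q (η r, r) - S.shiftC q (ζ r)
        - fderiv ℝ (S.shiftC q) (ζ r) (η r - ξ r, 0))
  rw [hs (-S.shiftC q (η r, r) - -S.shiftC q (ζ r)) (η r - ξ r)]
  generalize η r - ξ r = v
  simp only [map_sub, map_neg]
  ring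

set_option synthInstance.maxHeartbeats 200000 in
/-- The chord between two normal curves grows at most by the factor `exp (∫ k)`, where `k` bounds
`N |K|`, up to an error which is small for short chords. -/
theorem exists_chordSq_le (S : SplitMetric n M t₀) (q : M) {T₁ : ℝ} (hT₁ : t₀ < T₁) :
    ∃ V ∈ 𝓝 q, V ⊆ (extChartAt (𝓡 n) q).source ∧ ∃ ε > 0, ∃ C, 0 ≤ C ∧
      ∀ (x y : ℝ → M) (k : ℝ → ℝ) (T T' : ℝ), T ∈ Ioo (T₁ - ε) (T₁ + ε) →
      T' ∈ Ioo (T₁ - ε) (T₁ + ε) → T ≤ T' →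
      S.IsNormalOn x (Icc T T') → S.IsNormalOn y (Icc T T') →
      (∀ r ∈ Icc T T', x r ∈ V ∧ y r ∈ V) → IntegrableOn k (Icc T T') →
      (∀ r ∈ Icc T T', ∀ p, 0 < S.lapse r p ∧ S.lapse r p * S.normExtrinsicCurvature r p ≤ k r) →
      S.chordSq q T' (x T') (y T') ≤ S.chordSq q T (x T) (y T)
        * Real.exp (2 * (∫ r in T..T', k r) + C * Real.sqrt (S.chordSq q T (x T) (y T))) := by
  set φ := extChartAt (𝓡 n) q with hφ
  have hqs : q ∈ φ.source := mem_extChartAt_source q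
  set z₀ : 𝓔 × ℝ := (φ q, T₁) with hz₀
  have hz : z₀ ∈ S.chartDom q := ⟨φ.map_source hqs, hT₁⟩
  have hβ := S.contDiffAt_shiftC hz
  have hg := (S.contDiffAt_metricC hz).continuousAt
  obtain ⟨K, hK, ρ₁, hρ₁, hTay⟩ := (hβ.of_le (m := 2) (by norm_cast)).exists_norm_sub_sub_le
  obtain ⟨K₂, s, hs, hl⟩ := (hβ.of_le (m := 1) (by norm_cast)).exists_lipschitzOnWith
  obtain ⟨m, hm, hlow⟩ := exists_eventually_le_bilin hg fun v hv => S.metricC_pos hz hv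
  have hup : ∀ᶠ z in 𝓝 z₀, ‖S.metricC q z‖ < ‖S.metricC q z₀‖ + 1 :=
    Tendsto.eventually_lt_const (lt_add_one _)
      ((continuous_norm (E := 𝓔 →L[ℝ] 𝓔 →L[ℝ] ℝ)).continuousAt.comp hg).tendsto
  set G := ‖S.metricC q z₀‖ + 1 with hG
  have hG0 : 0 ≤ G := by positivity
  obtain ⟨ρ₂, hρ₂, hball⟩ := Metric.mem_nhds_iff.1 (inter_mem hs (inter_mem hlow hup))
  set ρ := min ρ₁ ρ₂ with hρ
  have hρp : 0 < ρ := lt_min hρ₁ hρ₂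
  have hmem : ∀ p ∈ φ ⁻¹' Metric.ball (φ q) ρ, ∀ r ∈ Ioo (T₁ - ρ) (T₁ + ρ),
      ((φ p, r) : 𝓔 × ℝ) ∈ Metric.ball z₀ ρ := by
    intro p hp r hr
    rw [← Real.ball_eq_Ioo] at hr
    rw [hz₀, ← ball_prod_same]
    exact ⟨hp, hr⟩
  set C₁ := 2 * G * K / m with hC₁
  have hC₁0 : 0 ≤ C₁ := by positivity
  set C₂ := Real.exp (K₂ * (2 * ρ)) / Real.sqrt m with hC₂
  have hC₂0 : 0 ≤ C₂ := by positivity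
  refine ⟨φ.source ∩ φ ⁻¹' Metric.ball (φ q) ρ,
    inter_mem ((isOpen_extChartAt_source q).mem_nhds hqs)
      ((continuousAt_extChartAt q).preimage_mem_nhds (Metric.ball_mem_nhds _ hρp)),
    inter_subset_left, ρ, hρp, C₁ * C₂ * (2 * ρ), by positivity, ?_⟩
  intro x y k T T' hT hT' hTT hx hy hxy hk hN
  have hIcc : Icc T T' ⊆ Ioo (T₁ - ρ) (T₁ + ρ) := fun r hr =>
    ⟨hT.1.trans_le hr.1, hr.2.trans_lt hT'.2⟩
  have hzx : ∀ r ∈ Icc T T', ((φ (x r), r) : 𝓔 × ℝ) ∈ Metric.ball z₀ ρ := fun r hr =>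
    hmem _ (hxy r hr).1.2 r (hIcc hr)
  have hzy : ∀ r ∈ Icc T T', ((φ (y r), r) : 𝓔 × ℝ) ∈ Metric.ball z₀ ρ := fun r hr =>
    hmem _ (hxy r hr).2.2 r (hIcc hr)
  have hxd := fun r (hr : r ∈ Icc T T') => (hx r hr).2.2 q (hxy r hr).1.1
  have hyd := fun r (hr : r ∈ Icc T T') => (hy r hr).2.2 q (hxy r hr).2.1
  set δ : ℝ → 𝓔 := fun r => φ (y r) - φ (x r) with hδ
  set Q : ℝ → ℝ := fun r => S.chordSq q r (x r) (y r) with hQ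
  have hlowQ : ∀ r ∈ Icc T T', m * ‖δ r‖ ^ 2 ≤ Q r := fun r hr =>
    (hball (Metric.ball_subset_ball (min_le_right _ _) (hzx r hr))).2.1 (δ r)
  have hTI : T ∈ Icc T T' := left_mem_Icc.2 hTT
  -- a first estimate of the chord by the Lipschitz constant of the shift
  have hgron : ∀ r ∈ Icc T T', ‖δ r‖ ≤ C₂ * Real.sqrt (Q T) := by
    intro r hr
    have h1 := dist_le_of_trajectories_ODE_of_mem (v := fun t w => -S.shiftC q (w, t))
      (s := fun _ => Metric.ball (φ q) ρ) (K := K₂) (f := fun r => φ (x r))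
      (g := fun r => φ (y r)) (a := T) (b := T') (δ := ‖δ T‖) (fun t ht => ?_)
      (fun r hr => (hxd r hr).continuousAt.continuousWithinAt)
      (fun r hr => (hxd r (Ico_subset_Icc_self hr)).hasDerivWithinAt)
      (fun r hr => (hxy r (Ico_subset_Icc_self hr)).1.2)
      (fun r hr => (hyd r hr).continuousAt.continuousWithinAt)
      (fun r hr => (hyd r (Ico_subset_Icc_self hr)).hasDerivWithinAt)
      (fun r hr => (hxy r (Ico_subset_Icc_self hr)).2.2)
      (by rw [dist_comm, dist_eq_norm]) r hr
    · rw [dist_comm, dist_eq_norm] at h1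
      have h2 : ‖δ T‖ ≤ Real.sqrt (Q T) / Real.sqrt m := by
        rw [le_div_iff₀ (Real.sqrt_pos.2 hm)]
        refine Real.le_sqrt_of_sq_le ?_
        rw [mul_pow, Real.sq_sqrt hm.le]
        linarith [hlowQ T hTI]
      have h3 : r - T ≤ 2 * ρ := by
        have := hIcc hr; linarith [this.2, hT.1]
      calc ‖δ r‖ ≤ ‖δ T‖ * Real.exp (K₂ * (r - T)) := h1
        _ ≤ Real.sqrt (Q T) / Real.sqrt m * Real.exp (K₂ * (2 * ρ)) := by gcongr
        _ = C₂ * Real.sqrt (Q T) := by rw [hC₂]; ring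
    · have htI := hIcc (Ico_subset_Icc_self ht)
      rw [lipschitzOnWith_iff_dist_le_mul]
      intro a ha b hb
      have hball' : ∀ a ∈ Metric.ball (φ q) ρ, ((a, t) : 𝓔 × ℝ) ∈ s := fun a ha =>
        (hball (Metric.ball_subset_ball (min_le_right _ _) (by
          rw [← Real.ball_eq_Ioo] at htI
          rw [hz₀, ← ball_prod_same]
          exact ⟨ha, htI⟩))).1
      have h1 := (lipschitzOnWith_iff_dist_le_mul.1 hl) (a, t) (hball' a ha) (b, t) (hball' b hb)
      rw [dist_neg_neg]
      refine h1.trans (le_of_eq ?_)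
      rw [Prod.dist_eq, dist_self, max_eq_left dist_nonneg]
  set d := C₂ * Real.sqrt (Q T) with hd
  have hd0 : 0 ≤ d := by positivity
  have hQd := fun r (hr : r ∈ Icc T T') => S.hasDerivAt_chordSq (q := q) (x := x) (y := y)
    (hx.mono (singleton_subset_iff.2 hr)) (hy.mono (singleton_subset_iff.2 hr))
    (hxy r hr).1.1 (hxy r hr).2.1
  have hkn : ∀ r ∈ Icc T T', 0 ≤ k r := fun r hr =>
    (mul_nonneg (hN r hr q).1.le (Real.sqrt_nonneg _)).trans (hN r hr q).2
  have hQ0 : ∀ r ∈ Icc T T', 0 ≤ Q r := fun r hr => (by positivity : 0 ≤ m * ‖δ r‖ ^ 2).trans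
    (hlowQ r hr)
  -- Grönwall's inequality for `Q' ≤ (2 k + C₁ d) Q`, where `2 k` comes from the second fundamental
  -- form and `C₁ d` from the second order remainder of the shift
  have hmain := le_mul_exp_integral (Q := Q) (k := fun r => 2 * k r + C₁ * d) hTT
    (fun r hr => (hQd r hr).continuousAt.continuousWithinAt)
    (fun r hr => hQd r (Ioo_subset_Icc_self hr)) hQ0
    (fun r hr => add_nonneg (mul_nonneg zero_le_two (hkn r (Ioo_subset_Icc_self hr)))
      (mul_nonneg hC₁0 hd0)) (fun r hr => ?_)
    ((hk.const_mul 2).add continuousOn_const.integrableOn_Icc)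
  · refine hmain.trans ?_
    have hki : IntervalIntegrable k volume T T' :=
      (intervalIntegrable_iff_integrableOn_Icc_of_le hTT).2 hk
    rw [intervalIntegral.integral_add (hki.const_mul 2) (by simp),
      intervalIntegral.integral_const_mul, intervalIntegral.integral_const, smul_eq_mul]
    have h3 : T' - T ≤ 2 * ρ := by linarith [hT'.2, hT.1]
    have := hQ0 T hTI
    have h4 : (T' - T) * (C₁ * d) ≤ C₁ * C₂ * (2 * ρ) * Real.sqrt (Q T) := by
      calc (T' - T) * (C₁ * d) ≤ (2 * ρ) * (C₁ * d) := by gcongr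
        _ = _ := by rw [hd]; ring
    gcongr
  · have hrI := Ioo_subset_Icc_self hr
    have hzr := hzx r hrI
    have hzm : ((φ (x r), r) : 𝓔 × ℝ) ∈ S.chartDom q :=
      ⟨φ.map_source (hxy r hrI).1.1, (hx r hrI).1⟩
    set z : 𝓔 × ℝ := (φ (x r), r) with hzdef
    have e1 := S.abs_secondForm_le hzm (hN r hrI _).1 (δ r)
    have e2 : S.lapseC q z * S.normExtrinsicCurvature z.2 (φ.symm z.1) ≤ k r := (hN r hrI _).2
    have e3 : S.metricC q z (δ r) (δ r) = Q r := rfl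
    have e4 := hTay z (Metric.ball_subset_ball (min_le_left _ _) hzr) (φ (y r), r)
      (Metric.ball_subset_ball (min_le_left _ _) (hzy r hrI))
    have e5 : ((φ (y r), r) : 𝓔 × ℝ) - z = (δ r, 0) := by
      rw [hzdef]; ext <;> simp [hδ]
    rw [e5] at e4
    have e6 : ‖((δ r, 0) : 𝓔 × ℝ)‖ = ‖δ r‖ := by simp [Prod.norm_def]
    rw [e6] at e4
    have e7 : ‖S.metricC q z‖ ≤ G :=
      le_of_lt (hball (Metric.ball_subset_ball (min_le_right _ _) hzr)).2.2
    have e8 : |S.metricC q z (δ r) (S.shiftC q (φ (y r), r) - S.shiftC q z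
        - fderiv ℝ (S.shiftC q) z (δ r, 0))| ≤ G * ‖δ r‖ * (K * ‖δ r‖ ^ 2) := by
      rw [← Real.norm_eq_abs]
      refine ((S.metricC q z).le_opNorm₂ _ _).trans ?_
      gcongr
    have e9 : G * ‖δ r‖ * (K * ‖δ r‖ ^ 2) * 2 ≤ C₁ * d * Q r := by
      have h1 := hgron r hrI
      have h2 := hlowQ r hrI
      calc G * ‖δ r‖ * (K * ‖δ r‖ ^ 2) * 2 = C₁ * ‖δ r‖ * (m * ‖δ r‖ ^ 2) := by
            rw [hC₁]; field_simp
        _ ≤ C₁ * d * Q r := by gcongr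
    rw [e3] at e1
    have e10 : |S.secondForm q z (δ r) (δ r)| ≤ k r * Q r :=
      e1.trans (mul_le_mul_of_nonneg_right e2 (hQ0 r hrI))
    change -2 * S.secondForm q z (δ r) (δ r) - 2 * S.metricC q z (δ r) (S.shiftC q (φ (y r), r)
      - S.shiftC q z - fderiv ℝ (S.shiftC q) z (δ r, 0)) ≤ (2 * k r + C₁ * d) * Q r
    linarith [(abs_le.1 e10).1, (abs_le.1 e8).1]

/-! ### The distance of a slice -/

/-- The Riemannian distance of the slice `M × {t}`. -/
def sliceEDist (S : SplitMetric n M t₀) (t : ℝ) (ht : t₀ < t) (x y : M) : ℝ≥0∞ :=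
  letI : Bundle.RiemannianBundle (fun x : M => TangentSpace (𝓡 n) x) :=
    ⟨(S.slice t ht).toRiemannianMetric⟩
  Manifold.riemannianEDist (𝓡 n) x y

theorem sliceEDist_comm (S : SplitMetric n M t₀) {t : ℝ} (ht : t₀ < t) (x y : M) :
    S.sliceEDist t ht x y = S.sliceEDist t ht y x :=
  letI : Bundle.RiemannianBundle (fun x : M => TangentSpace (𝓡 n) x) :=
    ⟨(S.slice t ht).toRiemannianMetric⟩
  Manifold.riemannianEDist_comm

theorem sliceEDist_self (S : SplitMetric n M t₀) {t : ℝ} (ht : t₀ < t) (x : M) :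
    S.sliceEDist t ht x x = 0 :=
  letI : Bundle.RiemannianBundle (fun x : M => TangentSpace (𝓡 n) x) :=
    ⟨(S.slice t ht).toRiemannianMetric⟩
  Manifold.riemannianEDist_self

theorem sliceEDist_triangle (S : SplitMetric n M t₀) {t : ℝ} (ht : t₀ < t) (x y z : M) :
    S.sliceEDist t ht x z ≤ S.sliceEDist t ht x y + S.sliceEDist t ht y z :=
  have : IsManifold (𝓡 n) 1 M := IsManifold.of_le (n := ∞) (by norm_cast)
  letI : Bundle.RiemannianBundle (fun x : M => TangentSpace (𝓡 n) x) :=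
    ⟨(S.slice t ht).toRiemannianMetric⟩
  Manifold.riemannianEDist_triangle

theorem sliceEDist_le (S : SplitMetric n M t₀) {t : ℝ} (ht : t₀ < t) {γ : ℝ → M} {C : ℝ}
    (hγ : ContMDiffOn 𝓘(ℝ, ℝ) (𝓡 n) 1 γ (Icc 0 1))
    (hC : ∀ s ∈ Icc (0 : ℝ) 1, S.metric t (γ s)
      (mfderivWithin 𝓘(ℝ, ℝ) (𝓡 n) γ (Icc 0 1) s (1 : ℝ))
      (mfderivWithin 𝓘(ℝ, ℝ) (𝓡 n) γ (Icc 0 1) s (1 : ℝ)) ≤ C) :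
    S.sliceEDist t ht (γ 0) (γ 1) ≤ ENNReal.ofReal (Real.sqrt C) := by
  have : IsManifold (𝓡 n) 1 M := IsManifold.of_le (n := ∞) (by norm_cast)
  let : Bundle.RiemannianBundle (fun x : M => TangentSpace (𝓡 n) x) :=
    ⟨(S.slice t ht).toRiemannianMetric⟩
  refine (Manifold.riemannianEDist_le_pathELength (I := 𝓡 n) hγ rfl rfl zero_le_one).trans ?_
  rw [Manifold.pathELength_eq_lintegral_mfderivWithin_Icc]
  have hn : ∀ (x : M) (v : TangentSpace (𝓡 n) x),
      ‖v‖ₑ = ENNReal.ofReal (Real.sqrt (S.metric t x v v)) := fun x v => by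
    rw [← ofReal_norm, norm_eq_sqrt_real_inner]
    rfl
  calc _ ≤ ∫⁻ s in Icc (0 : ℝ) 1, ENNReal.ofReal (Real.sqrt C) := by
        refine setLIntegral_mono' measurableSet_Icc fun s hs => ?_
        rw [hn]
        exact ENNReal.ofReal_le_ofReal (Real.sqrt_le_sqrt (hC s hs))
    _ = ENNReal.ofReal (Real.sqrt C) := by simp

theorem exists_tendsto_of_sliceEDist (S : SplitMetric n M t₀) (hS : S.SliceComplete) {t : ℝ}
    (ht : t₀ < t) {a : ℕ → M}
    (ha : ∀ ε : ℝ≥0∞, 0 < ε → ∃ k, ∀ i ≥ k, ∀ j ≥ k, S.sliceEDist t ht (a i) (a j) < ε) :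
    ∃ x, Tendsto a atTop (𝓝 x) := hS.1 t ht a ha

set_option synthInstance.maxHeartbeats 200000 in
/-- Near a point, the distance of the slice is bounded by the chord in a chart. -/
theorem eventually_sliceEDist_le (S : SplitMetric n M t₀) {t : ℝ} (ht : t₀ < t) (q : M) {c : ℝ}
    (hc : 1 < c) :
    ∀ᶠ z in 𝓝 q, S.sliceEDist t ht q z ≤ ENNReal.ofReal (Real.sqrt (c * S.chordSq q t q z)) := by
  set φ := extChartAt (𝓡 n) q with hφ
  have hqs : q ∈ φ.source := mem_extChartAt_source q
  have hz : ((φ q, t) : 𝓔 × ℝ) ∈ S.chartDom q := ⟨φ.map_source hqs, ht⟩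
  have hg : ContDiffAt ℝ ∞ (fun y : 𝓔 => S.metricC q (y, t)) (φ q) :=
    ContDiffAt.comp (g := S.metricC q) (f := fun y : 𝓔 => (y, t)) (φ q)
      (S.contDiffAt_metricC hz) (contDiffAt_id.prodMk contDiffAt_const)
  -- `c g_q - g` is positive definite near `q`
  have hpos : ∀ v : 𝓔, v ≠ 0 → 0 < (c • S.metricC q (φ q, t) - S.metricC q (φ q, t)) v v := by
    intro v hv
    have := S.metricC_pos hz hv
    simp only [sub_apply, smul_apply, smul_eq_mul]
    nlinarith
  obtain ⟨m, hm, hev⟩ := exists_eventually_le_bilin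
    (B := fun y : 𝓔 => c • S.metricC q (φ q, t) - S.metricC q (y, t)) (x₀ := φ q)
    (contDiffAt_const.sub hg).continuousAt hpos
  obtain ⟨ρ, hρ, hball⟩ := Metric.mem_nhds_iff.1
    (inter_mem hev ((isOpen_extChartAt_target (I := 𝓡 n) q).mem_nhds (φ.map_source hqs)))
  filter_upwards [(isOpen_extChartAt_source (I := 𝓡 n) q).mem_nhds hqs,
    (continuousAt_extChartAt (I := 𝓡 n) q).preimage_mem_nhds (Metric.ball_mem_nhds _ hρ)]
    with z hzs hzb
  set δ : 𝓔 := φ z - φ q with hδ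
  set l : ℝ → 𝓔 := fun s => φ q + s • δ with hl
  have hlb : ∀ s ∈ Icc (0 : ℝ) 1, l s ∈ Metric.ball (φ q) ρ := by
    intro s hs
    have h1 : ‖δ‖ < ρ := by rw [hδ, ← dist_eq_norm]; exact hzb
    rw [mem_ball_iff_norm]
    simp only [hl, add_sub_cancel_left, norm_smul, Real.norm_of_nonneg hs.1]
    nlinarith [hs.2, norm_nonneg δ]
  have hld : ∀ s, HasDerivAt l δ s := fun s => by
    simpa only [one_smul] using! ((hasDerivAt_id s).smul_const δ).const_add (φ q)
  have hlm : ContMDiff 𝓘(ℝ, ℝ) 𝓘(ℝ, 𝓔) 1 l := by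
    rw [contMDiff_iff_contDiff]; fun_prop
  have hφs : ContMDiffOn 𝓘(ℝ, 𝓔) (𝓡 n) 1 φ.symm φ.target :=
    (contMDiffOn_extChartAt_symm (n := ∞) q).of_le (by norm_cast)
  have hγ : ContMDiffOn 𝓘(ℝ, ℝ) (𝓡 n) 1 (φ.symm ∘ l) (Icc 0 1) :=
    hφs.comp hlm.contMDiffOn fun s hs => (hball (hlb s hs)).2
  have h := S.sliceEDist_le ht (C := c * S.chordSq q t q z) hγ fun s hs => ?_
  · have e0 : (φ.symm ∘ l) 0 = q := by simp [hl, φ.left_inv hqs]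
    have e1 : (φ.symm ∘ l) 1 = z := by simp [hl, hδ, φ.left_inv hzs]
    rwa [e0, e1] at h
  · have hd : mfderivWithin 𝓘(ℝ, ℝ) (𝓡 n) (φ.symm ∘ l) (Icc 0 1) s (1 : ℝ)
        = chartSymmD q (l s) δ := by
      have h1 : HasMFDerivWithinAt 𝓘(ℝ, 𝓔) (𝓡 n) φ.symm (range (𝓡 n)) (l s) (chartSymmD q (l s)) :=
        have : IsManifold (𝓡 n) 1 M := IsManifold.of_le (n := ∞) (by norm_cast)
        (mdifferentiableWithinAt_extChartAt_symm (I := 𝓡 n)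
          (hball (hlb s hs)).2).hasMFDerivWithinAt
      have h2 : HasMFDerivWithinAt 𝓘(ℝ, ℝ) 𝓘(ℝ, 𝓔) l (Icc 0 1) s
          (ContinuousLinearMap.toSpanSingleton ℝ δ) :=
        (hld s).hasFDerivAt.hasFDerivWithinAt.hasMFDerivWithinAt
      have h3 := h1.comp s h2 fun r _ => by simp
      have h4 := h3.mfderivWithin ((uniqueDiffOn_Icc zero_lt_one s hs).uniqueMDiffWithinAt)
      rw [h4]
      change chartSymmD q (l s) ((1 : ℝ) • δ) = _
      rw [one_smul]
    rw [hd]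
    have h1 := (hball (hlb s hs)).1 δ
    have h2 : (c • S.metricC q (φ q, t) - S.metricC q (l s, t)) δ δ
        = c * S.chordSq q t q z - S.metricC q (l s, t) δ δ := rfl
    have h3 : (0 : ℝ) ≤ m * ‖δ‖ ^ 2 := by positivity
    have h4 := h3.trans h1
    rw [h2] at h4
    change S.metricC q (l s, t) δ δ ≤ _
    linarith

end SplitMetric

/-- A first order bound `Q ≤ (L ρ)²` is propagated by an estimate of the growth of `Q`. -/
theorem eventually_le_sq_of_growth {ι : Type*} {l : Filter ι} {Q Q' ρ : ι → ℝ} {L I C : ℝ}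
    (hL : 0 ≤ L) (hρ : Tendsto ρ l (𝓝 0))
    (h : ∀ η > 0, ∀ᶠ i in l, Q i ≤ ((L + η) * ρ i) ^ 2) (h0 : ∀ᶠ i in l, 0 ≤ Q i)
    (h' : ∀ᶠ i in l, Q' i ≤ Q i * Real.exp (2 * I + C * Real.sqrt (Q i))) :
    ∀ η > 0, ∀ᶠ i in l, Q' i ≤ ((L * Real.exp I + η) * ρ i) ^ 2 := by
  intro η hη
  set A := Real.exp I with hA
  have hAp : 0 < A := Real.exp_pos I
  have hQ0 : Tendsto Q l (𝓝 0) := by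
    have h1 : Tendsto (fun i => ((L + 1) * ρ i) ^ 2) l (𝓝 0) := by
      simpa using (hρ.const_mul (L + 1)).pow 2
    exact squeeze_zero' h0 (h 1 one_pos) h1
  have hexp : Tendsto (fun i => Real.exp (C * Real.sqrt (Q i))) l (𝓝 1) := by
    have h1 : Continuous fun x : ℝ => Real.exp (C * Real.sqrt x) := by fun_prop
    simpa [Function.comp_def] using (h1.tendsto 0).comp hQ0
  set c := ((L * A + η) / (L * A + η / 2)) ^ 2 with hc
  have hden : 0 < L * A + η / 2 := by positivity
  have hc1 : 1 < c := by
    rw [hc]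
    refine one_lt_pow₀ ?_ two_ne_zero
    rw [one_lt_div hden]
    linarith
  filter_upwards [h (η / (2 * A)) (by positivity), h', h0, hexp.eventually_lt_const hc1]
    with i h1 h2 h3 h4
  calc Q' i ≤ Q i * Real.exp (2 * I + C * Real.sqrt (Q i)) := h2
    _ = Q i * (A ^ 2 * Real.exp (C * Real.sqrt (Q i))) := by
        rw [Real.exp_add, two_mul, Real.exp_add, ← hA, pow_two]
    _ ≤ ((L + η / (2 * A)) * ρ i) ^ 2 * (A ^ 2 * c) := by gcongr
    _ = ((L * A + η) * ρ i) ^ 2 := by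
        rw [hc]
        field_simp

namespace SplitMetric

variable {n : ℕ} {M : Type*} [TopologicalSpace M]
  [ChartedSpace (EuclideanSpace ℝ (Fin n)) M] [IsManifold (𝓡 n) ∞ M] {t₀ : ℝ}

local notation "𝓔" => EuclideanSpace ℝ (Fin n)

/-! ### First order separation -/

theorem chordSq_nonneg (S : SplitMetric n M t₀) {x₀ q : M} {T : ℝ} (hT : t₀ < T)
    (hq : q ∈ (extChartAt (𝓡 n) x₀).source) (z : M) : 0 ≤ S.chordSq x₀ T q z :=
  S.metricC_nonneg (z := (_, T)) ⟨(extChartAt (𝓡 n) x₀).map_source hq, hT⟩ _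

/-- The chords from a point in two charts are asymptotically equal. -/
theorem eventually_chordSq_le_chordSq (S : SplitMetric n M t₀) {x₀ x₁ q : M} {T c : ℝ}
    (hT : t₀ < T) (hq : q ∈ (extChartAt (𝓡 n) x₀).source)
    (hq' : q ∈ (extChartAt (𝓡 n) x₁).source) (hc : 1 < c) :
    ∀ᶠ z in 𝓝 q, S.chordSq x₁ T q z ≤ c * S.chordSq x₀ T q z := by
  set y := extChartAt (𝓡 n) x₀ q with hy
  have hyt : y ∈ (extChartAt (𝓡 n) x₀).target := (extChartAt (𝓡 n) x₀).map_source hq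
  have hys : (extChartAt (𝓡 n) x₀).symm y = q := (extChartAt (𝓡 n) x₀).left_inv hq
  have hy' : (extChartAt (𝓡 n) x₀).symm y ∈ (extChartAt (𝓡 n) x₁).source := by rwa [hys]
  have hd : HasFDerivAt (transition n x₀ x₁) (fderiv ℝ (transition n x₀ x₁) y) y :=
    ((contDiffAt_transition hyt hy').differentiableAt (by simp)).hasFDerivAt
  set A := fderiv ℝ (transition n x₀ x₁) y with hA
  have hψ : ∀ z ∈ (extChartAt (𝓡 n) x₀).source,
      transition n x₀ x₁ (extChartAt (𝓡 n) x₀ z) = extChartAt (𝓡 n) x₁ z := fun z hz => by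
    rw [transition, (extChartAt (𝓡 n) x₀).left_inv hz]
  have hiso := S.metricC_transition hyt hy' T
  rw [hψ q hq] at hiso
  set g₀ := S.metricC x₀ (y, T) with hg₀
  set g₁ := S.metricC x₁ (extChartAt (𝓡 n) x₁ q, T) with hg₁
  have hpos₁ : ∀ v, 0 ≤ g₁ v v := fun v =>
    S.metricC_nonneg (z := (_, T)) ⟨(extChartAt (𝓡 n) x₁).map_source hq', hT⟩ v
  have hsymm : ∀ u v, g₁ u v = g₁ v u := S.metricC_symm hT
  obtain ⟨m, hm, hlow⟩ := exists_eventually_le_bilin (B := fun _ : Unit => g₀) (x₀ := ())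
    continuousAt_const (fun v hv => S.metricC_pos (z := (y, T)) ⟨hyt, hT⟩ hv)
  replace hlow := hlow.self_of_nhds
  set σ := (c - 1) / 2 with hσ
  have hσp : 0 < σ := by rw [hσ]; linarith
  set K := (1 + σ⁻¹) * ‖g₁‖ / m with hK
  have hK0 : 0 ≤ K := by positivity
  set ε := min 1 (σ / (K + 1)) with hε
  have hεp : 0 < ε := lt_min one_pos (by positivity)
  have hKε : K * ε ^ 2 ≤ σ := by
    have h1 : ε ≤ 1 := min_le_left _ _
    have h2 : ε ≤ σ / (K + 1) := min_le_right _ _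
    rw [le_div_iff₀ (by positivity)] at h2
    nlinarith [mul_nonneg hK0 hεp.le]
  have hlin := (hd.isLittleO.def hεp)
  have hcont : ContinuousAt (extChartAt (𝓡 n) x₀) q := continuousAt_extChartAt' hq
  filter_upwards [(isOpen_extChartAt_source x₀).mem_nhds hq, hcont.tendsto.eventually hlin]
    with z hz hzl
  rw [hψ z hz, hψ q hq] at hzl
  set δ := extChartAt (𝓡 n) x₀ z - y with hδ
  set e := extChartAt (𝓡 n) x₁ z - extChartAt (𝓡 n) x₁ q - A δ with he
  have h1 : S.chordSq x₁ T q z = g₁ (A δ + e) (A δ + e) := by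
    rw [he, add_sub_cancel, chordSq]
  have h2 : S.chordSq x₀ T q z = g₀ δ δ := rfl
  have h3 : 2 * g₁ (A δ) e ≤ σ * g₁ (A δ) (A δ) + σ⁻¹ * g₁ e e := by
    have h := hpos₁ (σ • A δ - e)
    simp only [map_sub, map_smul, sub_apply, smul_apply, smul_eq_mul, hsymm e (A δ)] at h
    have h' : σ * (2 * g₁ (A δ) e) ≤ σ * (σ * g₁ (A δ) (A δ) + σ⁻¹ * g₁ e e) := by
      rw [mul_add, ← mul_assoc σ σ⁻¹, mul_inv_cancel₀ hσp.ne']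
      linarith
    exact le_of_mul_le_mul_left h' hσp
  have h4 : g₁ e e ≤ ‖g₁‖ * (ε * ‖δ‖) ^ 2 := by
    refine (le_abs_self _).trans ?_
    rw [← Real.norm_eq_abs]
    refine (g₁.le_opNorm₂ e e).trans ?_
    rw [mul_assoc, ← pow_two]
    gcongr
  have h5 : (1 + σ⁻¹) * g₁ e e ≤ σ * g₀ δ δ := by
    calc (1 + σ⁻¹) * g₁ e e ≤ (1 + σ⁻¹) * (‖g₁‖ * (ε * ‖δ‖) ^ 2) := by gcongr
      _ = K * ε ^ 2 * (m * ‖δ‖ ^ 2) := by rw [hK]; field_simp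
      _ ≤ σ * g₀ δ δ := by
        have := hlow δ
        gcongr
  rw [h1, h2]
  simp only [map_add, add_apply]
  rw [hiso δ δ] at h3 ⊢
  rw [hsymm e (A δ)]
  have hc2 : c = 1 + 2 * σ := by rw [hσ]; ring
  rw [hc2]
  linarith

/-- If the chords from `q` to `z i` tend to zero then `z i` tends to `q`. -/
theorem tendsto_of_chordSq (S : SplitMetric n M t₀) {ι : Type*} {l : Filter ι} {x₀ q : M} {T : ℝ}
    (hT : t₀ < T) (hq : q ∈ (extChartAt (𝓡 n) x₀).source) {z : ι → M}
    (hz : ∀ᶠ i in l, z i ∈ (extChartAt (𝓡 n) x₀).source)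
    (h : Tendsto (fun i => S.chordSq x₀ T q (z i)) l (𝓝 0)) : Tendsto z l (𝓝 q) := by
  set y := extChartAt (𝓡 n) x₀ q with hy
  have hyt : y ∈ (extChartAt (𝓡 n) x₀).target := (extChartAt (𝓡 n) x₀).map_source hq
  obtain ⟨m, hm, hlow⟩ := exists_eventually_le_bilin (B := fun _ : Unit => S.metricC x₀ (y, T))
    (x₀ := ()) continuousAt_const (fun v hv => S.metricC_pos (z := (y, T)) ⟨hyt, hT⟩ hv)
  replace hlow := hlow.self_of_nhds
  have h1 : Tendsto (fun i => ‖extChartAt (𝓡 n) x₀ (z i) - y‖) l (𝓝 0) := by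
    have h2 : Tendsto (fun i => Real.sqrt (S.chordSq x₀ T q (z i) / m)) l (𝓝 0) := by
      have := (Real.continuous_sqrt.tendsto (0 / m)).comp (h.div_const m)
      simpa [Function.comp_def] using this
    refine squeeze_zero (fun i => norm_nonneg _) (fun i => ?_) h2
    refine Real.le_sqrt_of_sq_le ?_
    rw [le_div_iff₀ hm, mul_comm]
    exact hlow _
  have h2 : Tendsto (fun i => extChartAt (𝓡 n) x₀ (z i)) l (𝓝 y) :=
    tendsto_iff_norm_sub_tendsto_zero.2 h1
  have h3 : Tendsto (fun i => (extChartAt (𝓡 n) x₀).symm (extChartAt (𝓡 n) x₀ (z i))) l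
      (𝓝 ((extChartAt (𝓡 n) x₀).symm y)) :=
    (continuousAt_extChartAt_symm'' hyt).tendsto.comp h2
  rw [(extChartAt (𝓡 n) x₀).left_inv hq] at h3
  exact h3.congr' (hz.mono fun i hi => (extChartAt (𝓡 n) x₀).left_inv hi)

/-- The points `z i` converge to `q`, at a distance which is at most `Λ ρ i` to first order, with
respect to the metric of the slice at time `T`. -/
def ChordLE (S : SplitMetric n M t₀) {ι : Type*} (T : ℝ) (l : Filter ι) (z : ι → M) (q : M)
    (ρ : ι → ℝ) (Λ : ℝ) : Prop :=
  Tendsto z l (𝓝 q) ∧ ∀ x₀ : M, q ∈ (extChartAt (𝓡 n) x₀).source → ∀ η > 0,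
    ∀ᶠ i in l, S.chordSq x₀ T q (z i) ≤ ((Λ + η) * ρ i) ^ 2

theorem chordLE_of_chart (S : SplitMetric n M t₀) {ι : Type*} {l : Filter ι} {x₀ q : M} {T : ℝ}
    (hT : t₀ < T) (hq : q ∈ (extChartAt (𝓡 n) x₀).source) {z : ι → M} {ρ : ι → ℝ} {Λ : ℝ}
    (hz : Tendsto z l (𝓝 q)) (hΛ : 0 ≤ Λ)
    (h : ∀ η > 0, ∀ᶠ i in l, S.chordSq x₀ T q (z i) ≤ ((Λ + η) * ρ i) ^ 2) :
    S.ChordLE T l z q ρ Λ := by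
  refine ⟨hz, fun x₁ hq' η hη => ?_⟩
  have hden : 0 < Λ + η / 2 := by positivity
  set c := ((Λ + η) / (Λ + η / 2)) ^ 2 with hc
  have hc1 : 1 < c := by
    rw [hc]
    refine one_lt_pow₀ ?_ two_ne_zero
    rw [one_lt_div hden]
    linarith
  filter_upwards [hz.eventually (S.eventually_chordSq_le_chordSq hT hq hq' hc1),
    h (η / 2) (half_pos hη)] with i h1 h2
  calc S.chordSq x₁ T q (z i) ≤ c * S.chordSq x₀ T q (z i) := h1
    _ ≤ c * ((Λ + η / 2) * ρ i) ^ 2 := by gcongr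
    _ = ((Λ + η) * ρ i) ^ 2 := by rw [hc]; field_simp

/-- From time `Ta` on, the lapse is positive and `N |K| ≤ k(t)` with an integrable `k`. -/
def CurvatureBound (S : SplitMetric n M t₀) (Ta : ℝ) (k : ℝ → ℝ) : Prop :=
  t₀ < Ta ∧ IntegrableOn k (Ici Ta) ∧ ∀ r, Ta ≤ r → ∀ p : M,
    0 < S.lapse r p ∧ S.lapse r p * S.normExtrinsicCurvature r p ≤ k r

theorem CurvatureBound.nonneg {S : SplitMetric n M t₀} {Ta : ℝ} {k : ℝ → ℝ}
    (h : S.CurvatureBound Ta k) (p : M) {r : ℝ} (hr : Ta ≤ r) : 0 ≤ k r :=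
  (mul_nonneg (h.2.2 r hr p).1.le (Real.sqrt_nonneg _)).trans (h.2.2 r hr p).2

theorem CurvatureBound.intervalIntegrable {S : SplitMetric n M t₀} {Ta : ℝ} {k : ℝ → ℝ}
    (h : S.CurvatureBound Ta k) {a b : ℝ} (ha : Ta ≤ a) (hab : a ≤ b) :
    IntervalIntegrable k volume a b :=
  (intervalIntegrable_iff_integrableOn_Icc_of_le hab).2
    (h.2.1.mono_set fun _ hr => ha.trans hr.1)

/-- Propagation of the first order separation along the normal flow, for short times. -/
theorem exists_chordLE_flow [T2Space M] (S : SplitMetric n M t₀) {Ta : ℝ} {k : ℝ → ℝ}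
    (hk : S.CurvatureBound Ta k) {y : ℝ → M} {a b T₁ : ℝ} (hy : S.IsNormalOn y (Ioo a b))
    (hT₁ : T₁ ∈ Ioo a b) :
    ∃ ε > 0, ∀ T ∈ Ioo (T₁ - ε) (T₁ + ε), ∀ T' ∈ Ioo (T₁ - ε) (T₁ + ε), Ta ≤ T → T ≤ T' →
      ∀ (ι : Type) (l : Filter ι) (z : ι → M) (ρ : ι → ℝ) (Λ : ℝ), Tendsto ρ l (𝓝 0) → 0 ≤ Λ →
      S.ChordLE T l z (y T) ρ Λ → (∀ᶠ i in l, S.Survives T T' (z i)) ∧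
        S.ChordLE T' l (fun i => S.flow T T' (z i)) (y T') ρ
          (Λ * Real.exp (∫ r in T..T', k r)) := by
  obtain ⟨ht₁, hyc, -⟩ := hy T₁ hT₁
  obtain ⟨V, hV, hVs, ε₁, hε₁, C, hC, hchord⟩ := S.exists_chordSq_le (y T₁) ht₁
  obtain ⟨W, hW, ε₂, hε₂, hbox⟩ := S.exists_flow_box ht₁ hV
  have hev : ∀ᶠ r in 𝓝 T₁, y r ∈ interior W ∩ V ∧ r ∈ Ioo a b :=
    (hyc.eventually_mem (inter_mem (interior_mem_nhds.2 hW) hV)).and (isOpen_Ioo.mem_nhds hT₁)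
  obtain ⟨ε₃, hε₃, hball⟩ := Metric.mem_nhds_iff.1 hev
  rw [Real.ball_eq_Ioo] at hball
  refine ⟨min ε₁ (min ε₂ ε₃), by positivity, fun T hT T' hT' hTa hTT ι l z ρ Λ hρ hΛ hz => ?_⟩
  have hsub : ∀ e, min ε₁ (min ε₂ ε₃) ≤ e → Ioo (T₁ - min ε₁ (min ε₂ ε₃))
      (T₁ + min ε₁ (min ε₂ ε₃)) ⊆ Ioo (T₁ - e) (T₁ + e) := fun e he =>
    Ioo_subset_Ioo (by linarith) (by linarith)
  have hs₁ := hsub ε₁ (min_le_left _ _)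
  have hs₂ := hsub ε₂ ((min_le_right _ _).trans (min_le_left _ _))
  have hs₃ := hsub ε₃ ((min_le_right _ _).trans (min_le_right _ _))
  have hIcc : Icc T T' ⊆ Ioo (T₁ - min ε₁ (min ε₂ ε₃)) (T₁ + min ε₁ (min ε₂ ε₃)) := fun r hr =>
    ⟨hT.1.trans_le hr.1, hr.2.trans_lt hT'.2⟩
  have hyT := hball (hs₃ hT)
  have hyT' := hball (hs₃ hT')
  have htT : t₀ < T := (hy T hyT.2).1
  have htT' : t₀ < T' := (hy T' hyT'.2).1
  have hzW : ∀ᶠ i in l, z i ∈ W :=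
    (hz.1.eventually_mem (isOpen_interior.mem_nhds hyT.1.1)).mono fun i hi => interior_subset hi
  have key : ∀ i, z i ∈ W → S.Survives T T' (z i) ∧ S.flow T T' (z i) ∈ V ∧
      S.chordSq (y T₁) T' (y T') (S.flow T T' (z i)) ≤ S.chordSq (y T₁) T (y T) (z i)
        * Real.exp (2 * (∫ r in T..T', k r) + C * Real.sqrt (S.chordSq (y T₁) T (y T) (z i))) := by
    intro i hi
    obtain ⟨w, hw, hwT, hwV⟩ := hbox (z i) hi T (hs₂ hT)
    have hfl : S.flow T T' (z i) = w T' := by rw [← hwT, hw.flow_eq (hs₂ hT) (hs₂ hT')]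
    refine ⟨hwT ▸ hw.survives (hs₂ hT) (hs₂ hT'), hfl ▸ hwV T' (hs₂ hT'), ?_⟩
    have h := hchord y w k T T' (hs₁ hT) (hs₁ hT') hTT
      (hy.mono fun r hr => (hball (hs₃ (hIcc hr))).2) (hw.mono fun r hr => hs₂ (hIcc hr))
      (fun r hr => ⟨(hball (hs₃ (hIcc hr))).1.2, hwV r (hs₂ (hIcc hr))⟩)
      (hk.2.1.mono_set fun r hr => hTa.trans hr.1) (fun r hr => hk.2.2 r (hTa.trans hr.1))
    rwa [hwT, ← hfl] at h
  have hmain := eventually_le_sq_of_growth (Q' := fun i =>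
      S.chordSq (y T₁) T' (y T') (S.flow T T' (z i))) hΛ hρ (hz.2 (y T₁) (hVs hyT.1.2))
    (Eventually.of_forall fun i => S.chordSq_nonneg htT (hVs hyT.1.2) (z i))
    (hzW.mono fun i hi => (key i hi).2.2)
  refine ⟨hzW.mono fun i hi => (key i hi).1,
    S.chordLE_of_chart htT' (hVs hyT'.1.2) ?_ (by positivity) hmain⟩
  refine S.tendsto_of_chordSq htT' (hVs hyT'.1.2) (hzW.mono fun i hi => hVs (key i hi).2.1) ?_
  refine squeeze_zero' (Eventually.of_forall fun i =>
    S.chordSq_nonneg htT' (hVs hyT'.1.2) _) (hmain 1 one_pos) ?_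
  simpa using (hρ.const_mul (Λ * Real.exp (∫ r in T..T', k r) + 1)).pow 2

end SplitMetric

/-- Induction along a compact interval: a property which can be propagated forwards near every point
of the interval holds at its end if it holds at its beginning. -/
theorem Icc_propagate {P : ℝ → Prop} {a b : ℝ} (hab : a ≤ b) (ha : P a)
    (h : ∀ c ∈ Icc a b, ∃ ε > 0, ∀ s ∈ Icc a b, ∀ s' ∈ Icc a b, s ∈ Ioo (c - ε) (c + ε) →
      s' ∈ Ioo (c - ε) (c + ε) → s ≤ s' → P s → P s') : P b := by
  choose! ε hε hP using h
  obtain ⟨t, ht0, htm, ⟨m, hm⟩, hsub⟩ := exists_monotone_Icc_subset_open_cover_Icc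
    (c := fun c : Icc a b => {s : Icc a b | (s : ℝ) ∈ Ioo ((c : ℝ) - ε c) ((c : ℝ) + ε c)}) hab
    (fun c => isOpen_Ioo.preimage continuous_subtype_val)
    (fun s _ => mem_iUnion.2 ⟨s, by
      have := hε s s.2
      exact ⟨by linarith, by linarith⟩⟩)
  have hall : ∀ i, P (t i) := by
    intro i
    induction i with
    | zero => rwa [ht0]
    | succ i ih =>
      obtain ⟨c, hc⟩ := hsub i
      have hle : t i ≤ t (i + 1) := htm (Nat.le_succ i)
      exact hP c c.2 (t i) (t i).2 (t (i + 1)) (t (i + 1)).2 (hc (left_mem_Icc.2 hle))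
        (hc (right_mem_Icc.2 hle)) hle ih
  have := hall m
  rwa [hm m le_rfl] at this

theorem Filter.Tendsto.bilin_apply_self {ι F : Type*} [NormedAddCommGroup F] [NormedSpace ℝ F]
    {l : Filter ι} {B : ι → F →L[ℝ] F →L[ℝ] ℝ} {B₀ : F →L[ℝ] F →L[ℝ] ℝ} {v : ι → F} {v₀ : F}
    (hB : Tendsto B l (𝓝 B₀)) (hv : Tendsto v l (𝓝 v₀)) :
    Tendsto (fun i => B i (v i) (v i)) l (𝓝 (B₀ v₀ v₀)) := by
  have h1 : Continuous fun x : (F →L[ℝ] F →L[ℝ] ℝ) × F => x.1 x.2 :=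
    isBoundedBilinearMap_apply.continuous
  have h2 : Continuous fun x : (F →L[ℝ] ℝ) × F => x.1 x.2 :=
    isBoundedBilinearMap_apply.continuous
  exact (h2.tendsto (B₀ v₀, v₀)).comp
    (((h1.tendsto (B₀, v₀)).comp (hB.prodMk_nhds hv)).prodMk_nhds hv)

namespace SplitMetric

variable {n : ℕ} {M : Type*} [TopologicalSpace M]
  [ChartedSpace (EuclideanSpace ℝ (Fin n)) M] [IsManifold (𝓡 n) ∞ M] {t₀ : ℝ}

local notation "𝓔" => EuclideanSpace ℝ (Fin n)

/-! ### Transport of paths along the normal flow -/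

/-- The path `p` of the spacetime is differentiable at `u` and the component of its velocity
tangent to the slices has length at most `L`. -/
def HorizontalSpeedLE (S : SplitMetric n M t₀) (p : ℝ → M × ℝ) (u L : ℝ) : Prop :=
  ContinuousAt p u ∧ ∃ w, HasDerivAt (curveC n (p u).1 p) w u ∧
    S.metricC (p u).1 (curveC n (p u).1 p u)
      (horizontal (S.shiftC (p u).1 (curveC n (p u).1 p u)) w)
      (horizontal (S.shiftC (p u).1 (curveC n (p u).1 p u)) w) ≤ L ^ 2

/-- The separation of the normal curve through `p u` from the point `p u'`, at the time of `p u'`,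
is to first order the horizontal part of the velocity of `p`. -/
theorem HorizontalSpeedLE.eventually_chordSq_le {S : SplitMetric n M t₀} {p : ℝ → M × ℝ} {u L : ℝ}
    (hp : S.HorizontalSpeedLE p u L) (hL : 0 ≤ L) {y : ℝ → M} {J : Set ℝ}
    (hy : S.IsNormalOn y J) (hu : (p u).2 ∈ J) (hyu : y (p u).2 = (p u).1) {η : ℝ} (hη : 0 < η) :
    ∀ᶠ u' in 𝓝 u, S.chordSq (p u).1 (p u').2 (y (p u').2) (p u').1 ≤ ((L + η) * |u' - u|) ^ 2 := by
  obtain ⟨hpc, w, hw, hwL⟩ := hp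
  set q := (p u).1 with hq
  set φ := extChartAt (𝓡 n) q with hφ
  have hqs : q ∈ φ.source := mem_extChartAt_source q
  obtain ⟨htu, hyc, hyd⟩ := hy _ hu
  have hyd := hyd q (by rwa [hyu])
  rw [hyu] at hyd
  have hz : curveC n q p u ∈ S.chartDom q := S.curveC_mem htu hqs
  have ht : HasDerivAt (fun u' => (p u').2) w.2 u := hw.snd
  have hx : HasDerivAt (fun u' => φ (p u').1) w.1 u := hw.fst
  have hηd : HasDerivAt (fun u' => φ (y (p u').2)) (w.2 • -S.shiftC q (φ q, (p u).2)) u :=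
    HasDerivAt.scomp (g₁ := fun s => φ (y s)) (h := fun u' => (p u').2) u hyd ht
  set v : 𝓔 := horizontal (S.shiftC q (curveC n q p u)) w with hv
  have hδ : HasDerivAt (fun u' => φ (p u').1 - φ (y (p u').2)) v u := by
    refine (hx.fun_sub hηd).congr_deriv ?_
    rw [hv, horizontal_apply, smul_neg, sub_neg_eq_add]
    rfl
  have hslope := hasDerivAt_iff_tendsto_slope.1 hδ
  have hζ : ContinuousAt (fun u' => ((φ (y (p u').2), (p u').2) : 𝓔 × ℝ)) u :=
    hηd.continuousAt.prodMk ht.continuousAt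
  have hB : ContinuousAt (fun u' => S.metricC q (φ (y (p u').2), (p u').2)) u :=
    ContinuousAt.comp (g := S.metricC q) (by
      rw [hyu]; exact (S.contDiffAt_metricC hz).continuousAt) hζ
  have hB' : Tendsto (fun u' => S.metricC q (φ (y (p u').2), (p u').2)) (𝓝[≠] u)
      (𝓝 (S.metricC q (curveC n q p u))) := by
    have h1 := hB.tendsto
    rw [hyu] at h1
    exact h1.mono_left nhdsWithin_le_nhds
  have hlim := hB'.bilin_apply_self hslope
  have hlt : S.metricC q (curveC n q p u) v v < (L + η) ^ 2 :=
    hwL.trans_lt (by gcongr; linarith)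
  have hev := hlim.eventually_lt_const hlt
  have h0 : φ (p u).1 - φ (y (p u).2) = 0 := by rw [hyu, sub_self]
  rw [← nhdsNE_sup_pure u, eventually_sup]
  constructor
  · filter_upwards [hev, self_mem_nhdsWithin] with u' h1 hne
    have hne' : u' - u ≠ 0 := sub_ne_zero.2 hne
    rw [slope_def_module, h0, sub_zero] at h1
    simp only [map_smul, smul_apply, smul_eq_mul] at h1
    rw [mul_pow, sq_abs]
    have h2 : S.chordSq q (p u').2 (y (p u').2) (p u').1
        = (u' - u) ^ 2 * ((u' - u)⁻¹ * ((u' - u)⁻¹ *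
          S.metricC q (φ (y (p u').2), (p u').2) (φ (p u').1 - φ (y (p u').2))
            (φ (p u').1 - φ (y (p u').2)))) := by
      rw [chordSq]
      field_simp
      rfl
    rw [h2, mul_comm]
    gcongr
  · rw [eventually_pure, chordSq, h0]
    simp

/-- For a short time after the time of `p u`, the transport of the path `p` along the normal flow has
speed at most `L exp (∫ k)` at `u`. The normal curves which are compared start at different times,
on the path and not on a slice. -/
theorem exists_chordLE_base [T2Space M] {S : SplitMetric n M t₀} {Ta : ℝ} {k : ℝ → ℝ}
    (hk : S.CurvatureBound Ta k) {p : ℝ → M × ℝ} {u L : ℝ} (hp : S.HorizontalSpeedLE p u L)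
    (hL : 0 ≤ L) (hTa : Ta < (p u).2) {y : ℝ → M} {a b : ℝ} (hy : S.IsNormalOn y (Ioo a b))
    (hu : (p u).2 ∈ Ioo a b) (hyu : y (p u).2 = (p u).1) :
    ∃ ε > 0, ∀ T ∈ Ioo (p u).2 ((p u).2 + ε),
      (∀ᶠ u' in 𝓝 u, S.Survives (p u').2 T (p u').1) ∧
        S.ChordLE T (𝓝 u) (fun u' => S.flow (p u').2 T (p u').1) (y T) (fun u' => |u' - u|)
          (L * Real.exp (∫ r in Ta..T, k r)) := by
  set T₁ := (p u).2 with hT₁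
  have ht₁ := (hy T₁ hu).1
  obtain ⟨V, hV, hVs, ε₁, hε₁, C, hC, hchord⟩ := S.exists_chordSq_le (p u).1 ht₁
  obtain ⟨W, hW, ε₂, hε₂, hbox⟩ := S.exists_flow_box ht₁ hV
  have hyc' : ContinuousAt y T₁ := (hy T₁ hu).2.1
  have hev : ∀ᶠ r in 𝓝 T₁, y r ∈ V ∧ r ∈ Ioo a b :=
    (hyc'.eventually_mem (by rwa [hyu])).and (isOpen_Ioo.mem_nhds hu)
  obtain ⟨ε₃, hε₃, hball⟩ := Metric.mem_nhds_iff.1 hev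
  rw [Real.ball_eq_Ioo] at hball
  set ε := min ε₁ (min ε₂ ε₃) with hε
  have hεp : 0 < ε := by positivity
  have hsub : ∀ e, ε ≤ e → Ioo (T₁ - ε) (T₁ + ε) ⊆ Ioo (T₁ - e) (T₁ + e) := fun e he =>
    Ioo_subset_Ioo (by linarith) (by linarith)
  have hs₁ := hsub ε₁ (min_le_left _ _)
  have hs₂ := hsub ε₂ ((min_le_right _ _).trans (min_le_left _ _))
  have hs₃ := hsub ε₃ ((min_le_right _ _).trans (min_le_right _ _))
  refine ⟨ε, hεp, fun T hT => ?_⟩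
  have hTI : T ∈ Ioo (T₁ - ε) (T₁ + ε) := ⟨by linarith [hT.1], hT.2⟩
  have htT : t₀ < T := ht₁.trans hT.1
  have hpt : ContinuousAt (fun u' => (p u').2) u := continuous_snd.continuousAt.comp hp.1
  have hpx : ContinuousAt (fun u' => (p u').1) u := continuous_fst.continuousAt.comp hp.1
  have hgood : ∀ᶠ u' in 𝓝 u, (p u').1 ∈ W ∧ (p u').2 ∈ Ioo (T₁ - ε) (T₁ + ε) ∧ (p u').2 < T ∧
      Ta < (p u').2 := by
    refine (hpx.eventually_mem hW).and ((hpt.eventually_mem (Ioo_mem_nhds (by linarith)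
      (by linarith))).and ?_)
    exact (hpt.eventually_mem (Iio_mem_nhds hT.1)).and (hpt.eventually_mem (Ioi_mem_nhds hTa))
  have key : ∀ u', ((p u').1 ∈ W ∧ (p u').2 ∈ Ioo (T₁ - ε) (T₁ + ε) ∧ (p u').2 < T ∧
      Ta < (p u').2) → S.Survives (p u').2 T (p u').1 ∧ S.flow (p u').2 T (p u').1 ∈ V ∧
      0 ≤ S.chordSq (p u).1 (p u').2 (y (p u').2) (p u').1 ∧
      S.chordSq (p u).1 T (y T) (S.flow (p u').2 T (p u').1)
        ≤ S.chordSq (p u).1 (p u').2 (y (p u').2) (p u').1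
        * Real.exp (2 * (∫ r in Ta..T, k r) + C * Real.sqrt
          (S.chordSq (p u).1 (p u').2 (y (p u').2) (p u').1)) := by
    rintro u' ⟨h1, h2, h3, h4⟩
    obtain ⟨w, hw, hwT, hwV⟩ := hbox _ h1 _ (hs₂ h2)
    have hfl : S.flow (p u').2 T (p u').1 = w T := by rw [← hwT, hw.flow_eq (hs₂ h2) (hs₂ hTI)]
    have hIcc : Icc (p u').2 T ⊆ Ioo (T₁ - ε) (T₁ + ε) := fun r hr =>
      ⟨h2.1.trans_le hr.1, hr.2.trans_lt hTI.2⟩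
    have hpos : 0 ≤ S.chordSq (p u).1 (p u').2 (y (p u').2) (p u').1 :=
      S.chordSq_nonneg (hk.1.trans h4) (hVs (hball (hs₃ h2)).1) _
    refine ⟨hwT ▸ hw.survives (hs₂ h2) (hs₂ hTI), hfl ▸ hwV T (hs₂ hTI), hpos, ?_⟩
    have h := hchord y w k (p u').2 T (hs₁ h2) (hs₁ hTI) h3.le
      (hy.mono fun r hr => (hball (hs₃ (hIcc hr))).2) (hw.mono fun r hr => hs₂ (hIcc hr))
      (fun r hr => ⟨(hball (hs₃ (hIcc hr))).1, hwV r (hs₂ (hIcc hr))⟩)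
      (hk.2.1.mono_set fun r hr => h4.le.trans hr.1) (fun r hr => hk.2.2 r (h4.le.trans hr.1))
    rw [hwT, ← hfl] at h
    have hint : ∫ r in (p u').2..T, k r ≤ ∫ r in Ta..T, k r := by
      rw [← intervalIntegral.integral_add_adjacent_intervals
        (hk.intervalIntegrable le_rfl h4.le) (hk.intervalIntegrable h4.le h3.le)]
      have : 0 ≤ ∫ r in Ta..(p u').2, k r :=
        intervalIntegral.integral_nonneg h4.le fun r hr => hk.nonneg (p u).1 hr.1
      linarith
    refine h.trans ?_
    gcongr
  have hρ : Tendsto (fun u' => |u' - u|) (𝓝 u) (𝓝 0) := by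
    have : Continuous fun u' : ℝ => |u' - u| := by fun_prop
    simpa using this.tendsto u
  have hmain := eventually_le_sq_of_growth
    (Q' := fun u' => S.chordSq (p u).1 T (y T) (S.flow (p u').2 T (p u').1)) hL hρ
    (fun η hη => hp.eventually_chordSq_le hL hy hu hyu hη)
    (hgood.mono fun u' hu' => (key u' hu').2.2.1) (hgood.mono fun u' hu' => (key u' hu').2.2.2)
  have hyT := hVs (hball (hs₃ hTI)).1
  refine ⟨hgood.mono fun u' hu' => (key u' hu').1,
    S.chordLE_of_chart htT hyT ?_ (by positivity) hmain⟩
  refine S.tendsto_of_chordSq htT hyT (hgood.mono fun u' hu' => hVs (key u' hu').2.1) ?_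
  refine squeeze_zero' (Eventually.of_forall fun i => S.chordSq_nonneg htT hyT _)
    (hmain 1 one_pos) ?_
  simpa using (hρ.const_mul (L * Real.exp (∫ r in Ta..T, k r) + 1)).pow 2

/-- The transport of a path to a later slice along the normal flow is defined near every parameter
at which it is defined, and its speed is at most `L exp (∫ k)`. -/
theorem chordLE_flow_path [T2Space M] {S : SplitMetric n M t₀} {Ta : ℝ} {k : ℝ → ℝ}
    (hk : S.CurvatureBound Ta k) {p : ℝ → M × ℝ} {u L T : ℝ} (hp : S.HorizontalSpeedLE p u L)
    (hL : 0 ≤ L) (hTa : Ta < (p u).2) (hT : (p u).2 < T) (hs : S.Survives (p u).2 T (p u).1) :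
    (∀ᶠ u' in 𝓝 u, S.Survives (p u').2 T (p u').1) ∧
      S.ChordLE T (𝓝 u) (fun u' => S.flow (p u').2 T (p u').1) (S.flow (p u).2 T (p u).1)
        (fun u' => |u' - u|) (L * Real.exp (∫ r in Ta..T, k r)) := by
  obtain ⟨a, b, hu, hTI, y, hy, hyu⟩ := hs
  have hfl : S.flow (p u).2 T (p u).1 = y T := by rw [← hyu, hy.flow_eq hu hTI]
  rw [hfl]
  obtain ⟨ε, hε, hbase⟩ := exists_chordLE_base hk hp hL hTa hy hu hyu
  obtain ⟨T', hT', hT'm⟩ := exists_between (lt_min hT (by linarith : (p u).2 < (p u).2 + ε))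
  have hT'T : T' ≤ T := (hT'm.trans_le (min_le_left _ _)).le
  have hρ : Tendsto (fun u' => |u' - u|) (𝓝 u) (𝓝 0) := by
    have : Continuous fun u' : ℝ => |u' - u| := by fun_prop
    simpa using this.tendsto u
  refine Icc_propagate (P := fun T => (∀ᶠ u' in 𝓝 u, S.Survives (p u').2 T (p u').1) ∧
      S.ChordLE T (𝓝 u) (fun u' => S.flow (p u').2 T (p u').1) (y T)
        (fun u' => |u' - u|) (L * Real.exp (∫ r in Ta..T, k r))) hT'T
    (hbase T' ⟨hT', hT'm.trans_le (min_le_right _ _)⟩) fun c hc => ?_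
  obtain ⟨δ, hδ, hstep⟩ := S.exists_chordLE_flow hk hy
    (T₁ := c) ⟨hu.1.trans (hT'.trans_le hc.1), hc.2.trans_lt hTI.2⟩
  refine ⟨δ, hδ, fun s hs s' hs' hsc hs'c hss hP => ?_⟩
  have hTas : Ta ≤ s := (hTa.trans (hT'.trans_le hs.1)).le
  obtain ⟨h1, h2⟩ := hstep s hsc s' hs'c hTas hss ℝ (𝓝 u) _ _ _ hρ (by positivity) hP.2
  have h3 : ∀ᶠ u' in 𝓝 u, S.Survives (p u').2 s' (p u').1 ∧
      S.flow (p u').2 s' (p u').1 = S.flow s s' (S.flow (p u').2 s (p u').1) := by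
    filter_upwards [hP.1, h1] with u' h4 h5 using h4.trans h5
  refine ⟨h3.mono fun u' hu' => hu'.1, ?_⟩
  have hexp : L * Real.exp (∫ r in Ta..s, k r) * Real.exp (∫ r in s..s', k r)
      = L * Real.exp (∫ r in Ta..s', k r) := by
    rw [mul_assoc, ← Real.exp_add, intervalIntegral.integral_add_adjacent_intervals
      (hk.intervalIntegrable le_rfl hTas) (hk.intervalIntegrable hTas hss)]
  rw [hexp] at h2
  refine ⟨h2.1.congr' (h3.mono fun u' hu' => hu'.2.symm), fun x₀ hx₀ η hη => ?_⟩
  filter_upwards [h2.2 x₀ hx₀ η hη, h3] with u' h4 h5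
  rwa [h5.2]

end SplitMetric

/-- A function which is Lipschitz at every point of an interval, for a distance function, is
Lipschitz on the interval. -/
theorem edist_le_of_forall_eventually {X : Type*} {D : X → X → ℝ≥0∞} (hself : ∀ x, D x x = 0)
    (hsymm : ∀ x y, D x y = D y x) (htri : ∀ x y z, D x z ≤ D x y + D y z) {f : ℝ → X}
    {a b K : ℝ} (hab : a ≤ b) (hK : 0 ≤ K)
    (h : ∀ u ∈ Icc a b, ∀ᶠ v in 𝓝 u, D (f u) (f v) ≤ ENNReal.ofReal (K * |v - u|)) :
    D (f a) (f b) ≤ ENNReal.ofReal (K * (b - a)) := by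
  set s : Set ℝ := {u | D (f a) (f u) ≤ ENNReal.ofReal (K * (u - a))} with hs
  refine (IsClosed.Icc_subset_of_forall_exists_gt (s := s) (a := a) (b := b) ?_ ?_ ?_)
    (right_mem_Icc.2 hab)
  · refine isClosed_of_closure_subset fun x hx => ?_
    have hxI : x ∈ Icc a b := by
      have := closure_mono (inter_subset_right (s := s) (t := Icc a b)) hx
      rwa [isClosed_Icc.closure_eq] at this
    refine ⟨?_, hxI⟩
    by_contra hlt
    have hlt' : ENNReal.ofReal (K * (x - a)) < D (f a) (f x) := not_le.1 hlt
    have hcont : Continuous fun u : ℝ => ENNReal.ofReal (K * (u - a) + K * |u - x|) := by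
      refine ENNReal.continuous_ofReal.comp ?_
      fun_prop
    have h1 : ∀ᶠ u in 𝓝 x, ENNReal.ofReal (K * (u - a) + K * |u - x|) < D (f a) (f x) := by
      refine (hcont.tendsto x).eventually_lt_const ?_
      simpa using hlt'
    have h2 : ∃ᶠ u in 𝓝 x, u ∈ s ∩ Icc a b := mem_closure_iff_frequently.1 hx
    obtain ⟨u, ⟨hus, huI⟩, h3, h4⟩ := (h2.and_eventually (h1.and (h x hxI))).exists
    refine absurd h3 (not_lt.2 ?_)
    calc D (f a) (f x) ≤ D (f a) (f u) + D (f u) (f x) := htri _ _ _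
      _ ≤ ENNReal.ofReal (K * (u - a)) + ENNReal.ofReal (K * |u - x|) := by
          rw [hsymm (f u)]
          exact add_le_add hus h4
      _ = ENNReal.ofReal (K * (u - a) + K * |u - x|) :=
          (ENNReal.ofReal_add (mul_nonneg hK (sub_nonneg.2 huI.1)) (by positivity)).symm
  · simp [hs, hself]
  · rintro x ⟨hxs, hxI⟩ y hxy
    obtain ⟨u, h1, h2⟩ := (((h x (Ico_subset_Icc_self hxI)).filter_mono
      nhdsWithin_le_nhds).and (Ioc_mem_nhdsGT (mem_Ioi.1 hxy))).exists
    refine ⟨u, ?_, h2⟩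
    rw [abs_of_pos (sub_pos.2 h2.1)] at h1
    calc D (f a) (f u) ≤ D (f a) (f x) + D (f x) (f u) := htri _ _ _
      _ ≤ ENNReal.ofReal (K * (x - a)) + ENNReal.ofReal (K * (u - x)) := add_le_add hxs h1
      _ = ENNReal.ofReal (K * (u - a)) := by
          rw [← ENNReal.ofReal_add (mul_nonneg hK (sub_nonneg.2 hxI.1))
            (mul_nonneg hK (sub_pos.2 h2.1).le)]
          congr 1; ring

/-- A function has a limit along a countably generated filter if it has one along all sequences. -/
theorem exists_tendsto_of_forall_seq {X Y : Type*} [TopologicalSpace Y] [T2Space Y]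
    {l : Filter X} [l.IsCountablyGenerated] [l.NeBot] {f : X → Y}
    (h : ∀ u : ℕ → X, Tendsto u atTop l → ∃ y, Tendsto (f ∘ u) atTop (𝓝 y)) :
    ∃ y, Tendsto f l (𝓝 y) := by
  obtain ⟨u, hu⟩ := l.exists_seq_tendsto
  obtain ⟨y, hy⟩ := h u hu
  refine ⟨y, tendsto_of_seq_tendsto fun v hv => ?_⟩
  -- the sequence which interlaces `u` and `v`
  set w : ℕ → X := fun i => if Even i then u (i / 2) else v (i / 2) with hw
  have hwl : Tendsto w atTop l := by
    intro s hs
    obtain ⟨N, hN⟩ := eventually_atTop.1 ((hu.eventually_mem hs).and (hv.eventually_mem hs))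
    refine mem_map.2 (mem_atTop_sets.2 ⟨2 * N, fun i hi => ?_⟩)
    have h1 := hN (i / 2) (by omega)
    rw [mem_preimage, hw]
    by_cases hi' : Even i
    · simpa only [hi', if_true] using h1.1
    · simpa only [hi', if_false] using h1.2
  obtain ⟨y', hy'⟩ := h w hwl
  have e1 : Tendsto (fun i : ℕ => 2 * i) atTop atTop :=
    tendsto_atTop_mono (fun i => by simp only [id]; omega) tendsto_id
  have e2 : Tendsto (fun i : ℕ => 2 * i + 1) atTop atTop :=
    tendsto_atTop_mono (fun i => by simp only [id]; omega) tendsto_id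
  have h1 : f ∘ u = (f ∘ w) ∘ fun i => 2 * i := by
    funext i; simp [hw]
  have h2 : f ∘ v = (f ∘ w) ∘ fun i => 2 * i + 1 := by
    funext i
    have : (2 * i + 1) / 2 = i := by omega
    simp [hw, this]
  have h3 : y = y' := tendsto_nhds_unique hy (h1 ▸ hy'.comp e1)
  rw [h3, h2]
  exact hy'.comp e2

namespace SplitMetric

variable {n : ℕ} {M : Type*} [TopologicalSpace M]
  [ChartedSpace (EuclideanSpace ℝ (Fin n)) M] [IsManifold (𝓡 n) ∞ M] {t₀ : ℝ}

local notation "𝓔" => EuclideanSpace ℝ (Fin n)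

/-! ### Completeness of the normal flow -/

theorem Survives.mono {S : SplitMetric n M t₀} {t T T' : ℝ} {z : M} (h : S.Survives t T z)
    (h1 : t ≤ T') (h2 : T' ≤ T) : S.Survives t T' z := by
  obtain ⟨a, b, ht, hT, y, hy, he⟩ := h
  exact ⟨a, b, ht, ⟨ht.1.trans_le h1, h2.trans_lt hT.2⟩, y, hy, he⟩

/-- The transport along the normal flow of a path with bounded horizontal speed is Lipschitz. -/
theorem sliceEDist_flow_le [T2Space M] {S : SplitMetric n M t₀} {Ta : ℝ} {k : ℝ → ℝ}
    (hk : S.CurvatureBound Ta k) {p : ℝ → M × ℝ} {L T a b : ℝ} (hL : 0 ≤ L) (hab : a ≤ b)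
    (hp : ∀ u ∈ Icc a b, S.HorizontalSpeedLE p u L)
    (ht : ∀ u ∈ Icc a b, Ta < (p u).2 ∧ (p u).2 < T)
    (hs : ∀ u ∈ Icc a b, S.Survives (p u).2 T (p u).1) (hT : t₀ < T) :
    S.sliceEDist T hT (S.flow (p a).2 T (p a).1) (S.flow (p b).2 T (p b).1)
      ≤ ENNReal.ofReal (2 * (L * Real.exp (∫ r in Ta..T, k r) + 1) * (b - a)) := by
  refine edist_le_of_forall_eventually (f := fun u => S.flow (p u).2 T (p u).1)
    (S.sliceEDist_self hT) (S.sliceEDist_comm hT) (S.sliceEDist_triangle hT) hab (by positivity)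
    fun u hu => ?_
  -- the slice distance is at most `√4` times the chord, and the chord at most `(Λ + 1) |v - u|`
  obtain ⟨-, h1, h2⟩ := chordLE_flow_path hk (hp u hu) hL (ht u hu).1 (ht u hu).2 (hs u hu)
  filter_upwards [h1.eventually (S.eventually_sliceEDist_le hT _ (c := 4) (by norm_num)),
    h2 _ (mem_extChartAt_source _) 1 one_pos] with v h3 h4
  refine h3.trans (ENNReal.ofReal_le_ofReal ?_)
  rw [Real.sqrt_le_left (by positivity)]
  calc _ ≤ 4 * ((L * Real.exp (∫ r in Ta..T, k r) + 1) * |v - u|) ^ 2 := by gcongr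
    _ = _ := by ring

/-- The transport along the normal flow of a path with bounded horizontal speed has a limit at the
end of a bounded interval, because it is Lipschitz for the complete distance of the slice. -/
theorem exists_tendsto_flow [T2Space M] {S : SplitMetric n M t₀} (hS : S.SliceComplete) {Ta : ℝ}
    {k : ℝ → ℝ} (hk : S.CurvatureBound Ta k) {p : ℝ → M × ℝ} {L T a b : ℝ} (hL : 0 ≤ L)
    (hp : ∀ u ∈ Ico a b, S.HorizontalSpeedLE p u L)
    (ht : ∀ u ∈ Ico a b, Ta < (p u).2 ∧ (p u).2 < T)
    (hs : ∀ u ∈ Ico a b, S.Survives (p u).2 T (p u).1) (hab : a < b) :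
    ∃ q, Tendsto (fun u => S.flow (p u).2 T (p u).1) (𝓝[<] b) (𝓝 q) := by
  have hT : t₀ < T := hk.1.trans ((ht a ⟨le_rfl, hab⟩).1.trans (ht a ⟨le_rfl, hab⟩).2)
  refine exists_tendsto_of_forall_seq fun v hv => S.exists_tendsto_of_sliceEDist hS hT ?_
  intro ε hε
  set K := 2 * (L * Real.exp (∫ r in Ta..T, k r) + 1) with hK
  have hKp : 0 < K := by positivity
  obtain ⟨δ, hδ, hδε⟩ : ∃ δ : ℝ, 0 < δ ∧ ENNReal.ofReal (K * δ) < ε := by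
    rcases eq_or_ne ε ⊤ with rfl | hε'
    · exact ⟨1, one_pos, ENNReal.ofReal_lt_top⟩
    · have h1 : 0 < ε.toReal := ENNReal.toReal_pos hε.ne' hε'
      refine ⟨ε.toReal / (2 * K), by positivity, ?_⟩
      rw [← ENNReal.ofReal_toReal hε', ENNReal.ofReal_lt_ofReal_iff h1]
      simp only [ENNReal.toReal_ofReal h1.le]
      field_simp
      linarith
  have hmem : Ico (max a (b - δ)) b ∈ 𝓝[<] b := Ico_mem_nhdsLT (max_lt hab (by linarith))
  obtain ⟨N, hN⟩ := eventually_atTop.1 (hv.eventually_mem hmem)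
  have key : ∀ x ∈ Ico (max a (b - δ)) b, ∀ y ∈ Ico (max a (b - δ)) b, x ≤ y →
      S.sliceEDist T hT (S.flow (p x).2 T (p x).1) (S.flow (p y).2 T (p y).1) < ε := by
    intro x hx y hy hxy
    have hsub : Icc x y ⊆ Ico a b := fun u hu =>
      ⟨(le_max_left a (b - δ)).trans (hx.1.trans hu.1), hu.2.trans_lt hy.2⟩
    refine (sliceEDist_flow_le hk hL hxy (fun u hu => hp u (hsub hu)) (fun u hu => ht u (hsub hu))
      (fun u hu => hs u (hsub hu)) hT).trans_lt (lt_of_le_of_lt (ENNReal.ofReal_le_ofReal ?_) hδε)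
    have : y - x ≤ δ := by
      have := (le_max_right a (b - δ)).trans hx.1
      linarith [hy.2]
    gcongr
  refine ⟨N, fun i hi j hj => ?_⟩
  rcases le_total (v i) (v j) with h | h
  · exact key _ (hN i hi) _ (hN j hj) h
  · rw [S.sliceEDist_comm]
    exact key _ (hN j hj) _ (hN i hi) h

/-- If the normal curves through all the points `p u`, `u < b`, of a path with bounded horizontal
speed reach the slice at time `T`, then so does the normal curve through `p b`. At the first time
`T₁` up to which the latter cannot be continued, the transports of `p u` converge in the slice, by
completeness, and the limit is the missing end point. -/
theorem survives_of_forall_Ico [T2Space M] {S : SplitMetric n M t₀} (hS : S.SliceComplete)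
    {Ta : ℝ} {k : ℝ → ℝ} (hk : S.CurvatureBound Ta k) {p : ℝ → M × ℝ} {L T a b : ℝ} (hL : 0 ≤ L)
    (hp : ∀ u ∈ Icc a b, S.HorizontalSpeedLE p u L)
    (ht : ∀ u ∈ Icc a b, Ta < (p u).2 ∧ (p u).2 < T)
    (hs : ∀ u ∈ Ico a b, S.Survives (p u).2 T (p u).1) (hab : a < b) :
    S.Survives (p b).2 T (p b).1 := by
  have : LocallyCompactSpace M := ChartedSpace.locallyCompactSpace (EuclideanSpace ℝ (Fin n)) M
  have hbI : b ∈ Icc a b := right_mem_Icc.2 hab.le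
  obtain ⟨hTb, hbT⟩ := ht b hbI
  have hb0 : t₀ < (p b).2 := hk.1.trans hTb
  set A : Set ℝ := {T' | T' ∈ Icc (p b).2 T ∧ S.Survives (p b).2 T' (p b).1} with hA
  obtain ⟨W₀, hW₀, ε₀, hε₀, hbox₀⟩ := S.exists_flow_box' hb0 (W' := univ) (q := (p b).1) univ_mem
  obtain ⟨T₂, hT₂, hT₂'⟩ := exists_between (lt_min hbT (by linarith : (p b).2 < (p b).2 + ε₀))
  have hT₂A : T₂ ∈ A := ⟨⟨hT₂.le, (hT₂'.trans_le (min_le_left _ _)).le⟩,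
    (hbox₀ _ (mem_of_mem_nhds hW₀) _ ⟨by linarith, by linarith⟩ _
      ⟨by linarith, hT₂'.trans_le (min_le_right _ _)⟩).1⟩
  have hAb : BddAbove A := ⟨T, fun x hx => hx.1.2⟩
  set T₁ := sSup A with hT₁
  have hT₁T : T₁ ≤ T := csSup_le ⟨T₂, hT₂A⟩ fun x hx => hx.1.2
  have hT₂₁ : T₂ ≤ T₁ := le_csSup hAb hT₂A
  have hbT₁ : (p b).2 < T₁ := hT₂.trans_le hT₂₁
  have hT₁0 : t₀ < T₁ := hb0.trans hbT₁
  have hbelow : ∀ T' ∈ Ico (p b).2 T₁, S.Survives (p b).2 T' (p b).1 := by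
    intro T' hT'
    obtain ⟨x, hx, hlt⟩ := exists_lt_of_lt_csSup ⟨T₂, hT₂A⟩ hT'.2
    exact hx.2.mono hT'.1 hlt.le
  -- close to `b` the path lies before the time `T₁`
  have hpt : ContinuousAt (fun u => (p u).2) b := continuous_snd.continuousAt.comp (hp b hbI).1
  obtain ⟨ε, hε, hball⟩ := Metric.mem_nhds_iff.1 (hpt.eventually_mem (Iio_mem_nhds hbT₁))
  rw [Real.ball_eq_Ioo] at hball
  set a' := max a (b - ε / 2) with ha'
  have ha'b : a' < b := max_lt hab (by linarith)
  have hsub : Icc a' b ⊆ Icc a b := Icc_subset_Icc_left (le_max_left _ _)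
  have hlt : ∀ u ∈ Icc a' b, (p u).2 < T₁ := fun u hu => hball
    ⟨by linarith [(le_max_right a (b - ε / 2)).trans hu.1], by linarith [hu.2]⟩
  have hs₁ : ∀ u ∈ Ico a' b, S.Survives (p u).2 T₁ (p u).1 := fun u hu =>
    (hs u ⟨(le_max_left _ _).trans hu.1, hu.2⟩).mono (hlt u (Ico_subset_Icc_self hu)).le hT₁T
  obtain ⟨q, hq⟩ := exists_tendsto_flow hS hk hL
    (fun u hu => hp u (hsub (Ico_subset_Icc_self hu)))
    (fun u hu => ⟨(ht u (hsub (Ico_subset_Icc_self hu))).1, hlt u (Ico_subset_Icc_self hu)⟩)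
    hs₁ ha'b
  -- flow boxes around `(q, T₁)`
  obtain ⟨W₂, hW₂, ε₂, hε₂, hbox₂⟩ := S.exists_flow_box' hT₁0 (W' := univ) (q := q) univ_mem
  obtain ⟨C, hC, hCc, hCW⟩ := exists_mem_nhds_isClosed_subset hW₂
  obtain ⟨W₁, hW₁, ε₁, hε₁, hbox₁⟩ := S.exists_flow_box' hT₁0 hC
  obtain ⟨T', hT', hT'₁⟩ := exists_between (max_lt hbT₁ (max_lt (by linarith : T₁ - ε₁ < T₁)
    (by linarith : T₁ - ε₂ < T₁)))
  have hbT' : (p b).2 < T' := (le_max_left _ _).trans_lt hT'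
  have hT'ε₁ : T₁ - ε₁ < T' := ((le_max_left _ _).trans (le_max_right _ _)).trans_lt hT'
  have hT'ε₂ : T₁ - ε₂ < T' := ((le_max_right _ _).trans (le_max_right _ _)).trans_lt hT'
  have hsb := hbelow T' ⟨hbT'.le, hT'₁⟩
  have hlim := (chordLE_flow_path hk (hp b hbI) hL hTb hbT' hsb).2.1
  -- shortly before `T₁` the transports of `p u` lie in `C`, and hence so does that of `p b`
  have hmemC : S.flow (p b).2 T' (p b).1 ∈ C := by
    refine hCc.mem_of_tendsto (hlim.mono_left (nhdsWithin_le_nhds (s := Iio b))) ?_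
    filter_upwards [hq.eventually_mem hW₁, Ico_mem_nhdsLT ha'b] with u hu huI
    obtain ⟨h1, h2⟩ := hbox₁ _ hu T₁ ⟨by linarith, by linarith⟩ T' ⟨hT'ε₁, by linarith⟩
    rwa [((hs₁ u huI).trans h1).2]
  have hext := (hbox₂ _ (hCW hmemC) T' ⟨hT'ε₂, by linarith⟩ (T₁ + ε₂ / 2)
    ⟨by linarith, by linarith⟩).1
  have hfinal := (hsb.trans hext).1
  have hmin : min (T₁ + ε₂ / 2) T ∈ A := ⟨⟨le_min (by linarith) hbT.le, min_le_right _ _⟩,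
    hfinal.mono (le_min (by linarith) hbT.le) (min_le_left _ _)⟩
  have hle := le_csSup hAb hmin
  rcases min_le_iff.1 hle with h | h
  · rw [← hT₁] at h; linarith
  · rw [← hT₁] at h
    exact hfinal.mono hbT.le (by linarith)

/-- If the normal curve through the first point of a path with bounded horizontal speed reaches the
slice at time `T`, then so does the normal curve through the last point. -/
theorem survives_of_path [T2Space M] {S : SplitMetric n M t₀} (hS : S.SliceComplete)
    {Ta : ℝ} {k : ℝ → ℝ} (hk : S.CurvatureBound Ta k) {p : ℝ → M × ℝ} {L T a b : ℝ} (hL : 0 ≤ L)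
    (hab : a ≤ b) (hp : ∀ u ∈ Icc a b, S.HorizontalSpeedLE p u L)
    (ht : ∀ u ∈ Icc a b, Ta < (p u).2 ∧ (p u).2 < T)
    (hs : S.Survives (p a).2 T (p a).1) : S.Survives (p b).2 T (p b).1 := by
  set s : Set ℝ := {u | ∀ v ∈ Icc a u, S.Survives (p v).2 T (p v).1} with hsdef
  have hsub : Icc a b ⊆ s := by
    refine IsClosed.Icc_subset_of_forall_exists_gt (isClosed_of_closure_subset fun x hx => ?_)
      ?_ ?_
    · have hxI : x ∈ Icc a b := by
        have := closure_mono (inter_subset_right (s := s) (t := Icc a b)) hx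
        rwa [isClosed_Icc.closure_eq] at this
      refine ⟨?_, hxI⟩
      have hbefore : ∀ v ∈ Ico a x, S.Survives (p v).2 T (p v).1 := by
        intro v hv
        have h1 : ∃ᶠ u in 𝓝 x, u ∈ s ∩ Icc a b := mem_closure_iff_frequently.1 hx
        obtain ⟨u, ⟨hu, -⟩, hvu⟩ := (h1.and_eventually (Ioi_mem_nhds hv.2)).exists
        exact hu v ⟨hv.1, (mem_Ioi.1 hvu).le⟩
      intro v hv
      rcases hv.2.lt_or_eq with h | rfl
      · exact hbefore v ⟨hv.1, h⟩
      · rcases hv.1.lt_or_eq with h | rfl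
        · exact survives_of_forall_Ico hS hk hL
            (fun u hu => hp u ⟨hu.1, hu.2.trans hxI.2⟩)
            (fun u hu => ht u ⟨hu.1, hu.2.trans hxI.2⟩) hbefore h
        · exact hs
    · intro v hv
      rwa [show v = a from le_antisymm hv.2 hv.1]
    · rintro x ⟨hxs, hxI⟩ y hxy
      have hxI' := Ico_subset_Icc_self hxI
      have hev := (chordLE_flow_path hk (hp x hxI') hL (ht x hxI').1 (ht x hxI').2
        (hxs x ⟨hxI.1, le_rfl⟩)).1
      obtain ⟨ε, hε, hball⟩ := Metric.mem_nhds_iff.1 hev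
      rw [Real.ball_eq_Ioo] at hball
      refine ⟨min y (x + ε / 2), fun v hv => ?_, lt_min hxy (by linarith), min_le_left _ _⟩
      rcases le_or_gt v x with h | h
      · exact hxs v ⟨hv.1, h⟩
      · exact hball ⟨by linarith, by linarith [hv.2.trans (min_le_right _ _)]⟩
  exact hsub (right_mem_Icc.2 hab) b (right_mem_Icc.2 hab)

/-- Normal curves are defined for all later times. -/
theorem survives_of_lt [T2Space M] {S : SplitMetric n M t₀} (hS : S.SliceComplete)
    {Ta : ℝ} {k : ℝ → ℝ} (hk : S.CurvatureBound Ta k) {t T : ℝ} (ht : Ta < t) (htT : t < T)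
    (z : M) : S.Survives t T z := by
  have hT0 : t₀ < T := hk.1.trans (ht.trans htT)
  obtain ⟨W, hW, ε, hε, hbox⟩ := S.exists_flow_box' hT0 (W' := univ) (q := z) univ_mem
  have hzW := mem_of_mem_nhds hW
  rcases lt_or_ge (T - ε) t with h | h
  · exact (hbox z hzW t ⟨h, by linarith⟩ T ⟨by linarith, by linarith⟩).1
  -- the vertical path through `z`, traversed backwards in time from a time close to `T`
  set p : ℝ → M × ℝ := fun u => (z, T - u) with hp
  set a := ε / 2 with ha
  have hab : a ≤ T - t := by linarith
  set φ := extChartAt (𝓡 n) z with hφ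
  have hzs : z ∈ φ.source := mem_extChartAt_source z
  have hdom : ∀ u ∈ Icc a (T - t), ((φ z, T - u) : 𝓔 × ℝ) ∈ S.chartDom z := fun u hu =>
    ⟨φ.map_source hzs, by
      have h1 : t₀ < t := hk.1.trans ht
      have h2 := hu.2
      exact mem_Ioi.2 (by linarith)⟩
  have hcont : ContinuousOn (fun u => S.metricC z (φ z, T - u) (S.shiftC z (φ z, T - u))
      (S.shiftC z (φ z, T - u))) (Icc a (T - t)) := by
    intro u hu
    have h0 : ContinuousAt (fun u : ℝ => ((φ z, T - u) : 𝓔 × ℝ)) u := by fun_prop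
    have h1 : ContinuousAt (fun u : ℝ => S.metricC z (φ z, T - u)) u :=
      ContinuousAt.comp (g := S.metricC z) (f := fun u : ℝ => ((φ z, T - u) : 𝓔 × ℝ))
        (S.contDiffAt_metricC (hdom u hu)).continuousAt h0
    have h2 : ContinuousAt (fun u : ℝ => S.shiftC z (φ z, T - u)) u :=
      ContinuousAt.comp (g := S.shiftC z) (f := fun u : ℝ => ((φ z, T - u) : 𝓔 × ℝ))
        (S.contDiffAt_shiftC (hdom u hu)).continuousAt h0
    exact ContinuousAt.continuousWithinAt (h1.tendsto.bilin_apply_self h2.tendsto)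
  obtain ⟨C, hC⟩ := isCompact_Icc.bddAbove_image hcont
  have hspeed : ∀ u ∈ Icc a (T - t), S.HorizontalSpeedLE p u (|C| + 1) := by
    intro u hu
    refine ⟨by fun_prop, ((0 : 𝓔), (-1 : ℝ)), ?_, ?_⟩
    · have h1 : HasDerivAt (fun u : ℝ => T - u) (-1) u := by
        simpa using! (hasDerivAt_id u).const_sub T
      exact (hasDerivAt_const u (φ z)).prodMk h1
    · have h1 := hC (mem_image_of_mem _ hu)
      have h2 : horizontal (S.shiftC z (φ z, T - u)) ((0 : 𝓔), (-1 : ℝ))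
          = -S.shiftC z (φ z, T - u) := by simp [horizontal_apply]
      change S.metricC z (φ z, T - u) (horizontal (S.shiftC z (φ z, T - u)) ((0 : 𝓔), (-1 : ℝ)))
        (horizontal (S.shiftC z (φ z, T - u)) ((0 : 𝓔), (-1 : ℝ))) ≤ _
      rw [h2]
      simp only [map_neg, neg_apply, neg_neg]
      refine h1.trans ((le_abs_self C).trans ?_)
      nlinarith [abs_nonneg C]
  have h := survives_of_path hS hk (T := T) (by positivity) hab hspeed (fun u hu =>
    ⟨by have := hu.2; simp only [hp]; linarith, by have := hu.1; simp only [hp]; linarith⟩)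
    (hbox z hzW (T - a) ⟨by linarith, by linarith⟩ T ⟨by linarith, by linarith⟩).1
  simpa [hp] using h

/-- A path with bounded horizontal speed converges when its time tends to a finite limit. -/
theorem exists_tendsto_of_horizontalSpeedLE [T2Space M] {S : SplitMetric n M t₀}
    (hS : S.SliceComplete) {Ta : ℝ} {k : ℝ → ℝ} (hk : S.CurvatureBound Ta k) {p : ℝ → M × ℝ}
    {L T a b : ℝ} (hL : 0 ≤ L) (hab : a < b) (hp : ∀ u ∈ Ico a b, S.HorizontalSpeedLE p u L)
    (ht : ∀ u ∈ Ico a b, Ta < (p u).2 ∧ (p u).2 < T)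
    (hT : Tendsto (fun u => (p u).2) (𝓝[<] b) (𝓝 T)) :
    ∃ q, Tendsto (fun u => (p u).1) (𝓝[<] b) (𝓝 q) := by
  have hs : ∀ u ∈ Ico a b, S.Survives (p u).2 T (p u).1 := fun u hu =>
    survives_of_lt hS hk (ht u hu).1 (ht u hu).2 _
  have hT0 : t₀ < T := hk.1.trans ((ht a ⟨le_rfl, hab⟩).1.trans (ht a ⟨le_rfl, hab⟩).2)
  obtain ⟨q, hq⟩ := exists_tendsto_flow hS hk hL hp ht hs hab
  refine ⟨q, fun W' hW' => ?_⟩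
  obtain ⟨W, hW, ε, hε, hbox⟩ := S.exists_flow_box' hT0 hW'
  change ∀ᶠ u in 𝓝[<] b, (p u).1 ∈ W'
  filter_upwards [hq.eventually_mem hW, Ico_mem_nhdsLT hab,
    hT.eventually_mem (Ioo_mem_nhds (by linarith : T - ε < T) (by linarith : T < T + ε))]
    with u h1 h2 h3
  have h4 := (hbox _ h1 T ⟨by linarith, by linarith⟩ (p u).2 h3).2
  rwa [(hs u h2).symm.2] at h4

end SplitMetric

/-! ### The geodesic spray of a nondegenerate form -/

section Spray

variable {F : Type*} [NormedAddCommGroup F] [NormedSpace ℝ F]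

/-- The linear form `w ↦ [v v, w]`, for the Christoffel symbols of the first kind of `B`. -/
def sprayForm (B : F → F →L[ℝ] F →L[ℝ] ℝ) (z v : F) : F →L[ℝ] ℝ :=
  fderiv ℝ B z v v - (1 / 2 : ℝ) • ((fderiv ℝ B z).flip v).flip v

theorem sprayForm_apply (B : F → F →L[ℝ] F →L[ℝ] ℝ) (z v w : F) :
    sprayForm B z v w = christoffelForm B z v v w := by
  simp only [sprayForm, christoffelForm, sub_apply, smul_apply, ContinuousLinearMap.flip_apply,
    smul_eq_mul]
  ring

/-- The geodesic equation of the form `B` as a first order system for the position and the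
velocity. -/
def spray (B : F → F →L[ℝ] F →L[ℝ] ℝ) (y : F × F) : F × F :=
  (y.2, -(B y.1).inverse (sprayForm B y.1 y.2))

theorem isInvertible_of_ker [FiniteDimensional ℝ F] {b : F →L[ℝ] F →L[ℝ] ℝ}
    (hb : ∀ u, b u = 0 → u = 0) : b.IsInvertible := by
  have hinj : Function.Injective (b : F →ₗ[ℝ] F →L[ℝ] ℝ) :=
    (injective_iff_map_eq_zero (b : F →ₗ[ℝ] F →L[ℝ] ℝ)).2 hb
  have hdim : Module.finrank ℝ F = Module.finrank ℝ (F →L[ℝ] ℝ) := by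
    rw [← (LinearMap.toContinuousLinearMap (𝕜 := ℝ) (E := F) (F' := ℝ)).finrank_eq]
    exact Subspace.dual_finrank_eq.symm
  exact ⟨(LinearMap.linearEquivOfInjective (b : F →ₗ[ℝ] F →L[ℝ] ℝ) hinj
    hdim).toContinuousLinearEquiv, by ext; rfl⟩

theorem form_spray {B : F → F →L[ℝ] F →L[ℝ] ℝ} {y : F × F} (hB : (B y.1).IsInvertible) (w : F) :
    B y.1 (spray B y).2 w + christoffelForm B y.1 y.2 y.2 w = 0 := by
  rw [spray, map_neg, hB.self_apply_inverse, neg_apply, sprayForm_apply, neg_add_cancel]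

theorem eq_spray_snd {B : F → F →L[ℝ] F →L[ℝ] ℝ} {z v a : F} (hB : (B z).IsInvertible)
    (h : ∀ w, B z a w + christoffelForm B z v v w = 0) : a = (spray B (z, v)).2 := by
  refine hB.injective ?_
  ext w
  linarith [h w, form_spray (y := (z, v)) hB w]

theorem contDiffAt_fderiv_apply {G : Type*} [NormedAddCommGroup G] [NormedSpace ℝ G] {f : F → G}
    {y : F × F} (hf : ContDiffAt ℝ ∞ f y.1) :
    ContDiffAt ℝ 1 (fun x : F × F => fderiv ℝ f x.1 x.2) y :=
  (ContDiffAt.comp (g := fderiv ℝ f) (f := Prod.fst) y (hf.fderiv_right (m := 1) (by norm_cast))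
    contDiffAt_fst).clm_apply contDiffAt_snd

/-- The derivative of `z ↦ B z v v` is a partial derivative of `(z, v) ↦ B z v v`, and therefore
depends smoothly on `(z, v)`. -/
theorem contDiffAt_fderiv_flip_apply {B : F → F →L[ℝ] F →L[ℝ] ℝ} {y : F × F}
    (hB : ContDiffAt ℝ ∞ B y.1) :
    ContDiffAt ℝ 1 (fun x : F × F => ((fderiv ℝ B x.1).flip x.2).flip x.2) y := by
  set f : F × F → ℝ := fun x => B x.1 x.2 x.2 with hf
  have hfs : ∀ x : F × F, ContDiffAt ℝ ∞ B x.1 → ContDiffAt ℝ ∞ f x := fun x hx =>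
    ((ContDiffAt.comp (g := B) (f := Prod.fst) x hx contDiffAt_fst).clm_apply
      contDiffAt_snd).clm_apply contDiffAt_snd
  have h1 : ContDiffAt ℝ 1 (fun x => (fderiv ℝ f x).comp (ContinuousLinearMap.inl ℝ F F)) y :=
    ((hfs y hB).fderiv_right (m := 1) (by norm_cast)).clm_comp contDiffAt_const
  refine h1.congr_of_eventuallyEq ?_
  have h2 : ∀ᶠ x : F × F in 𝓝 y, ContDiffAt ℝ 1 B x.1 :=
    continuous_fst.continuousAt.eventually ((hB.of_le (by norm_cast)).eventually (by norm_num))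
  have h3 : ∀ᶠ x : F × F in 𝓝 y, ContDiffAt ℝ 1 f x :=
    ((hfs y hB).of_le (by norm_cast)).eventually (by norm_num)
  filter_upwards [h2, h3] with x hx hx'
  refine (hasFDerivAt_form_apply (hx.differentiableAt (by norm_num)) x.2 x.2).unique ?_
  exact HasFDerivAt.comp (g := f) (f := fun z => (z, x.2)) x.1
    (hx'.differentiableAt (by norm_num)).hasFDerivAt (hasFDerivAt_prodMk_left x.1 x.2)

set_option synthInstance.maxHeartbeats 200000 in
theorem contDiffAt_spray [FiniteDimensional ℝ F] {B : F → F →L[ℝ] F →L[ℝ] ℝ} {y : F × F}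
    (hB : ContDiffAt ℝ ∞ B y.1) (hi : (B y.1).IsInvertible) : ContDiffAt ℝ 1 (spray B) y := by
  have hB1 : ContDiffAt ℝ 1 B y.1 := hB.of_le (by norm_cast)
  have h2 : ContDiffAt ℝ 1 (fun x : F × F => x.2) y := contDiffAt_snd
  have e1 : ContDiffAt ℝ 1 (fun x : F × F => fderiv ℝ B x.1 x.2 x.2) y :=
    (contDiffAt_fderiv_apply hB).clm_apply h2
  have e3 : ContDiffAt ℝ 1 (fun x : F × F => ((fderiv ℝ B x.1).flip x.2).flip x.2) y :=
    contDiffAt_fderiv_flip_apply hB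
  have e4 : ContDiffAt ℝ 1 (fun x : F × F => sprayForm B x.1 x.2) y :=
    e1.sub (e3.const_smul (1 / 2 : ℝ))
  have e5 : ContDiffAt ℝ 1 (fun x : F × F => (B x.1).inverse) y :=
    ContDiffAt.comp (g := ContinuousLinearMap.inverse) (f := fun x : F × F => B x.1) y
      hi.contDiffAt_map_inverse
      (ContDiffAt.comp (g := B) (f := Prod.fst) y hB1 contDiffAt_fst)
  exact h2.prodMk (e5.clm_apply e4).neg

/-- The velocity of a geodesic has constant square. -/
theorem hasDerivAt_form_self {B : F → F →L[ℝ] F →L[ℝ] ℝ} {y : ℝ → F × F} {s : ℝ}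
    (hB : DifferentiableAt ℝ B (y s).1) (hi : (B (y s).1).IsInvertible)
    (hsymm : ∀ u v, B (y s).1 u v = B (y s).1 v u) (hy : HasDerivAt y (spray B (y s)) s) :
    HasDerivAt (fun r => B (y r).1 (y r).2 (y r).2) 0 s := by
  have h1 : HasDerivAt (fun r => (y r).1) (y s).2 s :=
    HasFDerivAt.comp_hasDerivAt (l := Prod.fst) (f := y) s hasFDerivAt_fst hy
  have h2 : HasDerivAt (fun r => (y r).2) (spray B (y s)).2 s :=
    HasFDerivAt.comp_hasDerivAt (l := Prod.snd) (f := y) s hasFDerivAt_snd hy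
  have h3 : HasDerivAt (fun r => B (y r).1) (fderiv ℝ B (y s).1 (y s).2) s :=
    HasFDerivAt.comp_hasDerivAt (l := B) (f := fun r => (y r).1) s hB.hasFDerivAt h1
  have h4 := (h3.clm_apply h2).clm_apply h2
  have h5 := form_spray hi (y s).2
  rw [christoffelForm_self] at h5
  refine h4.congr_deriv ?_
  rw [add_apply, hsymm (y s).2 (spray B (y s)).2]
  linarith

end Spray

/-! ### Continuation of solutions of autonomous systems -/

section Continuation

variable {X : Type*} [NormedAddCommGroup X] [NormedSpace ℝ X] [FiniteDimensional ℝ X]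

/-- A solution of a system of class `C¹` which stays in a compact set can be continued. -/
theorem exists_extend_solution {Φ : X → X} {K : Set X} (hK : IsCompact K)
    (hΦ : ∀ x ∈ K, ContDiffAt ℝ 1 Φ x) {y : ℝ → X} {a b : ℝ} (hab : a < b)
    (hy : ∀ s ∈ Ioo a b, HasDerivAt y (Φ (y s)) s) (hyK : ∀ s ∈ Ioo a b, y s ∈ K) :
    ∃ ε > 0, ∃ y' : ℝ → X, y' b ∈ K ∧ EqOn y' y (Ioo a b) ∧
      ∀ s ∈ Ioo a (b + ε), HasDerivAt y' (Φ (y' s)) s := by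
  have hcont : ContinuousOn Φ K := fun x hx => (hΦ x hx).continuousAt.continuousWithinAt
  obtain ⟨C, hC⟩ := hK.exists_bound_of_continuousOn hcont
  have hlip : LipschitzOnWith C.toNNReal y (Ioo a b) :=
    (convex_Ioo a b).lipschitzOnWith_of_nnnorm_hasDerivWithin_le
      (fun s hs => (hy s hs).hasDerivWithinAt) fun s hs => by
        rw [← NNReal.coe_le_coe, coe_nnnorm]
        exact (hC _ (hyK s hs)).trans (Real.le_coe_toNNReal C)
  obtain ⟨g, hg, hgy⟩ := hlip.extend_finite_dimension
  have hlim : Tendsto y (𝓝[<] b) (𝓝 (g b)) := by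
    refine (hg.continuous.continuousAt.tendsto.mono_left nhdsWithin_le_nhds).congr' ?_
    filter_upwards [Ioo_mem_nhdsLT hab] with s hs using (hgy hs).symm
  have hxK : g b ∈ K := hK.isClosed.mem_of_tendsto hlim (by
    filter_upwards [Ioo_mem_nhdsLT hab] with s hs using hyK s hs)
  obtain ⟨α, hα, ε, hε, hαd⟩ :=
    (hΦ _ hxK).exists_forall_mem_closedBall_exists_eq_forall_mem_Ioo_hasDerivAt₀ b
  set y' : ℝ → X := fun s => if s < b then y s else α s with hy'
  have hlt : ∀ s, s < b → y' s = y s := fun s hs => if_pos hs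
  have hge : ∀ s, b ≤ s → y' s = α s := fun s hs => if_neg hs.not_gt
  have hb : y' b = g b := (hge b le_rfl).trans hα
  have hder : ∀ s ∈ Ioo a b, HasDerivAt y' (Φ (y' s)) s := fun s hs => by
    rw [hlt s hs.2]
    refine (hy s hs).congr_of_eventuallyEq ?_
    filter_upwards [Iio_mem_nhds hs.2] with r hr using hlt r hr
  have hlim' : Tendsto y' (𝓝[<] b) (𝓝 (y' b)) := by
    rw [hb]
    refine hlim.congr' ?_
    filter_upwards [self_mem_nhdsWithin] with s hs using (hlt s hs).symm
  refine ⟨ε, hε, y', hb ▸ hxK, fun s hs => hlt s hs.2, fun s hs => ?_⟩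
  rcases lt_trichotomy s b with h | rfl | h
  · exact hder s ⟨hs.1, h⟩
  · have hleft : HasDerivWithinAt y' (Φ (y' s)) (Iic s) s := by
      refine hasDerivWithinAt_Iic_of_tendsto_deriv
        (fun r hr => (hder r hr).differentiableAt.differentiableWithinAt)
        (hlim'.mono_left (nhdsWithin_mono _ fun r hr => hr.2)) (Ioo_mem_nhdsLT hab) ?_
      have h1 : Tendsto (fun r => Φ (y' r)) (𝓝[<] s) (𝓝 (Φ (y' s))) :=
        ((hΦ _ (hb ▸ hxK)).continuousAt.tendsto).comp hlim'
      refine h1.congr' ?_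
      filter_upwards [Ioo_mem_nhdsLT hab] with r hr using (hder r hr).deriv.symm
    have hright : HasDerivWithinAt y' (Φ (y' s)) (Ici s) s := by
      rw [hge s le_rfl]
      exact (hαd s ⟨by linarith, by linarith⟩).hasDerivWithinAt.congr (fun r hr => hge r hr)
        (hge s le_rfl)
    have := hleft.union hright
    rwa [Iic_union_Ici, hasDerivWithinAt_univ] at this
  · rw [hge s h.le]
    refine (hαd s ⟨by linarith, hs.2⟩).congr_of_eventuallyEq ?_
    filter_upwards [Ioi_mem_nhds h] with r hr using hge r (le_of_lt hr)

/-- A solution of a system of class `C¹` is of class `C²`. -/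
theorem contDiffOn_two_of_solution {Φ : X → X} {y : ℝ → X} {I : Set ℝ} (hI : IsOpen I)
    (hΦ : ∀ s ∈ I, ContDiffAt ℝ 1 Φ (y s)) (hy : ∀ s ∈ I, HasDerivAt y (Φ (y s)) s) :
    ContDiffOn ℝ 2 y I := by
  have hd : EqOn (deriv y) (Φ ∘ y) I := fun s hs => (hy s hs).deriv
  have hdiff : DifferentiableOn ℝ y I := fun s hs =>
    (hy s hs).differentiableAt.differentiableWithinAt
  have h1 : ContDiffOn ℝ 1 y I := by
    rw [show (1 : WithTop ℕ∞) = 0 + 1 by norm_num, contDiffOn_succ_iff_deriv_of_isOpen hI]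
    refine ⟨hdiff, by simp, contDiffOn_zero.2 (ContinuousOn.congr (fun s hs => ?_) hd)⟩
    exact ((hΦ s hs).continuousAt.comp (hy s hs).continuousAt).continuousWithinAt
  rw [show (2 : WithTop ℕ∞) = 1 + 1 by norm_num, contDiffOn_succ_iff_deriv_of_isOpen hI]
  refine ⟨hdiff, by simp, ContDiffOn.congr (fun s hs => ?_) hd⟩
  exact (hΦ s hs).comp_contDiffWithinAt s (h1 s hs)

end Continuation

namespace SplitMetric

variable {n : ℕ} {M : Type*} [TopologicalSpace M]
  [ChartedSpace (EuclideanSpace ℝ (Fin n)) M] [IsManifold (𝓡 n) ∞ M] {t₀ : ℝ}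

local notation "𝓔" => EuclideanSpace ℝ (Fin n)

/-! ### Geodesics in charts -/

/-- The curve `c`, defined on `J`, satisfies at `s` all the conditions on a future-directed geodesic
whose velocity has a square with the property `κ`. The conditions are stated in charts, and depend
only on the germ of `c` and `J` at `s`. -/
def GeodesicAt (S : SplitMetric n M t₀) (κ : ℝ → Prop) (c : ℝ → M × ℝ) (J : Set ℝ) (s : ℝ) :
    Prop :=
  t₀ < (c s).2 ∧ ContMDiffWithinAt 𝓘(ℝ, ℝ) ((𝓡 n).prod 𝓘(ℝ, ℝ)) 2 c J s ∧
  ∀ x₀ : M, (c s).1 ∈ (extChartAt (𝓡 n) x₀).source →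
    (∀ w, S.lorentzC x₀ (curveC n x₀ c s) (derivWithin (derivWithin (curveC n x₀ c) J) J s) w
      + christoffelForm (S.lorentzC x₀) (curveC n x₀ c s) (derivWithin (curveC n x₀ c) J s)
        (derivWithin (curveC n x₀ c) J s) w = 0) ∧
    κ (S.lorentzC x₀ (curveC n x₀ c s) (derivWithin (curveC n x₀ c) J s)
      (derivWithin (curveC n x₀ c) J s)) ∧
    0 < (derivWithin (curveC n x₀ c) J s).2

theorem forall_geodesicAt_iff {S : SplitMetric n M t₀} {κ : ℝ → Prop} {c : ℝ → M × ℝ} {J : Set ℝ}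
    (hJ : UniqueDiffOn ℝ J) : (∀ s ∈ J, S.GeodesicAt κ c J s) ↔
      S.IsSpacetimeGeodesicOn c J ∧ ∀ s ∈ J,
        κ (S.spacetimeMetric (c s) (curveVelocity ((𝓡 n).prod 𝓘(ℝ, ℝ)) c J s)
          (curveVelocity ((𝓡 n).prod 𝓘(ℝ, ℝ)) c J s)) ∧ 0 < timeRate c J s := by
  constructor
  · intro h
    refine ⟨⟨fun s hs => (h s hs).1, fun s hs => (h s hs).2.1, fun s hs p₀ hp₀ => ?_⟩,
      fun s hs => ?_⟩
    · intro ξ w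
      have hs' := mem_extChartAt_prod_source.1 hp₀
      have hm := S.curveC_mem (h s hs).1 hs'
      have h' := ((h s hs).2.2 p₀.1 hs').1 w
      have hξ : ξ = curveC n p₀.1 c := extChartAt_prod_curve p₀ c
      clear_value ξ
      subst hξ
      exact (congrArg₂ (· + ·) (S.metricInChart_eq p₀ hm.1 _ _)
        (S.christoffelFirst_eq p₀ hm _ _ _)).trans h'
    · obtain ⟨h1, h2, h3⟩ := h s hs
      have hself : (c s).1 ∈ (extChartAt (𝓡 n) (c s).1).source := mem_extChartAt_source _
      rw [timeRate_eq (hJ s hs) h2 hself, S.spacetimeMetric_curveVelocity (hJ s hs) h1 h2 hself]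
      exact (h3 _ hself).2
  · rintro ⟨h, h'⟩ s hs
    have h2 := h.2.1 s hs
    refine ⟨h.1 s hs, h2, fun x₀ hx₀ => ⟨S.geodesic_equation h hs hx₀, ?_⟩⟩
    rw [← timeRate_eq (hJ s hs) h2 hx₀, ← S.spacetimeMetric_curveVelocity (hJ s hs) (h.1 s hs) h2 hx₀]
    exact h' s hs

theorem GeodesicAt.congr {S : SplitMetric n M t₀} {κ : ℝ → Prop} {c c' : ℝ → M × ℝ} {J : Set ℝ}
    {s : ℝ} (h : S.GeodesicAt κ c J s) (hs : s ∈ J) (hc : c' =ᶠ[𝓝[J] s] c) :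
    S.GeodesicAt κ c' J s := by
  have h0 : c' s = c s := hc.self_of_nhdsWithin hs
  have h1 : ∀ x₀ : M, curveC n x₀ c' =ᶠ[𝓝[J] s] curveC n x₀ c := fun x₀ => by
    filter_upwards [hc] with r hr
    simp only [curveC, hr]
  have h2 : ∀ x₀ : M, curveC n x₀ c' s = curveC n x₀ c s := fun x₀ => by simp only [curveC, h0]
  refine ⟨h0 ▸ h.1, h.2.1.congr_of_eventuallyEq hc h0, fun x₀ hx₀ => ?_⟩
  rw [h0] at hx₀
  rw [(h1 x₀).derivWithin.derivWithin_eq_of_mem hs, (h1 x₀).derivWithin_eq (h2 x₀), h2]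
  exact h.2.2 x₀ hx₀

theorem GeodesicAt.congr_set {S : SplitMetric n M t₀} {κ : ℝ → Prop} {c : ℝ → M × ℝ} {J J' : Set ℝ}
    {s : ℝ} (h : S.GeodesicAt κ c J s) (hJ : J' =ᶠ[𝓝 s] J) : S.GeodesicAt κ c J' s := by
  have h1 : ∀ f : ℝ → 𝓔 × ℝ, derivWithin f J' =ᶠ[𝓝 s] derivWithin f J := fun f => by
    filter_upwards [hJ.eventuallyEq_nhds] with r hr using derivWithin_congr_set hr
  refine ⟨h.1, h.2.1.congr_set hJ.symm, fun x₀ hx₀ => ?_⟩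
  rw [(h1 _).derivWithin_eq_of_nhds, derivWithin_congr_set hJ, derivWithin_congr_set hJ]
  exact h.2.2 x₀ hx₀

theorem isInvertible_lorentzC {S : SplitMetric n M t₀} {x₀ : M} {z : 𝓔 × ℝ} (hz : z ∈ S.chartDom x₀)
    (hN : 0 < S.lapseC x₀ z) : (S.lorentzC x₀ z).IsInvertible := by
  refine isInvertible_of_ker fun u hu => ?_
  have h1 : u.2 = 0 := by
    have h := S.lorentzC_normalC x₀ z u
    rw [hu, zero_apply] at h
    have : (S.lapseC x₀ z) ^ 2 ≠ 0 := by positivity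
    rcases mul_eq_zero.1 h.symm with h | h
    · exact absurd (neg_eq_zero.1 h) this
    · exact h
  have h2 : u.1 = 0 := by
    by_contra hne
    have h := S.metricC_pos hz hne
    have h' := S.lorentzC_apply x₀ z u u
    rw [hu, zero_apply, h1] at h'
    simp only [zero_smul, add_zero, mul_zero, zero_add] at h'
    exact h.ne h'
  exact Prod.ext h2 h1

theorem surjective_fderiv_transitionT {S : SplitMetric n M t₀} {x₀ x₁ : M} {z : 𝓔 × ℝ}
    (hz : z ∈ S.overlap x₀ x₁) (hN : 0 < S.lapseC x₀ z) :
    Function.Surjective (fderiv ℝ (transitionT n x₀ x₁) z) := by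
  have hinj : Function.Injective (fderiv ℝ (transitionT n x₀ x₁) z : 𝓔 × ℝ →ₗ[ℝ] 𝓔 × ℝ) := by
    refine (injective_iff_map_eq_zero _).2 fun u hu => ?_
    refine (injective_iff_map_eq_zero _).1 (isInvertible_lorentzC hz.1 hN).injective u ?_
    refine ContinuousLinearMap.ext fun v => ?_
    have hu' : fderiv ℝ (transitionT n x₀ x₁) z u = 0 := hu
    rw [S.lorentzC_transitionT hz, hu', map_zero, zero_apply, zero_apply]
  exact LinearMap.injective_iff_surjective.1 hinj

/-- The curve with the coordinates `(y s).1` in the chart around `q`. -/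
def chartCurve (n : ℕ) {M : Type*} [TopologicalSpace M]
    [ChartedSpace (EuclideanSpace ℝ (Fin n)) M] (q : M)
    (y : ℝ → (EuclideanSpace ℝ (Fin n) × ℝ) × (EuclideanSpace ℝ (Fin n) × ℝ)) (s : ℝ) : M × ℝ :=
  ((extChartAt (𝓡 n) q).symm (y s).1.1, (y s).1.2)

/-- A solution of the geodesic equation in one chart is a geodesic. -/
theorem geodesicAt_chartCurve {S : SplitMetric n M t₀} {κ : ℝ → Prop} {q : M} {I : Set ℝ}
    (hI : IsOpen I) {y : ℝ → (𝓔 × ℝ) × (𝓔 × ℝ)} (hN : ∀ t, t₀ < t → ∀ x, 0 < S.lapse t x)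
    (hy : ∀ s ∈ I, HasDerivAt y (spray (S.lorentzC q) (y s)) s)
    (hdom : ∀ s ∈ I, (y s).1 ∈ S.chartDom q) (hpos : ∀ s ∈ I, 0 < (y s).2.2)
    (hκ : ∀ s ∈ I, κ (S.lorentzC q (y s).1 (y s).2 (y s).2)) {s : ℝ} (hs : s ∈ I) :
    S.GeodesicAt κ (chartCurve n q y) univ s := by
  have hinv : ∀ r ∈ I, (S.lorentzC q (y r).1).IsInvertible := fun r hr =>
    isInvertible_lorentzC (hdom r hr) (hN _ (hdom r hr).2 _)
  have hC2 : ContDiffAt ℝ 2 y s := (contDiffOn_two_of_solution hI (fun r hr =>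
    contDiffAt_spray (S.contDiffAt_lorentzC (hdom r hr)) (hinv r hr)) hy).contDiffAt (hI.mem_nhds hs)
  have hd1 : ∀ r ∈ I, HasDerivAt (fun r => (y r).1) (y r).2 r := fun r hr =>
    HasFDerivAt.comp_hasDerivAt (l := Prod.fst) (f := y) r hasFDerivAt_fst (hy r hr)
  have hd2 : HasDerivAt (fun r => (y r).2) (spray (S.lorentzC q) (y s)).2 s :=
    HasFDerivAt.comp_hasDerivAt (l := Prod.snd) (f := y) s hasFDerivAt_snd (hy s hs)
  refine ⟨(hdom s hs).2, ?_, fun x₁ hx₁ => ?_⟩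
  · have h1 : ContMDiffAt 𝓘(ℝ, ℝ) 𝓘(ℝ, 𝓔 × ℝ) 2 (fun r => (y r).1) s := hC2.fst.contMDiffAt
    have h2 := (contMDiffAt_chartInverse (n := n) (hdom s hs).1).of_le (m := 2) (by norm_cast)
    exact (ContMDiffAt.comp (f := fun r => (y r).1) s h2 h1).contMDiffWithinAt
  · set Ψ := transitionT n q x₁ with hΨ
    have hcurve : curveC n x₁ (chartCurve n q y) = fun r => Ψ (y r).1 := rfl
    have ho : (y s).1 ∈ S.overlap q x₁ := ⟨hdom s hs, hx₁⟩
    have hev : ∀ᶠ r in 𝓝 s, (y r).1 ∈ S.overlap q x₁ ∧ r ∈ I :=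
      ((hd1 s hs).continuousAt.eventually_mem (S.overlap_mem_nhds ho)).and (hI.mem_nhds hs)
    have e1 : ∀ r, (y r).1 ∈ S.overlap q x₁ → r ∈ I →
        HasDerivAt (fun r => Ψ (y r).1) (fderiv ℝ Ψ (y r).1 (y r).2) r := fun r hr hrI =>
      HasFDerivAt.comp_hasDerivAt (l := Ψ) (f := fun r => (y r).1) r
        ((S.contDiffAt_transitionT hr).differentiableAt (by simp)).hasFDerivAt (hd1 r hrI)
    have e2 : deriv (fun r => Ψ (y r).1) =ᶠ[𝓝 s] fun r => fderiv ℝ Ψ (y r).1 (y r).2 := by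
      filter_upwards [hev] with r hr using (e1 r hr.1 hr.2).deriv
    have hdΨ : DifferentiableAt ℝ (fderiv ℝ Ψ) (y s).1 :=
      ((S.contDiffAt_transitionT ho).fderiv_right (m := 1) (by norm_cast)).differentiableAt
        (by norm_num)
    have e3 : HasDerivAt (fun r => fderiv ℝ Ψ (y r).1) (fderiv ℝ (fderiv ℝ Ψ) (y s).1 (y s).2) s :=
      HasFDerivAt.comp_hasDerivAt (l := fderiv ℝ Ψ) (f := fun r => (y r).1) s hdΨ.hasFDerivAt
        (hd1 s hs)
    have e4 : deriv (deriv fun r => Ψ (y r).1) s = fderiv ℝ (fderiv ℝ Ψ) (y s).1 (y s).2 (y s).2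
        + fderiv ℝ Ψ (y s).1 (spray (S.lorentzC q) (y s)).2 :=
      ((e3.clm_apply hd2).congr_of_eventuallyEq e2).deriv
    simp only [derivWithin_univ, hcurve]
    have e5 : deriv (fun r => Ψ (y r).1) s = fderiv ℝ Ψ (y s).1 (y s).2 := e2.self_of_nhds
    rw [e4, e5]
    refine ⟨fun w => ?_, ?_, ?_⟩
    · obtain ⟨w, rfl⟩ := surjective_fderiv_transitionT ho (hN _ (hdom s hs).2 _) w
      have h1 := form_spray (hinv s hs) w
      rw [S.christoffelForm_transitionT ho, S.lorentzC_transitionT ho] at h1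
      rw [map_add, add_apply]
      linarith
    · rw [← S.lorentzC_transitionT ho]
      exact hκ s hs
    · rw [S.fderiv_transitionT ho]
      exact hpos s hs

/-! ### Continuation of causal geodesics -/

/-- The lapse is bounded above and below, and the gradient of the lapse and the extrinsic curvature
are bounded by integrable functions of time. -/
def HasIntegrableBounds (S : SplitMetric n M t₀) : Prop :=
  S.BoundedLapse ∧
  (∀ t₁, t₀ < t₁ → ∃ f : ℝ → ℝ, IntegrableOn f (Ici t₁) ∧
    ∀ t, t₁ ≤ t → ∀ x : M, S.normGradLapse t x ≤ f t) ∧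
  ∀ t₁, t₀ < t₁ → ∃ f : ℝ → ℝ, IntegrableOn f (Ici t₁) ∧
    ∀ t, t₁ ≤ t → ∀ x : M, S.normExtrinsicCurvature t x ≤ f t

/-- The energy of a causal geodesic varies at most by a constant factor. -/
theorem exists_timeRate_bounds {S : SplitMetric n M t₀} (hS : S.HasIntegrableBounds)
    {c : ℝ → M × ℝ} {J : Set ℝ} {a : ℝ} (hJ : UniqueDiffOn ℝ J)
    (hc : S.IsFutureCausalGeodesicOn c J) (ha : a ∈ J) (hJa : ∀ s ∈ J, a ≤ s ∧ Icc a s ⊆ J) :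
    ∃ τ > 0, ∃ C > 0, ∀ s ∈ J, τ ≤ timeRate c J s ∧ timeRate c J s ≤ C ∧ S.energy c J s ≤ C := by
  obtain ⟨⟨Nm, NM, hNm, hN⟩, hgrad, hcurv⟩ := hS
  obtain ⟨f₁, hf₁, h₁⟩ := hgrad (c a).2 (hc.1.1 a ha)
  obtain ⟨f₂, hf₂, h₂⟩ := hcurv (c a).2 (hc.1.1 a ha)
  have hN' : ∀ t, t₀ < t → ∀ x, 0 < S.lapse t x ∧ S.lapse t x ≤ NM := fun t ht x =>
    ⟨hNm.trans_le (hN t ht x).1, (hN t ht x).2⟩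
  set D := ∫ t in Ici (c a).2, (f₁ t + NM * f₂ t) with hD
  have hepos : ∀ s ∈ J, 0 < S.energy c J s := fun s hs =>
    mul_pos (hN' _ (hc.1.1 s hs) _).1 (hc.2 s hs).2
  set e := S.energy c J a with he
  have hea : 0 < e := hepos a ha
  have hNMp : 0 < NM := (hN' _ (hc.1.1 a ha) (c a).1).1.trans_le (hN' _ (hc.1.1 a ha) (c a).1).2
  have hbound : ∀ s ∈ J, e * Real.exp (-D) ≤ S.energy c J s ∧ S.energy c J s ≤ e * Real.exp D := by
    intro s hs
    have h := abs_le.1 (S.abs_log_energy_le hN' hJ hc (hJa s hs).1 (hJa s hs).2 hf₁ hf₂ h₁ h₂)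
    rw [← Real.exp_log (hepos s hs), ← Real.exp_log hea, ← Real.exp_add, ← Real.exp_add]
    rw [← hD, ← he] at h
    exact ⟨Real.exp_le_exp.2 (by linarith [h.1]), Real.exp_le_exp.2 (by linarith [h.2])⟩
  refine ⟨e * Real.exp (-D) / NM, by positivity, e * Real.exp D * (1 + 1 / Nm), by positivity,
    fun s hs => ⟨?_, ?_, ?_⟩⟩
  · rw [div_le_iff₀ hNMp]
    refine (hbound s hs).1.trans ?_
    rw [energy, mul_comm]
    exact mul_le_mul_of_nonneg_left (hN' _ (hc.1.1 s hs) _).2 (hc.2 s hs).2.le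
  · have h1 : Nm * timeRate c J s ≤ e * Real.exp D :=
      (mul_le_mul_of_nonneg_right (hN _ (hc.1.1 s hs) _).1 (hc.2 s hs).2.le).trans (hbound s hs).2
    have h2 : timeRate c J s ≤ e * Real.exp D / Nm := by
      rw [le_div_iff₀ hNm]; linarith
    have h3 : 0 < e * Real.exp D := by positivity
    calc timeRate c J s ≤ e * Real.exp D / Nm := h2
      _ ≤ e * Real.exp D + e * Real.exp D / Nm := by linarith
      _ = _ := by ring
  · refine (hbound s hs).2.trans (le_mul_of_one_le_right (by positivity) ?_)
    have : 0 < 1 / Nm := by positivity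
    linarith

theorem exists_curvatureBound {S : SplitMetric n M t₀} (hS : S.HasIntegrableBounds) {Ta : ℝ}
    (hTa : t₀ < Ta) : ∃ k, S.CurvatureBound Ta k := by
  obtain ⟨⟨Nm, NM, hNm, hN⟩, -, hcurv⟩ := hS
  obtain ⟨f, hf, h⟩ := hcurv Ta hTa
  refine ⟨fun t => NM * f t, hTa, hf.const_mul NM, fun r hr p => ?_⟩
  have h1 := hN r (hTa.trans_le hr) p
  have h2 : 0 ≤ S.normExtrinsicCurvature r p := Real.sqrt_nonneg _
  exact ⟨hNm.trans_le h1.1, (mul_le_mul_of_nonneg_right h1.2 h2).trans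
    (mul_le_mul_of_nonneg_left (h r hr p) (hNm.le.trans (h1.1.trans h1.2)))⟩

/-- A causal geodesic defined on a bounded interval has an end point in the spacetime. -/
theorem exists_tendsto_of_causal [T2Space M] {S : SplitMetric n M t₀} (hS : S.HasIntegrableBounds)
    (hslice : S.SliceComplete) {c : ℝ → M × ℝ} {a b : ℝ} (hab : a < b)
    (hc : S.IsFutureCausalGeodesicOn c (Ico a b)) :
    ∃ p : M × ℝ, t₀ < p.2 ∧ Tendsto c (𝓝[<] b) (𝓝 p) := by
  set J := Ico a b with hJdef
  have hJ : UniqueDiffOn ℝ J := uniqueDiffOn_Ico a b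
  have ha : a ∈ J := ⟨le_rfl, hab⟩
  obtain ⟨τ, hτ, C, hC, hbd⟩ := exists_timeRate_bounds hS hJ hc ha
    fun s hs => ⟨hs.1, Icc_subset_Ico_right hs.2⟩
  have hder : ∀ s ∈ J, HasDerivWithinAt (fun r => (c r).2) (timeRate c J s) J s := fun s hs => by
    rw [timeRate_eq (hJ s hs) (hc.1.2.1 s hs) (mem_extChartAt_source (I := 𝓡 n) (c s).1)]
    exact hasDerivWithinAt_time (hc.1.2.1 s hs)
  have hmono : StrictMonoOn (fun r => (c r).2) J := by
    refine strictMonoOn_of_deriv_pos (convex_Ico a b)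
      (fun s hs => (hder s hs).continuousWithinAt) fun s hs => ?_
    rw [interior_Ico] at hs
    rw [((hder s (Ioo_subset_Ico_self hs)).hasDerivAt (Ico_mem_nhds hs.1 hs.2)).deriv]
    exact hτ.trans_le (hbd s (Ioo_subset_Ico_self hs)).1
  have hlip : LipschitzOnWith C.toNNReal (fun r => (c r).2) J :=
    (convex_Ico a b).lipschitzOnWith_of_nnnorm_hasDerivWithin_le hder fun s hs => by
      rw [← NNReal.coe_le_coe, coe_nnnorm, Real.norm_eq_abs, abs_of_pos (hc.2 s hs).2]
      exact (hbd s hs).2.1.trans (Real.le_coe_toNNReal C)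
  obtain ⟨g, hg, hgc⟩ := hlip.extend_finite_dimension
  set T := g b with hT
  have hlim : Tendsto (fun r => (c r).2) (𝓝[<] b) (𝓝 T) := by
    refine (hg.continuous.continuousAt.tendsto.mono_left nhdsWithin_le_nhds).congr' ?_
    filter_upwards [Ico_mem_nhdsLT hab] with s hs using (hgc hs).symm
  have hltT : ∀ s ∈ J, (c s).2 < T := fun s hs => by
    have h1 : (s + b) / 2 ∈ J := ⟨by linarith [hs.1, hs.2], by linarith [hs.2]⟩
    refine (hmono hs h1 (by linarith [hs.2])).trans_le (ge_of_tendsto hlim ?_)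
    filter_upwards [Ico_mem_nhdsLT h1.2] with r hr
    exact hmono.monotoneOn h1 ⟨h1.1.trans hr.1, hr.2⟩ hr.1
  obtain ⟨k, hk⟩ := exists_curvatureBound hS (hc.1.1 a ha)
  obtain ⟨q, hq⟩ := exists_tendsto_of_horizontalSpeedLE hslice hk (p := c) (L := C) (T := T)
    (a := (a + b) / 2) (b := b) hC.le (by linarith) (fun u hu => by
      have huJ : u ∈ J := ⟨by linarith [hu.1], hu.2⟩
      have hnhds : J ∈ 𝓝 u := Ico_mem_nhds (by linarith [hu.1]) hu.2
      have hsrc := mem_extChartAt_source (I := 𝓡 n) (c u).1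
      have h1 := hc.1.2.1 u huJ
      refine ⟨(h1.contMDiffAt hnhds).continuousAt, _,
        (hasDerivWithinAt_curveC h1 hsrc).hasDerivAt hnhds,
        (S.metricC_horizontal_le hJ hc huJ hsrc).trans ?_⟩
      have h2 : 0 ≤ S.energy c J u := by
        obtain ⟨⟨Nm, NM, hNm, hN⟩, -⟩ := hS
        exact mul_nonneg (hNm.le.trans (hN _ (hc.1.1 u huJ) _).1) (hc.2 u huJ).2.le
      exact pow_le_pow_left₀ h2 (hbd u huJ).2.2 2)
    (fun u hu => by
      have huJ : u ∈ J := ⟨by linarith [hu.1], hu.2⟩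
      exact ⟨hmono ha huJ (by linarith [hu.1]), hltT u huJ⟩) hlim
  exact ⟨(q, T), (hc.1.1 a ha).trans (hltT a ha), hq.prodMk_nhds hlim⟩

/-- Near a limit point, the components of vectors in the chart are controlled by the energy. -/
theorem exists_norm_le_of_metricC_le {S : SplitMetric n M t₀} {q : M} {z₀ : 𝓔 × ℝ}
    (hz : z₀ ∈ S.chartDom q) (C : ℝ) : ∃ R : ℝ, ∀ᶠ z in 𝓝 z₀, ∀ v : 𝓔 × ℝ, |v.2| ≤ C →
      S.metricC q z (horizontal (S.shiftC q z) v) (horizontal (S.shiftC q z) v) ≤ C ^ 2 →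
      ‖v‖ ≤ R := by
  obtain ⟨m, hm, hlow⟩ := exists_eventually_le_bilin (S.contDiffAt_metricC hz).continuousAt
    fun v hv => S.metricC_pos hz hv
  have hup : ∀ᶠ z in 𝓝 z₀, ‖S.shiftC q z‖ < ‖S.shiftC q z₀‖ + 1 :=
    (S.contDiffAt_shiftC hz).continuousAt.norm.eventually_lt_const (lt_add_one _)
  set β := ‖S.shiftC q z₀‖ + 1 with hβ
  refine ⟨Real.sqrt (C ^ 2 / m) + C * β + C, ?_⟩
  filter_upwards [hlow, hup] with z h1 h2 v hv hh
  have hC : 0 ≤ C := (abs_nonneg _).trans hv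
  have hβ0 : 0 ≤ β := by positivity
  have h3 : ‖horizontal (S.shiftC q z) v‖ ≤ Real.sqrt (C ^ 2 / m) := by
    refine Real.le_sqrt_of_sq_le ?_
    rw [le_div_iff₀ hm, mul_comm]
    exact (h1 _).trans hh
  have h4 : v.1 = horizontal (S.shiftC q z) v - v.2 • S.shiftC q z := by
    rw [horizontal_apply, add_sub_cancel_right]
  have h5 : ‖v.2 • S.shiftC q z‖ ≤ C * β := by
    rw [norm_smul, Real.norm_eq_abs]
    exact mul_le_mul hv h2.le (norm_nonneg _) hC
  have h6 : ‖v.1‖ ≤ Real.sqrt (C ^ 2 / m) + C * β := by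
    rw [h4]
    exact (norm_sub_le _ _).trans (add_le_add h3 h5)
  rw [Prod.norm_def]
  refine max_le (by linarith) ?_
  rw [Real.norm_eq_abs]
  have : 0 ≤ C * β := by positivity
  linarith [Real.sqrt_nonneg (C ^ 2 / m)]

/-- A causal geodesic defined on a bounded interval can be continued. -/
theorem exists_continuation [T2Space M] {S : SplitMetric n M t₀} (hS : S.HasIntegrableBounds)
    (hslice : S.SliceComplete) {κ : ℝ → Prop} (hκ : ∀ x, κ x → x ≤ 0) {c : ℝ → M × ℝ} {a b : ℝ}
    (hab : a < b) (hc : ∀ s ∈ Ico a b, S.GeodesicAt κ c (Ico a b) s) :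
    ∃ b' > b, ∃ c' : ℝ → M × ℝ, (∀ s ∈ Ico a b', S.GeodesicAt κ c' (Ico a b') s) ∧
      EqOn c' c (Ico a b) := by
  set J := Ico a b with hJdef
  have hJ : UniqueDiffOn ℝ J := uniqueDiffOn_Ico a b
  have hN : ∀ t, t₀ < t → ∀ x, 0 < S.lapse t x := by
    obtain ⟨⟨Nm, NM, hNm, hN⟩, -⟩ := hS
    exact fun t ht x => hNm.trans_le (hN t ht x).1
  have hcaus : S.IsFutureCausalGeodesicOn c J := by
    obtain ⟨h1, h2⟩ := (forall_geodesicAt_iff hJ).1 hc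
    exact ⟨h1, fun s hs => ⟨hκ _ (h2 s hs).1, (h2 s hs).2⟩⟩
  have ha : a ∈ J := ⟨le_rfl, hab⟩
  obtain ⟨τ, hτ, C, hC, hbd⟩ := exists_timeRate_bounds hS hJ hcaus ha
    fun s hs => ⟨hs.1, Icc_subset_Ico_right hs.2⟩
  obtain ⟨⟨q, T⟩, hT, hlim⟩ := exists_tendsto_of_causal hS hslice hab hcaus
  -- all estimates hold in a small ball around the limit point, in the chart around `q`
  set z₀ : 𝓔 × ℝ := (extChartAt (𝓡 n) q q, T) with hz₀
  have hzd : z₀ ∈ S.chartDom q := S.chartPoint_mem hT q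
  obtain ⟨R, hR⟩ := exists_norm_le_of_metricC_le hzd C
  obtain ⟨r, hr, hball⟩ := Metric.nhds_basis_closedBall.mem_iff.1
    (inter_mem ((S.isOpen_chartDom q).mem_nhds hzd) hR)
  set K : Set ((𝓔 × ℝ) × (𝓔 × ℝ)) := Metric.closedBall z₀ r ×ˢ Metric.closedBall 0 R with hK
  have hKc : IsCompact K := (isCompact_closedBall _ _).prod (isCompact_closedBall _ _)
  have hΦ : ∀ y ∈ K, ContDiffAt ℝ 1 (spray (S.lorentzC q)) y := fun y hy =>
    contDiffAt_spray (S.contDiffAt_lorentzC (hball hy.1).1)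
      (isInvertible_lorentzC (hball hy.1).1 (hN _ (hball hy.1).1.2 _))
  have hlim1 : Tendsto (fun s => (c s).1) (𝓝[<] b) (𝓝 q) :=
    (continuous_fst.tendsto (q, T)).comp hlim
  have hlim2 : Tendsto (fun s => (c s).2) (𝓝[<] b) (𝓝 T) :=
    (continuous_snd.tendsto (q, T)).comp hlim
  have hξ : Tendsto (curveC n q c) (𝓝[<] b) (𝓝 z₀) :=
    ((continuousAt_extChartAt (I := 𝓡 n) q).tendsto.comp hlim1).prodMk_nhds hlim2
  obtain ⟨α, hα, hαb⟩ := (mem_nhdsLT_iff_exists_mem_Ico_Ioo_subset hab).1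
    (inter_mem (hlim1.eventually_mem (extChartAt_source_mem_nhds (I := 𝓡 n) q))
      (hξ.eventually_mem (Metric.closedBall_mem_nhds z₀ hr)))
  have hsub : Ioo α b ⊆ J := fun s hs => ⟨hα.1.trans hs.1.le, hs.2⟩
  have hnhds : ∀ s ∈ Ioo α b, J ∈ 𝓝 s := fun s hs => Ico_mem_nhds (hα.1.trans_lt hs.1) hs.2
  set y : ℝ → (𝓔 × ℝ) × (𝓔 × ℝ) := fun s => (curveC n q c s, derivWithin (curveC n q c) J s)
    with hy
  have hrate : ∀ s ∈ Ioo α b, timeRate c J s = (y s).2.2 := fun s hs =>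
    timeRate_eq (hJ s (hsub hs)) (hc s (hsub hs)).2.1 (hαb hs).1
  have hyK : ∀ s ∈ Ioo α b, y s ∈ K := fun s hs => by
    refine ⟨(hαb hs).2, mem_closedBall_zero_iff.2 ((hball (hαb hs).2).2 _ ?_ ?_)⟩
    · have h := hrate s hs
      simp only [hy] at h
      rw [← h, abs_of_pos (hcaus.2 s (hsub hs)).2]
      exact (hbd s (hsub hs)).2.1
    · refine (S.metricC_horizontal_le hJ hcaus (hsub hs) (hαb hs).1).trans ?_
      exact pow_le_pow_left₀ (mul_nonneg (hN _ (hc s (hsub hs)).1 _).le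
        (hcaus.2 s (hsub hs)).2.le) (hbd s (hsub hs)).2.2 2
  have hyd : ∀ s ∈ Ioo α b, HasDerivAt y (spray (S.lorentzC q) (y s)) s := fun s hs => by
    have hg := hc s (hsub hs)
    have h1 := (hasDerivWithinAt_curveC hg.2.1 (hαb hs).1).hasDerivAt (hnhds s hs)
    have h2 := (hasDerivWithinAt_derivWithin_curveC hJ (hsub hs) hg.2.1 (hαb hs).1).hasDerivAt
      (hnhds s hs)
    have hd := (hball (hyK s hs).1).1
    rw [eq_spray_snd (isInvertible_lorentzC hd (hN _ hd.2 _)) (hg.2.2 q (hαb hs).1).1] at h2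
    exact h1.prodMk h2
  obtain ⟨ε, hε, y', hyb, hyy, hyd'⟩ := exists_extend_solution hKc hΦ hα.2 hyd hyK
  have hcontb : ContinuousAt y' b := (hyd' b ⟨hα.2, by linarith⟩).continuousAt
  have hposb : 0 < (y' b).2.2 := by
    have h1 : Tendsto (fun s => (y' s).2.2) (𝓝[<] b) (𝓝 (y' b).2.2) :=
      (hcontb.snd.snd.tendsto).mono_left nhdsWithin_le_nhds
    refine hτ.trans_le (ge_of_tendsto h1 ?_)
    filter_upwards [Ioo_mem_nhdsLT hα.2] with s hs
    rw [hyy hs, ← hrate s hs]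
    exact (hbd s (hsub hs)).1
  have hgood : ∀ᶠ s in 𝓝 b, (y' s).1 ∈ S.chartDom q ∧ 0 < (y' s).2.2 :=
    (hcontb.fst.eventually_mem ((S.isOpen_chartDom q).mem_nhds (hball hyb.1).1)).and
      (hcontb.snd.snd.eventually_mem (Ioi_mem_nhds hposb))
  obtain ⟨δ, hδ, hδb⟩ := Metric.mem_nhds_iff.1 hgood
  rw [Real.ball_eq_Ioo] at hδb
  set b' := min (b + ε) (b + δ) with hb'
  have hbb' : b < b' := lt_min (by linarith) (by linarith)
  set I := Ioo α b' with hI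
  have hyI : ∀ s ∈ I, HasDerivAt y' (spray (S.lorentzC q) (y' s)) s := fun s hs =>
    hyd' s ⟨hs.1, hs.2.trans_le (min_le_left _ _)⟩
  have hgoodI : ∀ s ∈ I, (y' s).1 ∈ S.chartDom q ∧ 0 < (y' s).2.2 := fun s hs => by
    rcases lt_or_ge s b with h | h
    · rw [hyy ⟨hs.1, h⟩, ← hrate s ⟨hs.1, h⟩]
      exact ⟨(hball (hyK s ⟨hs.1, h⟩).1).1, (hcaus.2 s (hsub ⟨hs.1, h⟩)).2⟩
    · exact hδb ⟨by linarith, hs.2.trans_le (min_le_right _ _)⟩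
  -- the square of the velocity is constant
  have hsq : ∀ s ∈ I, HasDerivAt (fun r => S.lorentzC q (y' r).1 (y' r).2 (y' r).2) 0 s :=
    fun s hs => hasDerivAt_form_self (S.differentiableAt_lorentzC (hgoodI s hs).1)
      (isInvertible_lorentzC (hgoodI s hs).1 (hN _ (hgoodI s hs).1.2 _))
      (S.lorentzC_symm (hgoodI s hs).1.2) (hyI s hs)
  set s₀ := (α + b) / 2 with hs₀
  have hs₀b : s₀ ∈ Ioo α b := ⟨by linarith [hα.2], by linarith [hα.2]⟩
  have hs₀I : s₀ ∈ I := ⟨hs₀b.1, hs₀b.2.trans hbb'⟩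
  have hκI : ∀ s ∈ I, κ (S.lorentzC q (y' s).1 (y' s).2 (y' s).2) := fun s hs => by
    have h1 := isOpen_Ioo.is_const_of_deriv_eq_zero isPreconnected_Ioo
      (fun r hr => (hsq r hr).differentiableAt.differentiableWithinAt)
      (fun r hr => (hsq r hr).deriv) hs hs₀I
    rw [h1, hyy hs₀b]
    exact ((hc s₀ (hsub hs₀b)).2.2 q (hαb hs₀b).1).2.1
  have hnew : ∀ s ∈ I, S.GeodesicAt κ (chartCurve n q y') univ s := fun s hs =>
    geodesicAt_chartCurve isOpen_Ioo hN hyI (fun r hr => (hgoodI r hr).1)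
      (fun r hr => (hgoodI r hr).2) hκI hs
  refine ⟨b', hbb', fun s => if s < b then c s else chartCurve n q y' s, fun s hs => ?_,
    fun s hs => if_pos hs.2⟩
  rcases lt_or_ge s b with h | h
  · have h1 : Ico a b' =ᶠ[𝓝 s] J := by
      filter_upwards [Iio_mem_nhds h] with r hr
      exact propext ⟨fun h => ⟨h.1, hr⟩, fun h => ⟨h.1, h.2.trans hbb'⟩⟩
    refine ((hc s ⟨hs.1, h⟩).congr ⟨hs.1, h⟩ ?_).congr_set h1
    filter_upwards [nhdsWithin_le_nhds (Iio_mem_nhds h)] with r hr using if_pos hr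
  · have hsI : s ∈ I := ⟨hα.2.trans_le h, hs.2⟩
    have h1 : Ico a b' =ᶠ[𝓝 s] univ := by
      rw [eventuallyEq_univ]
      exact Ico_mem_nhds (hab.trans_le h) hs.2
    refine ((hnew s hsI).congr (mem_univ s) ?_).congr_set h1
    rw [nhdsWithin_univ]
    filter_upwards [Ioo_mem_nhds hsI.1 hsI.2] with r hr
    rcases lt_or_ge r b with h' | h'
    · rw [if_pos h', chartCurve, hyy ⟨hr.1, h'⟩]
      exact Prod.ext (symm_curveC (hαb ⟨hr.1, h'⟩).1).symm rfl
    · exact if_neg h'.not_gt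

/-! ### Maximal continuations -/

/-- Curves on intervals `[a, p.1)` which continue one another fit together. -/
theorem exists_union_of_chain {X : Type*} {a : ℝ} {𝒞 : Set (ℝ × (ℝ → X))} (hne : 𝒞.Nonempty)
    (h𝒞 : ∀ p ∈ 𝒞, ∀ p' ∈ 𝒞, (p.1 ≤ p'.1 ∧ EqOn p'.2 p.2 (Ico a p.1)) ∨
      (p'.1 ≤ p.1 ∧ EqOn p.2 p'.2 (Ico a p'.1))) :
    ∃ c : ℝ → X, ∀ p ∈ 𝒞, EqOn c p.2 (Ico a p.1) := by
  classical
  obtain ⟨p₀, -⟩ := hne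
  refine ⟨fun s => if h : ∃ p ∈ 𝒞, s < p.1 then h.choose.2 s else p₀.2 s, fun p hp s hs => ?_⟩
  have h : ∃ p ∈ 𝒞, s < p.1 := ⟨p, hp, hs.2⟩
  simp only [dif_pos h]
  obtain ⟨h1, h2⟩ := h.choose_spec
  rcases h𝒞 p hp _ h1 with h3 | h3
  · exact h3.2 hs
  · exact (h3.2 ⟨hs.1, h2⟩).symm

/-- If the geodesics on bounded intervals can be continued, then they can be continued for ever. -/
theorem exists_geodesicAt_Ici [T2Space M] {S : SplitMetric n M t₀} (hS : S.HasIntegrableBounds)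
    (hslice : S.SliceComplete) {κ : ℝ → Prop} (hκ : ∀ x, κ x → x ≤ 0) {c : ℝ → M × ℝ} {a b : ℝ}
    (hab : a < b) (hc : ∀ s ∈ Ico a b, S.GeodesicAt κ c (Ico a b) s) :
    ∃ c' : ℝ → M × ℝ, (∀ s ∈ Ici a, S.GeodesicAt κ c' (Ici a) s) ∧ EqOn c' c (Ico a b) := by
  by_contra hno
  let P := {p : ℝ × (ℝ → M × ℝ) // b ≤ p.1 ∧
    (∀ s ∈ Ico a p.1, S.GeodesicAt κ p.2 (Ico a p.1) s) ∧ EqOn p.2 c (Ico a b)}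
  let r : P → P → Prop := fun p p' => p.1.1 ≤ p'.1.1 ∧ EqOn p'.1.2 p.1.2 (Ico a p.1.1)
  have htrans : ∀ {p₁ p₂ p₃ : P}, r p₁ p₂ → r p₂ p₃ → r p₁ p₃ := fun h h' =>
    ⟨h.1.trans h'.1, fun s hs => (h'.2 ⟨hs.1, hs.2.trans_le h.1⟩).trans (h.2 hs)⟩
  have hchain : ∀ 𝒞 : Set P, IsChain r 𝒞 → ∃ ub, ∀ p ∈ 𝒞, r p ub := by
    intro 𝒞 h𝒞
    rcases 𝒞.eq_empty_or_nonempty with rfl | hne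
    · exact ⟨⟨(b, c), le_rfl, hc, fun s _ => rfl⟩, fun p hp => absurd hp (notMem_empty p)⟩
    obtain ⟨c', hc'⟩ := exists_union_of_chain (a := a) (𝒞 := Subtype.val '' 𝒞) (hne.image _) (by
      rintro _ ⟨p, hp, rfl⟩ _ ⟨p', hp', rfl⟩
      rcases eq_or_ne p p' with rfl | hpp
      · exact Or.inl ⟨le_rfl, fun s _ => rfl⟩
      · exact h𝒞 hp hp' hpp)
    have hgeo : ∀ p ∈ 𝒞, ∀ s ∈ Ico a p.1.1, ∀ J : Set ℝ, J =ᶠ[𝓝 s] Ico a p.1.1 →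
        S.GeodesicAt κ c' J s := fun p hp s hs J hJ => by
      refine ((p.2.2.1 s hs).congr hs ?_).congr_set hJ
      filter_upwards [self_mem_nhdsWithin] with r hr using hc' _ (mem_image_of_mem _ hp) hr
    have heq : EqOn c' c (Ico a b) := by
      obtain ⟨p, hp⟩ := hne
      exact fun s hs => (hc' _ (mem_image_of_mem _ hp) ⟨hs.1, hs.2.trans_le p.2.1⟩).trans
        (p.2.2.2 hs)
    by_cases hbdd : BddAbove ((fun p : P => p.1.1) '' 𝒞)
    · set B := sSup ((fun p : P => p.1.1) '' 𝒞) with hB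
      have hle : ∀ p ∈ 𝒞, p.1.1 ≤ B := fun p hp => le_csSup hbdd (mem_image_of_mem _ hp)
      refine ⟨⟨(B, c'), ?_, fun s hs => ?_, heq⟩,
        fun p hp => ⟨hle p hp, hc' _ (mem_image_of_mem _ hp)⟩⟩
      · obtain ⟨p, hp⟩ := hne
        exact p.2.1.trans (hle p hp)
      · obtain ⟨_, ⟨p, hp, rfl⟩, hsp⟩ := exists_lt_of_lt_csSup (hne.image _) hs.2
        refine hgeo p hp s ⟨hs.1, hsp⟩ _ ?_
        filter_upwards [Iio_mem_nhds hsp] with r hr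
        exact propext ⟨fun h => ⟨h.1, hr⟩, fun h => ⟨h.1, h.2.trans_le (hle p hp)⟩⟩
    · refine absurd ⟨c', fun s hs => ?_, heq⟩ hno
      obtain ⟨_, ⟨p, hp, rfl⟩, hsp⟩ := not_bddAbove_iff.1 hbdd s
      refine hgeo p hp s ⟨hs, hsp⟩ _ ?_
      filter_upwards [Iio_mem_nhds hsp] with r hr
      exact propext ⟨fun h => ⟨h, hr⟩, fun h => h.1⟩
  obtain ⟨m, hm⟩ := exists_maximal_of_chains_bounded hchain htrans
  obtain ⟨b', hb', c', hc', heq⟩ := exists_continuation hS hslice hκ (hab.trans_le m.2.1) m.2.2.1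
  have h := hm ⟨(b', c'), m.2.1.trans hb'.le, hc', fun s hs =>
    (heq ⟨hs.1, hs.2.trans_le m.2.1⟩).trans (m.2.2.2 hs)⟩ ⟨hb'.le, heq⟩
  exact absurd h.1 (not_le.2 hb')

end SplitMetric

theorem theorem3 (n : ℕ) (M : Type*) [TopologicalSpace M]
    [ChartedSpace (EuclideanSpace ℝ (Fin n)) M] [IsManifold (𝓡 n) ∞ M]
    [T2Space M] [SecondCountableTopology M] (t₀ : ℝ) (S : SplitMetric n M t₀)
    (hlapse : S.BoundedLapse) (hslice : S.SliceComplete)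
    (hgrad : ∀ t₁, t₀ < t₁ → ∃ f : ℝ → ℝ, IntegrableOn f (Ici t₁) ∧
      ∀ t, t₁ ≤ t → ∀ x : M, S.normGradLapse t x ≤ f t)
    (hcurv : ∀ t₁, t₀ < t₁ → ∃ f : ℝ → ℝ, IntegrableOn f (Ici t₁) ∧
      ∀ t, t₁ ≤ t → ∀ x : M, S.normExtrinsicCurvature t x ≤ f t) :
    S.FutureTimelikeComplete ∧ S.FutureNullComplete ∧
    ∀ (a : ℝ) (c : ℝ → M × ℝ),
      (S.IsFutureTimelikeGeodesicOn c (Ici a) ∨ S.IsFutureNullGeodesicOn c (Ici a)) →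
      ∃ C : ℝ, ∀ s, a ≤ s → SplitMetric.timeRate c (Ici a) s ≤ C := by
  have hS : S.HasIntegrableBounds := ⟨hlapse, hgrad, hcurv⟩
  refine ⟨fun a b c hab hc => ?_, fun a b c hab hc => ?_, fun a c hc => ?_⟩
  · obtain ⟨c', hc', heq⟩ := SplitMetric.exists_geodesicAt_Ici hS hslice (κ := (· < 0))
      (fun x hx => le_of_lt hx) hab
      ((SplitMetric.forall_geodesicAt_iff (uniqueDiffOn_Ico a b)).2 hc)
    exact ⟨c', (SplitMetric.forall_geodesicAt_iff (uniqueDiffOn_Ici a)).1 hc', heq⟩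
  · obtain ⟨c', hc', heq⟩ := SplitMetric.exists_geodesicAt_Ici hS hslice (κ := (· = 0))
      (fun x hx => le_of_eq hx) hab
      ((SplitMetric.forall_geodesicAt_iff (uniqueDiffOn_Ico a b)).2 hc)
    exact ⟨c', (SplitMetric.forall_geodesicAt_iff (uniqueDiffOn_Ici a)).1 hc', heq⟩
  · have hcaus : S.IsFutureCausalGeodesicOn c (Ici a) := by
      rcases hc with hc | hc
      · exact ⟨hc.1, fun s hs => ⟨(hc.2 s hs).1.le, (hc.2 s hs).2⟩⟩
      · exact ⟨hc.1, fun s hs => ⟨(hc.2 s hs).1.le, (hc.2 s hs).2⟩⟩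
    obtain ⟨_, -, C, -, h⟩ := SplitMetric.exists_timeRate_bounds hS (uniqueDiffOn_Ici a) hcaus
      self_mem_Ici fun s hs => ⟨hs, Icc_subset_Ici_self⟩
    exact ⟨C, fun s hs => (h s hs).2.1⟩

end
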